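/- **Setting.** A (simple) polygon $P$ is the straight-line planar embedding of a cycle with at least three pairwise distinct corners in $\mathbb{R}^2$ (the relative interior of an edge contains no point of another closed edge; straight angles at corners are allowed). $\mathrm{Int}(P)$ is the bounded region it encloses, $\mathrm{area}(P)$ the area of that region. Let $\mathcal P$ be a finite set of polygons, distinct members being distinct as closed curves, that is *overlap-free*: for all $P,P'\in\mathcal P$, $\mathrm{Int}(P)\cap\mathrm{Int}(P')\in\{\mathrm{Int}(P),\mathrm{Int}(P'),\emptyset\}$ (boundaries may touch, also along edges). The *nesting forest* $\mathcal F(\mathcal P)$ is the Hasse diagram of the sets $\mathrm{Int}(P)$, $P\in\mathcal P$, with respect to inclusion; its roots are the inclusion-maximal members, and $P'$ is the parent of $P$ if $\mathrm{Int}(P)\subsetneq\mathrm{Int}(P')$ with no member strictly in between. Its parent function sends roots to $\emptyset$ and every other $P$ to its parent. For an edge, subpath or polygon $W$ write $I(W)=[\min_x W,\max_x W)$ and $I^\circ(W)=(\min_x W,\max_x W)$, the minimum and maximum being taken over the $x$-coordinates of its corners. A *segment* of $P$ is a subpath $S$ of its cycle. It is *outstretched* if $I(e)\cap I(f)=\emptyset$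 for any two distinct edges $e,f$ of $S$ and its terminal edges are not vertical; it is *maximal outstretched* if it is outstretched and not a proper subpath of an outstretched segment of $P$. For $\xi\in I(S)$ there is exactly one edge $e$ of $S$ with $\xi\in I(e)$; let $y_S(\xi)$ be the $y$-coordinate of $e$ at $\xi$ and $\Delta_S(\xi)$ the slope of $e$. The *parity* $\varpi(S,P)$ of a maximal outstretched segment $S$ of $P$ is $0$ if for all $\xi\in I^\circ(S)$ the number of maximal outstretched segments $S'$ of $P$ with $\xi\in I(S')$ and $y_{S'}(\xi)\ge y_S(\xi)$ is even, and $1$ otherwise. For $\xi\in\mathbb R$ let $\mathcal S_\xi$ be the set of pairs $(S,P)$ with $P\in\mathcal P$, $S$ a maximal outstretched segment of $P$ and $\xi\in I(S)$. On $\mathcal S_\xi$ put $(S',P')\lessdot_\xi(S,P)$ if $y_{S'}(\xi)>y_S(\xi)$; or $y_{S'}(\xi)=y_S(\xi)$ and $\Delta_{S'}(\xi)>\Delta_S(\xi)$; or both values agree and one of the following holds: $\varpi(S',P')=0$ and $\varpi(S,P)=1$; $\varpi(S',P')=\varpi(S,P)=1$ and $\mathrm{area}(P)<\mathrm{area}(P')$;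 $\varpi(S',P')=\varpi(S,P)=0$ and $\mathrm{area}(P)>\mathrm{area}(P')$. **Procedure at $\xi$.** Starting with no parent assigned, go through $(S,P)\in\mathcal S_\xi$ from small to large with respect to $\lessdot_\xi$. If $(S,P)$ is $\lessdot_\xi$-minimal among the pairs of $\mathcal S_\xi$ belonging to $P$, then: (a) if $(S,P)$ is $\lessdot_\xi$-minimal in $\mathcal S_\xi$, set $\mathrm{parent}(P)\leftarrow\emptyset$; (b) if its $\lessdot_\xi$-predecessor $(S',P')$ in $\mathcal S_\xi$ has $\varpi(S',P')=1$, set $\mathrm{parent}(P)\leftarrow P'$; (c) if its $\lessdot_\xi$-predecessor $(S',P')$ has $\varpi(S',P')=0$, set $\mathrm{parent}(P)\leftarrow\mathrm{parent}(P')$. **Proposition.** The nesting forest $\mathcal F(\mathcal P)$ has a parent function, and for every finite set $X\subset\mathbb R$ that meets $I(P)=[\min_x P,\max_x P)$ for every $P\in\mathcal P$ the following holds. For every $\xi\in X$, $\lessdot_\xi$ is a strict total order on the finite set $\mathcal S_\xi$, and the procedure at $\xi$ assigns a parent exactly to those $P\in\mathcal P$ with $\xi\in I(P)$. The union, over $\xi\in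 X$, of all the parent assignments made is exactly the parent function of $\mathcal F(\mathcal P)$. In particular, $X=\{\min_x P: P\in\mathcal P\}$ meets every $I(P)$, so the conclusion holds for it. -/

import Mathlib

open Set MeasureTheory

namespace Nesting

/-! ### Overlap-free families of sets -/

/-- Two sets overlap when their intersection is neither of them and is not empty. -/
def Overlap {α : Type*} (A B : Set α) : Prop :=
  A ∩ B ≠ A ∧ A ∩ B ≠ B ∧ A ∩ B ≠ ∅

/-- A family of sets is overlap-free when no two of its members overlap. -/
def OverlapFree {α : Type*} (C : Set (Set α)) : Prop :=
  ∀ A ∈ C, ∀ B ∈ C, ¬ Overlap A B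

/-! ### Intervals on the `x`-axis spanned by a finite nonempty set of points -/

/-- The half-open interval `[min_{v ∈ W} v_x, max_{v ∈ W} v_x)`, for finite nonempty `W`. -/
def spanIco (W : Set (ℝ × ℝ)) : Set ℝ :=
  {ξ | (∃ v ∈ W, v.1 ≤ ξ) ∧ ∃ w ∈ W, ξ < w.1}

/-- The open interval `(min_{v ∈ W} v_x, max_{v ∈ W} v_x)`, for finite nonempty `W`. -/
def spanIoo (W : Set (ℝ × ℝ)) : Set ℝ :=
  {ξ | (∃ v ∈ W, v.1 < ξ) ∧ ∃ w ∈ W, ξ < w.1}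

/-! ### Simple polygons -/

/-- A (simple) polygon: a straight-line embedding of a cycle, given by the cyclic sequence of its
pairwise distinct corners. Edge `i` joins corner `i` to the cyclically next corner. The embedding
is planar: the relative interior of an edge contains no point of another (closed) edge. Corners
with a straight angle are allowed. -/
structure SimplePolygon where
  n : ℕ
  three_le : 3 ≤ n
  poly : Polygon (ℝ × ℝ) n
  injective : Function.Injective poly.vertices
  planar : ∀ i j : Fin n, i ≠ j →
    Disjoint (openSegment ℝ (poly i) (poly (finRotate n i))) (poly.edgeSet ℝ j)

namespace SimplePolygon

/-- The set `V(P)` of corners. -/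
def corners (Q : SimplePolygon) : Set (ℝ × ℝ) := Set.range Q.poly.vertices

/-- The polygonal curve. -/
def curve (Q : SimplePolygon) : Set (ℝ × ℝ) := Q.poly.boundary ℝ

/-- `Int(P)`, the region enclosed by the polygon: the points off the curve whose connected
component in the complement of the curve is bounded. -/
def inside (Q : SimplePolygon) : Set (ℝ × ℝ) :=
  {p | p ∉ Q.curve ∧ Bornology.IsBounded (connectedComponentIn Q.curveᶜ p)}

/-- The area of the enclosed region (two-dimensional Lebesgue measure). -/
noncomputable def area (Q : SimplePolygon) : ENNReal := volume Q.inside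

/-- The interval `[min_x P, max_x P)`. -/
def xIco (Q : SimplePolygon) : Set ℝ := spanIco Q.corners

/-- `min_x P`, the smallest `x`-coordinate of a corner. -/
noncomputable def minX (Q : SimplePolygon) : ℝ := ⨅ i : Fin Q.n, (Q.poly i).1

/-- The two endpoints of edge `i`. -/
def edgeEnds (Q : SimplePolygon) (i : Fin Q.n) : Set (ℝ × ℝ) :=
  {Q.poly i, Q.poly (finRotate Q.n i)}

/-- The half-open `x`-interval of edge `i`; it is empty exactly for vertical edges. -/
def edgeIco (Q : SimplePolygon) (i : Fin Q.n) : Set ℝ := spanIco (Q.edgeEnds i)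

/-- Edge `i` is vertical. -/
def EdgeVertical (Q : SimplePolygon) (i : Fin Q.n) : Prop :=
  (Q.poly i).1 = (Q.poly (finRotate Q.n i)).1

/-- The slope of a non-vertical edge. -/
noncomputable def edgeSlope (Q : SimplePolygon) (i : Fin Q.n) : ℝ :=
  ((Q.poly (finRotate Q.n i)).2 - (Q.poly i).2) / ((Q.poly (finRotate Q.n i)).1 - (Q.poly i).1)

/-- The `y`-coordinate, at abscissa `ξ`, of the line through a non-vertical edge. -/
noncomputable def edgeY (Q : SimplePolygon) (i : Fin Q.n) (ξ : ℝ) : ℝ :=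
  (Q.poly i).2 + Q.edgeSlope i * (ξ - (Q.poly i).1)

/-- A segment of a polygon with `n` corners, that is, a subpath of the cycle: it has the corners
`start, …, start + len` and the edges `start, …, start + len - 1` (indices taken cyclically).
Since `len ≤ n - 1`, each subpath is represented exactly once. -/
structure Segment (Q : SimplePolygon) where
  start : Fin Q.n
  len : Fin Q.n

namespace Segment

variable {Q : SimplePolygon}

/-- The index reached from the start of the segment after `k` steps along the cycle. -/
def idx (S : Segment Q) (k : ℕ) : Fin Q.n := (⇑(finRotate Q.n))^[k] S.start

/-- Indices of the corners of the segment. -/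
def vertexIdx (S : Segment Q) : Set (Fin Q.n) := {i | ∃ k ≤ S.len.val, i = S.idx k}

/-- Indices of the edges of the segment. -/
def edgeIdx (S : Segment Q) : Set (Fin Q.n) := {i | ∃ k < S.len.val, i = S.idx k}

/-- The set `V(S)` of corners of the segment. -/
def corners (S : Segment Q) : Set (ℝ × ℝ) := Q.poly.vertices '' S.vertexIdx

/-- The half-open `x`-interval of the segment. -/
def xIco (S : Segment Q) : Set ℝ := spanIco S.corners

/-- The open `x`-interval of the segment. -/
def xIoo (S : Segment Q) : Set ℝ := spanIoo S.corners

/-- Property (O): the half-open `x`-intervals of distinct edges are disjoint. -/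
def PropO (S : Segment Q) : Prop :=
  ∀ e ∈ S.edgeIdx, ∀ f ∈ S.edgeIdx, e ≠ f → Q.edgeIco e ∩ Q.edgeIco f = ∅

/-- A segment is outstretched if it satisfies (O) and its terminal edges (the first and the last
one, if there are edges at all) are not vertical. -/
def Outstretched (S : Segment Q) : Prop :=
  S.PropO ∧ (0 < S.len.val →
    ¬ Q.EdgeVertical (S.idx 0) ∧ ¬ Q.EdgeVertical (S.idx (S.len.val - 1)))

/-- `S` is a proper subpath of `S'`. -/
def ProperSub (S S' : Segment Q) : Prop :=
  S.vertexIdx ⊆ S'.vertexIdx ∧ S.edgeIdx ⊆ S'.edgeIdx ∧ S ≠ S'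

/-- Maximal outstretched segments of the polygon. -/
def MaxOutstretched (S : Segment Q) : Prop :=
  S.Outstretched ∧ ¬ ∃ S' : Segment Q, S'.Outstretched ∧ S.ProperSub S'

open Classical in
/-- For an outstretched segment `S` and `ξ` in its half-open `x`-interval, the unique edge of `S`
whose half-open `x`-interval contains `ξ`. -/
noncomputable def activeEdge (S : Segment Q) (ξ : ℝ) : Fin Q.n :=
  if h : ∃ e ∈ S.edgeIdx, ξ ∈ Q.edgeIco e then h.choose else S.start

/-- The `y`-coordinate of `S` at `ξ`. -/
noncomputable def yVal (S : Segment Q) (ξ : ℝ) : ℝ := Q.edgeY (S.activeEdge ξ) ξ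

/-- The slope of `S` at `ξ`. -/
noncomputable def slope (S : Segment Q) (ξ : ℝ) : ℝ := Q.edgeSlope (S.activeEdge ξ)

/-- The maximal outstretched segments of the polygon that meet the vertical line at `ξ` at or above
`S` (the segment `S` included). -/
def above (S : Segment Q) (ξ : ℝ) : Set (Segment Q) :=
  {S' | S'.MaxOutstretched ∧ ξ ∈ S'.xIco ∧ S.yVal ξ ≤ S'.yVal ξ}

open Classical in
/-- The parity of a maximal outstretched segment. -/
noncomputable def parity (S : Segment Q) : ℕ :=
  if ∀ ξ ∈ S.xIoo, Even (S.above ξ).ncard then 0 else 1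

end Segment

end SimplePolygon

/-! ### Families of polygons: nesting forest -/

variable {ι : Type*}

/-- The nesting forest of a family of polygons: the Hasse diagram of the enclosed regions with
respect to inclusion, with polygons identified with the regions they enclose. -/
def nestingForest (P : ι → SimplePolygon) : SimpleGraph ι where
  Adj i j :=
    ((P i).inside ⊂ (P j).inside ∧
      ¬ ∃ k, (P i).inside ⊂ (P k).inside ∧ (P k).inside ⊂ (P j).inside) ∨
    ((P j).inside ⊂ (P i).inside ∧
      ¬ ∃ k, (P j).inside ⊂ (P k).inside ∧ (P k).inside ⊂ (P i).inside)
  symm := ⟨fun _ _ h => h.symm⟩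
  loopless := ⟨fun _ h => h.elim (fun h => (ssubset_irrefl _ h.1)) fun h => (ssubset_irrefl _ h.1)⟩

/-- The roots of the nesting forest are the inclusion-maximal members. -/
def IsRoot (P : ι → SimplePolygon) (i : ι) : Prop :=
  ¬ ∃ j, (P i).inside ⊂ (P j).inside

/-- `j` is a parent of `i` in the nesting forest. -/
def IsParent (P : ι → SimplePolygon) (j i : ι) : Prop :=
  (nestingForest P).Adj i j ∧ (P i).inside ⊂ (P j).inside

/-- `par` is the parent function of the nesting forest; the value `none` marks the roots. -/
def IsParentFunction (P : ι → SimplePolygon) (par : ι → Option ι) : Prop :=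
  ∀ i, (par i = none ↔ IsRoot P i) ∧ ∀ j, par i = some j ↔ IsParent P j i

/-! ### The order along a sweep line -/

/-- Pairs `(S, P)` of a segment and the polygon it is taken from. -/
abbrev SegPair (P : ι → SimplePolygon) : Type _ := Σ i : ι, (P i).Segment

/-- The pairs `(S, P)` with `S` a maximal outstretched segment of `P` whose half-open `x`-interval
contains `ξ`. -/
def sweepSet (P : ι → SimplePolygon) (ξ : ℝ) : Set (SegPair P) :=
  {s | s.2.MaxOutstretched ∧ ξ ∈ s.2.xIco}

/-- The relation `s' ⋖_ξ s` on the segments met by the sweep line at `ξ`. -/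
def SweepLT (P : ι → SimplePolygon) (ξ : ℝ) (s' s : SegPair P) : Prop :=
  s.2.yVal ξ < s'.2.yVal ξ ∨
  (s'.2.yVal ξ = s.2.yVal ξ ∧
    (s.2.slope ξ < s'.2.slope ξ ∨
    (s'.2.slope ξ = s.2.slope ξ ∧
      ((s'.2.parity = 0 ∧ s.2.parity = 1) ∨
       (s'.2.parity = 1 ∧ s.2.parity = 1 ∧ (P s.1).area < (P s'.1).area) ∨
       (s'.2.parity = 0 ∧ s.2.parity = 0 ∧ (P s'.1).area < (P s.1).area)))))

/-- `s` is the `⋖_ξ`-minimal element of `sweepSet P ξ`. -/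
def IsFirst (P : ι → SimplePolygon) (ξ : ℝ) (s : SegPair P) : Prop :=
  s ∈ sweepSet P ξ ∧ ∀ t ∈ sweepSet P ξ, t ≠ s → SweepLT P ξ s t

/-- `s` is `⋖_ξ`-minimal with respect to its polygon. -/
def IsFirstOfPolygon (P : ι → SimplePolygon) (ξ : ℝ) (s : SegPair P) : Prop :=
  s ∈ sweepSet P ξ ∧ ∀ t ∈ sweepSet P ξ, t.1 = s.1 → t ≠ s → SweepLT P ξ s t

/-- `t` is the `⋖_ξ`-predecessor of `s`. -/
def IsPred (P : ι → SimplePolygon) (ξ : ℝ) (t s : SegPair P) : Prop :=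
  t ∈ sweepSet P ξ ∧ SweepLT P ξ t s ∧
    ¬ ∃ u ∈ sweepSet P ξ, SweepLT P ξ t u ∧ SweepLT P ξ u s

/-! ### The single-sweep-line procedure -/

/-- `L` lists the elements of `sweepSet P ξ`, without repetition, from small to large with respect
to `⋖_ξ`. -/
def IsSweepList (P : ι → SimplePolygon) (ξ : ℝ) (L : List (SegPair P)) : Prop :=
  L.Nodup ∧ (∀ s, s ∈ L ↔ s ∈ sweepSet P ξ) ∧ L.Pairwise (SweepLT P ξ)

open Classical in
/-- One step of the procedure, processing `s`. The state records the parents assigned so far: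
`none` means not yet assigned, `some none` that the polygon is a root, and `some (some j)` that its
parent is `j`. -/
noncomputable def sweepStep (P : ι → SimplePolygon) (ξ : ℝ)
    (state : ι → Option (Option ι)) (s : SegPair P) : ι → Option (Option ι) :=
  if IsFirstOfPolygon P ξ s then
    if IsFirst P ξ s then Function.update state s.1 (some none)
    else if h : ∃ t, IsPred P ξ t s then
      if h.choose.2.parity = 1 then Function.update state s.1 (some (some h.choose.1))
      else Function.update state s.1 (state h.choose.1)
    else state
  else state

/-- The state after processing the whole list, starting with nothing assigned. -/
noncomputable def runSweep (P : ι → SimplePolygon) (ξ : ℝ) (L : List (SegPair P)) :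
    ι → Option (Option ι) :=
  L.foldl (sweepStep P ξ) fun _ => none

/-- The procedure run at `ξ` ends with `parent(P i) = r`. -/
def SweepAssigns (P : ι → SimplePolygon) (ξ : ℝ) (i : ι) (r : Option ι) : Prop :=
  ∃ L, IsSweepList P ξ L ∧ runSweep P ξ L i = some r

/-- Every polygon is met by a sweep line: some `ξ ∈ X` lies in `[min_x P, max_x P)`. -/
def MeetsAll (P : ι → SimplePolygon) (X : Set ℝ) : Prop :=
  ∀ i, ∃ ξ ∈ X, ξ ∈ (P i).xIco

/-- Running the procedure at all positions in `X` yields the parent function `par`: at each position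
`⋖_ξ` is a strict total order on the segments met, these can be listed in increasing order, and the
run assigns a parent to each polygon `P` met there, that is, with `ξ ∈ [min_x P, max_x P)`, and to
no other; and the union over `X` of all the assignments made is exactly `par`. -/
def SweepComputes (P : ι → SimplePolygon) (X : Set ℝ) (par : ι → Option ι) : Prop :=
  (∀ ξ ∈ X, IsStrictTotalOrder (sweepSet P ξ) (fun s t => SweepLT P ξ s t) ∧
    (∃ L, IsSweepList P ξ L) ∧
    ∀ i, (∃ r, SweepAssigns P ξ i r) ↔ ξ ∈ (P i).xIco) ∧
  ∀ i r, (∃ ξ ∈ X, SweepAssigns P ξ i r) ↔ par i = r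

end Nesting

namespace Nesting

open Filter Topology

/-! ### Iterating the rotation of `Fin n` -/

/-! The geometry enters through one fact: a maximal outstretched segment of parity 1 has the
interior of its polygon just below it, one of parity 0 has it just above. Given this, a single
vertical line carries enough information to recover every parent.

The fact rests on the Jordan curve theorem for polygons, proved by counting edges above a point
modulo 2 (`crossSum`). This parity is locally constant off the curve (`eventually_crossSum_eq`).
Near each of its points the curve cuts a disc into two connected pieces (`curve_locally_splits`), so
the closure of every complementary component contains the whole curve (`subset_closure_component`).
Hence there are just two components, told apart by parity, and the odd one is the bounded one
(`mem_inside_iff`). The same local constancy, applied while moving along a segment and counting only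
the edges outside it, shows that the parity of a segment can be read off at any abscissa strictly
between its ends (`parity_eq_zero_iff`).

An arbitrary `ξ` is replaced by a generic `ξ'` slightly to its right: the same segments are met, and
height followed by slope at `ξ` becomes height at `ξ'` (`IsJustRight.sweepLT_iff`). Distinct
polygons may still share edges; then their interiors lie on opposite sides or are nested, and area
decides between nested ones because strict inclusion of interiors forces strict inequality of areas
(`area_lt_of_inside_ssubset`).

What remains is combinatorics on a line (`LineCrossings`). Let `s` be the first crossing of its
polygon and `t` the crossing just before it. If `t` has parity 1, the line stays in the region of
`t` down to `s`, and that region is the parent (`FirstOfPol.parent_of_pred_par_one`). If `t` has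
parity 0, the regions of `s` and `t` have the same strict supersets, hence the same parent
(`FirstOfPol.ssubset_iff_of_pred_par_zero`). Induction along the sorted list finishes the proof
(`SweepCorrect.foldl_eq`). -/

theorem val_finRotate_iterate {n : ℕ} (i : Fin n) (k : ℕ) :
    ((⇑(finRotate n))^[k] i).val = (i.val + k) % n := by
  obtain _ | n := n
  · exact i.elim0
  induction k with
  | zero => simp [Nat.mod_eq_of_lt i.isLt]
  | succ k ih =>
    rw [Function.iterate_succ_apply', finRotate_apply, Fin.val_add, ih, Fin.val_one', ← Nat.add_mod,
      add_assoc]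

theorem finRotate_iterate_eq_iff {n : ℕ} (i : Fin n) (k l : ℕ) :
    (⇑(finRotate n))^[k] i = (⇑(finRotate n))^[l] i ↔ k ≡ l [MOD n] := by
  rw [Fin.ext_iff, val_finRotate_iterate, val_finRotate_iterate]
  exact ⟨fun h => Nat.ModEq.add_left_cancel' i.val h, fun h => Nat.ModEq.add_left i.val h⟩

theorem exists_finRotate_iterate_eq {n : ℕ} (i j : Fin n) :
    ∃ k < n, (⇑(finRotate n))^[k] i = j := by
  have hn : 0 < n := i.pos
  refine ⟨(j.val + (n - i.val)) % n, Nat.mod_lt _ hn, ?_⟩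
  rw [Fin.ext_iff, val_finRotate_iterate, Nat.add_mod_mod]
  have : i.val + (j.val + (n - i.val)) = j.val + n := by have := i.isLt; omega
  rw [this, Nat.add_mod_right, Nat.mod_eq_of_lt j.isLt]

theorem finRotate_ne_self {n : ℕ} (hn : 2 ≤ n) (i : Fin n) : finRotate n i ≠ i := by
  intro h
  have := (finRotate_iterate_eq_iff i 1 0).1 (by simpa using h)
  rw [Nat.ModEq, Nat.mod_eq_of_lt (by omega), Nat.zero_mod] at this
  omega

/-! ### Finite real sequences whose steps cover disjoint intervals -/

/-- The half-open intervals spanned by distinct steps of the sequence `f 0, …, f L` are disjoint. -/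
def StepsDisjoint (f : ℕ → ℝ) (L : ℕ) : Prop :=
  ∀ i < L, ∀ j < L, i ≠ j → ∀ ξ, ¬ (f i ≤ ξ ↔ f (i + 1) ≤ ξ) → (f j ≤ ξ ↔ f (j + 1) ≤ ξ)

/-- Used with `p i` being `f i ≤ ξ`: the half-open interval of a step, whichever way it runs,
contains `ξ` exactly when this predicate changes along the step. -/
theorem iff_of_forall_step {p : ℕ → Prop} {a b : ℕ} (hab : a ≤ b)
    (h : ∀ i, a ≤ i → i < b → (p i ↔ p (i + 1))) : p a ↔ p b := by
  induction b, hab using Nat.le_induction with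
  | base => rfl
  | succ b hb ih =>
    exact (ih fun i h1 h2 => h i h1 (by omega)).trans (h b hb (by omega))

theorem exists_step_of_not_iff {p : ℕ → Prop} {a b : ℕ} (hab : a ≤ b) (h : ¬ (p a ↔ p b)) :
    ∃ i, a ≤ i ∧ i < b ∧ ¬ (p i ↔ p (i + 1)) := by
  by_contra! hc
  exact h (iff_of_forall_step hab fun i h1 h2 => hc i h1 h2)

theorem StepsDisjoint.iff_left {f : ℕ → ℝ} {L k i : ℕ} (h : StepsDisjoint f L) (hk : k < L)
    {ξ : ℝ} (hξ : ¬ (f k ≤ ξ ↔ f (k + 1) ≤ ξ)) (hi : i ≤ k) : f i ≤ ξ ↔ f k ≤ ξ :=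
  iff_of_forall_step (p := fun i => f i ≤ ξ) hi fun j _ hj =>
    h k hk j (by omega) (by omega) ξ hξ

theorem StepsDisjoint.iff_right {f : ℕ → ℝ} {L k i : ℕ} (h : StepsDisjoint f L) (hk : k < L)
    {ξ : ℝ} (hξ : ¬ (f k ≤ ξ ↔ f (k + 1) ≤ ξ)) (hi : k < i) (hiL : i ≤ L) :
    f (k + 1) ≤ ξ ↔ f i ≤ ξ :=
  iff_of_forall_step (p := fun i => f i ≤ ξ) hi fun j hj hji =>
    h k hk j (by omega) (by omega) ξ hξ

/-- An ascending step is a barrier: no other step covers a point of its interval, so the path can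
never return across it. -/
theorem StepsDisjoint.le_of_lt_step {f : ℕ → ℝ} {L k : ℕ} (h : StepsDisjoint f L) (hk : k < L)
    (hlt : f k < f (k + 1)) :
    (∀ i ≤ k, f i ≤ f k) ∧ ∀ i, k < i → i ≤ L → f (k + 1) ≤ f i := by
  have key : ∀ ξ, f k ≤ ξ → ξ < f (k + 1) → ¬ (f k ≤ ξ ↔ f (k + 1) ≤ ξ) := by
    intro ξ h1 h2 h3
    exact absurd (h3.1 h1) (not_le.2 h2)
  refine ⟨fun i hi => (h.iff_left hk (key _ le_rfl hlt) hi).2 le_rfl, fun i hi hiL => ?_⟩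
  by_contra! hc
  -- This maximum lies in the interval of step `k` and is at least `f i`, so `f i` would be on the
  -- wrong side of it.
  have h1 : max (f k) (f i) < f (k + 1) := max_lt hlt hc
  have := (h.iff_right hk (key _ (le_max_left _ _) h1) hi hiL).2 (le_max_right _ _)
  exact absurd this (not_le.2 h1)

theorem StepsDisjoint.le_of_step_lt {f : ℕ → ℝ} {L k : ℕ} (h : StepsDisjoint f L) (hk : k < L)
    (hlt : f (k + 1) < f k) :
    (∀ i ≤ k, f k ≤ f i) ∧ ∀ i, k < i → i ≤ L → f i ≤ f (k + 1) := by
  have key : ∀ ξ, f (k + 1) ≤ ξ → ξ < f k → ¬ (f k ≤ ξ ↔ f (k + 1) ≤ ξ) := by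
    intro ξ h1 h2 h3
    exact absurd (h3.2 h1) (not_le.2 h2)
  refine ⟨fun i hi => ?_, fun i hi hiL => (h.iff_right hk (key _ le_rfl hlt) hi hiL).1 le_rfl⟩
  by_contra! hc
  have h1 : max (f (k + 1)) (f i) < f k := max_lt hlt hc
  have := (h.iff_left hk (key _ (le_max_left _ _) h1) hi).1 (le_max_right _ _)
  exact absurd this (not_le.2 h1)

/-- The steps of `f 0, …, f L` all go in the direction `ε`. -/
def StepsDirected (ε : ℝ) (f : ℕ → ℝ) (L : ℕ) : Prop :=
  ∀ i < L, 0 ≤ ε * (f (i + 1) - f i)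

/-- An ascending and a descending step cannot coexist: in either order the two barriers contradict
each other. The sign `ε` treats both orientations at once. -/
theorem StepsDisjoint.directed {f : ℕ → ℝ} {L k : ℕ} (h : StepsDisjoint f L) (hk : k < L)
    {ε : ℝ} (hε : ε = 1 ∨ ε = -1) (hlt : 0 < ε * (f (k + 1) - f k)) : StepsDirected ε f L := by
  intro j hj
  by_contra! hc
  have main : ∀ a b, a < L → b < L → f a < f (a + 1) → f (b + 1) < f b → False := by
    intro a b ha hb h1 h2
    have A := h.le_of_lt_step ha h1
    have B := h.le_of_step_lt hb h2
    rcases lt_trichotomy a b with hab | hab | hab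
    · have := A.2 b hab hb.le
      have := B.1 a hab.le
      linarith
    · subst hab; linarith
    · have := A.1 b hab.le
      have := B.2 a hab ha.le
      linarith
  rcases hε with rfl | rfl
  · exact main k j hk hj (by linarith) (by linarith)
  · exact main j k hj hk (by linarith) (by linarith)

theorem StepsDirected.mono {f : ℕ → ℝ} {L : ℕ} {ε : ℝ} (h : StepsDirected ε f L) {i j : ℕ}
    (hij : i ≤ j) (hj : j ≤ L) : 0 ≤ ε * (f j - f i) := by
  induction j, hij using Nat.le_induction with
  | base => simp
  | succ j hij ih =>
    have h1 := ih (by omega)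
    have h2 := h j (by omega)
    nlinarith

theorem StepsDirected.disjoint {f : ℕ → ℝ} {L : ℕ} {ε : ℝ} (hε : ε = 1 ∨ ε = -1)
    (h : StepsDirected ε f L) : StepsDisjoint f L := by
  have main : ∀ i j, i < j → j < L → ∀ ξ, ¬ (f i ≤ ξ ↔ f (i + 1) ≤ ξ) →
      (f j ≤ ξ ↔ f (j + 1) ≤ ξ) := by
    intro i j hij hj ξ hξ
    have h1 := h i (by omega)
    have h2 := h j hj
    have h3 := h.mono (i := i + 1) (j := j) hij hj.le
    rcases hε with rfl | rfl
    · have a1 : f i ≤ f (i + 1) := by linarith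
      have a2 : f j ≤ f (j + 1) := by linarith
      have a3 : f (i + 1) ≤ f j := by linarith
      have : ξ < f (i + 1) := by
        by_contra! hc
        exact hξ ⟨fun _ => hc, fun _ => a1.trans hc⟩
      exact ⟨fun _ => by linarith, fun _ => by linarith⟩
    · have a1 : f (i + 1) ≤ f i := by linarith
      have a2 : f (j + 1) ≤ f j := by linarith
      have a3 : f j ≤ f (i + 1) := by linarith
      have : f (i + 1) ≤ ξ := by
        by_contra! hc
        exact hξ ⟨fun _ => by linarith, fun _ => by linarith⟩
      exact ⟨fun _ => by linarith, fun _ => by linarith⟩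
  intro i hi j hj hij ξ hξ
  rcases lt_or_gt_of_ne hij with hlt | hlt
  · exact main i j hlt hj ξ hξ
  · by_contra hc
    exact hξ (main j i hlt hi ξ hc)

/-! ### Outstretched segments as directed paths; the unique maximal one through an edge. -/

theorem mem_spanIco_pair {a b : ℝ × ℝ} {ξ : ℝ} :
    ξ ∈ spanIco {a, b} ↔ ¬ (a.1 ≤ ξ ↔ b.1 ≤ ξ) := by
  simp only [spanIco, mem_ofPred_eq, mem_insert_iff, mem_singleton_iff, exists_eq_or_imp,
    exists_eq_left]
  rw [← not_le, ← not_le]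
  tauto

namespace SimplePolygon

variable {Q : SimplePolygon}

theorem mem_edgeIco {Q : SimplePolygon} {i : Fin Q.n} {ξ : ℝ} :
    ξ ∈ Q.edgeIco i ↔ ¬ ((Q.poly i).1 ≤ ξ ↔ (Q.poly (finRotate Q.n i)).1 ≤ ξ) :=
  mem_spanIco_pair

theorem edgeVertical_iff {Q : SimplePolygon} {i : Fin Q.n} :
    Q.EdgeVertical i ↔ Q.edgeIco i = ∅ := by
  simp only [EdgeVertical, eq_empty_iff_forall_notMem, mem_edgeIco, not_not]
  refine ⟨fun h ξ => by rw [h], fun h => le_antisymm ?_ ?_⟩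
  · exact (h _).2 le_rfl
  · exact (h _).1 le_rfl

namespace Segment

/-- The abscissas of the corners along a segment (continued along the cycle). -/
def xSeq (S : Segment Q) (k : ℕ) : ℝ := (Q.poly (S.idx k)).1

theorem idx_succ (S : Segment Q) (k : ℕ) : S.idx (k + 1) = finRotate Q.n (S.idx k) :=
  Function.iterate_succ_apply' _ _ _

theorem idx_eq_iff (S : Segment Q) (k l : ℕ) : S.idx k = S.idx l ↔ k ≡ l [MOD Q.n] :=
  finRotate_iterate_eq_iff _ _ _

theorem idx_inj (S : Segment Q) {k l : ℕ} (hk : k < Q.n) (hl : l < Q.n) (h : S.idx k = S.idx l) :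
    k = l :=
  Nat.ModEq.eq_of_lt_of_lt ((S.idx_eq_iff k l).1 h) hk hl

theorem mem_edgeIco_idx (S : Segment Q) (k : ℕ) (ξ : ℝ) :
    ξ ∈ Q.edgeIco (S.idx k) ↔ ¬ (S.xSeq k ≤ ξ ↔ S.xSeq (k + 1) ≤ ξ) := by
  rw [mem_edgeIco, xSeq, xSeq, idx_succ]

theorem edgeVertical_idx (S : Segment Q) (k : ℕ) :
    Q.EdgeVertical (S.idx k) ↔ S.xSeq k = S.xSeq (k + 1) := by
  rw [EdgeVertical, xSeq, xSeq, idx_succ]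

/-- A segment has fewer than `Q.n` edges, so distinct positions are distinct edges and (O) becomes a
property of the sequence of abscissas. -/
theorem propO_iff (S : Segment Q) : S.PropO ↔ StepsDisjoint S.xSeq S.len.val := by
  constructor
  · intro h i hi j hj hij ξ hξ
    by_contra hc
    have hne : S.idx i ≠ S.idx j := fun he =>
      hij (S.idx_inj (hi.trans S.len.isLt) (hj.trans S.len.isLt) he)
    have := h _ ⟨i, hi, rfl⟩ _ ⟨j, hj, rfl⟩ hne
    have hm : ξ ∈ Q.edgeIco (S.idx i) ∩ Q.edgeIco (S.idx j) :=
      ⟨(S.mem_edgeIco_idx i ξ).2 hξ, (S.mem_edgeIco_idx j ξ).2 hc⟩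
    rw [this] at hm
    exact hm
  · rintro h _ ⟨i, hi, rfl⟩ _ ⟨j, hj, rfl⟩ hne
    rw [eq_empty_iff_forall_notMem]
    rintro ξ ⟨h1, h2⟩
    rw [mem_edgeIco_idx] at h1 h2
    exact h2 (h i hi j hj (fun he => hne (by rw [he])) ξ h1)

/-- An outstretched segment runs in the direction of each of its non-vertical edges. -/
theorem Outstretched.directed {S : Segment Q} (h : S.Outstretched) {k : ℕ} (hk : k < S.len.val)
    {ε : ℝ} (hε : ε = 1 ∨ ε = -1) (hlt : 0 < ε * (S.xSeq (k + 1) - S.xSeq k)) :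
    StepsDirected ε S.xSeq S.len.val :=
  ((propO_iff S).1 h.1).directed hk hε hlt

theorem exists_sign_of_not_vertical (S : Segment Q) {k : ℕ} (h : ¬ Q.EdgeVertical (S.idx k)) :
    ∃ ε : ℝ, (ε = 1 ∨ ε = -1) ∧ 0 < ε * (S.xSeq (k + 1) - S.xSeq k) := by
  rw [edgeVertical_idx] at h
  rcases lt_or_gt_of_ne h with h | h
  · exact ⟨1, Or.inl rfl, by linarith⟩
  · exact ⟨-1, Or.inr rfl, by linarith⟩

theorem exists_outstretched_containing {Q : SimplePolygon} (e : Fin Q.n)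
    (he : ¬ Q.EdgeVertical e) : ∃ S : Segment Q, S.Outstretched ∧ e ∈ S.edgeIdx := by
  refine ⟨⟨e, ⟨1, by have := Q.three_le; omega⟩⟩, ⟨?_, fun _ => ⟨he, he⟩⟩, 0, by simp, rfl⟩
  rw [propO_iff]
  intro i hi j hj hij
  simp only at hi hj
  omega

theorem edgeIdx_eq_image (S : Segment Q) :
    S.edgeIdx = S.idx '' (Finset.range S.len.val : Set ℕ) := by
  ext i
  simp only [edgeIdx, mem_ofPred_eq, mem_image, Finset.coe_range, mem_Iio]
  exact ⟨fun ⟨k, h1, h2⟩ => ⟨k, h1, h2.symm⟩, fun ⟨k, h1, h2⟩ => ⟨k, h1, h2.symm⟩⟩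

theorem ncard_edgeIdx (S : Segment Q) : S.edgeIdx.ncard = S.len.val := by
  rw [edgeIdx_eq_image, InjOn.ncard_image, ncard_coe_finset, Finset.card_range]
  intro a ha b hb h
  simp only [Finset.coe_range, mem_Iio] at ha hb
  exact S.idx_inj (ha.trans S.len.isLt) (hb.trans S.len.isLt) h

/-- The first edge is the only one whose predecessor on the cycle is not in the segment, because the
segment does not go all the way round. Without edges the start would not be determined. -/
theorem eq_of_edgeIdx_eq {S S' : Segment Q} (h0 : 0 < S.len.val) (h : S.edgeIdx = S'.edgeIdx) :
    S = S' := by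
  have hlen : S.len = S'.len := by
    rw [Fin.ext_iff, ← ncard_edgeIdx, ← ncard_edgeIdx, h]
  have hstart : S.start = S'.start := by
    have hs : S.start ∈ S'.edgeIdx := h ▸ ⟨0, h0, rfl⟩
    obtain ⟨k, hk, hks⟩ := hs
    obtain _ | k := k
    · exact hks
    exfalso
    have : S'.idx k ∈ S.edgeIdx := h ▸ ⟨k, by omega, rfl⟩
    obtain ⟨m, hm, hms⟩ := this
    have h1 : S.idx (m + 1) = S.idx 0 := by
      rw [idx_succ, ← hms, ← idx_succ, ← hks]; rfl
    have := (S.idx_eq_iff _ _).1 h1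
    rw [Nat.ModEq, Nat.mod_eq_of_lt (by have := S.len.isLt; omega), Nat.zero_mod] at this
    omega
  cases S; cases S'
  simp_all

/-- Take an outstretched segment through `e` with the most edges; an outstretched one containing it
has the same edges, hence is the same segment. -/
theorem exists_maxOutstretched_containing {Q : SimplePolygon} (e : Fin Q.n)
    (he : ¬ Q.EdgeVertical e) : ∃ S : Segment Q, S.MaxOutstretched ∧ e ∈ S.edgeIdx := by
  classical
  let T : Set ℕ := {l | ∃ S : Segment Q, S.Outstretched ∧ e ∈ S.edgeIdx ∧ S.len.val = l}
  have hT : T.Finite := (finite_Iio Q.n).subset (by rintro l ⟨S, _, _, rfl⟩; exact S.len.isLt)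
  have hne : T.Nonempty := by
    obtain ⟨S, h1, h2⟩ := exists_outstretched_containing e he
    exact ⟨_, S, h1, h2, rfl⟩
  obtain ⟨l, ⟨S, h1, h2, rfl⟩, hmax⟩ := hT.exists_maximal hne
  refine ⟨S, ⟨h1, ?_⟩, h2⟩
  rintro ⟨S', h1', hsub⟩
  have hle : S.edgeIdx.ncard ≤ S'.edgeIdx.ncard := ncard_le_ncard hsub.2.1 (toFinite _)
  have hle' : S'.len.val ≤ S.len.val :=
    hmax ⟨S', h1', hsub.2.1 h2, rfl⟩ (by simpa [ncard_edgeIdx] using hle)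
  have heq : S.edgeIdx = S'.edgeIdx :=
    eq_of_subset_of_ncard_le hsub.2.1 (by simpa [ncard_edgeIdx] using hle') (toFinite _)
  obtain ⟨k, hk, _⟩ := h2
  exact hsub.2.2 (eq_of_edgeIdx_eq (by omega) heq)

/-- A directed path around a cycle that is not vertical throughout does not close up. -/
theorem lt_card_of_directed (S : Segment Q) {ε : ℝ} {L k : ℕ} (h : StepsDirected ε S.xSeq L)
    (hk : k < Q.n) (hlt : 0 < ε * (S.xSeq (k + 1) - S.xSeq k)) : L < Q.n := by
  by_contra! hc
  have h1 := h.mono (i := 0) (j := k) (by omega) (by omega)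
  have h2 := h.mono (i := k + 1) (j := Q.n) (by omega) hc
  have h3 : S.xSeq Q.n = S.xSeq 0 := by
    rw [xSeq, xSeq, (S.idx_eq_iff Q.n 0).2 (by simp [Nat.ModEq])]
  rw [h3] at h2
  nlinarith

theorem outstretched_of_directed {S : Segment Q} {ε : ℝ} (hε : ε = 1 ∨ ε = -1)
    (h : StepsDirected ε S.xSeq S.len.val)
    (h0 : 0 < S.len.val → ¬ Q.EdgeVertical (S.idx 0) ∧ ¬ Q.EdgeVertical (S.idx (S.len.val - 1))) :
    S.Outstretched :=
  ⟨(propO_iff S).2 (h.disjoint hε), h0⟩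

/-- Both segments run in the direction of the shared edge, so their union is a directed path. It
cannot close up (`lt_card_of_directed`), so it is an outstretched segment `U` containing both, and
maximality makes both equal to `U`. -/
theorem MaxOutstretched.eq_of_mem_of_le {S S' : Segment Q} (h : S.MaxOutstretched)
    (h' : S'.MaxOutstretched) {k k' : ℕ} (hk : k < S.len.val) (hk' : k' < S'.len.val)
    (hkk : k' ≤ k) (he : S.idx k = S'.idx k') (hv : ¬ Q.EdgeVertical (S.idx k)) : S = S' := by
  obtain ⟨ε, hε, hpos⟩ := S.exists_sign_of_not_vertical hv
  have hD := h.1.directed hk hε hpos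
  -- The offset of the start of `S'` along `S`, a natural number since `k' ≤ k`. As `d ≤ k < S.len`,
  -- the two ranges of steps leave no gap.
  set d := k - k' with hd
  have hidx : ∀ m, S'.idx m = S.idx (m + d) := by
    have hs : S'.start = S.idx d := by
      apply (Function.Injective.iterate (finRotate Q.n).injective k')
      change S'.idx k' = _
      rw [← he, idx, idx, ← Function.iterate_add_apply]
      congr 2
      omega
    intro m
    rw [idx, hs, idx, idx, ← Function.iterate_add_apply]
  have hx : ∀ m, S'.xSeq m = S.xSeq (m + d) := fun m => by rw [xSeq, xSeq, hidx]
  have hD' : StepsDirected ε S'.xSeq S'.len.val := by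
    apply h'.1.directed hk' hε
    rw [hx, hx]
    have h1 : k' + 1 + d = k + 1 := by omega
    have h2 : k' + d = k := by omega
    rwa [h1, h2]
  set L := max S.len.val (d + S'.len.val) with hL
  have hLD : StepsDirected ε S.xSeq L := by
    intro i hi
    by_cases h1 : i < S.len.val
    · exact hD i h1
    · have h2 := hD' (i - d) (by omega)
      rw [hx, hx] at h2
      have h3 : i - d + 1 + d = i + 1 := by omega
      have h4 : i - d + d = i := by omega
      rwa [h3, h4] at h2
  have hLn : L < Q.n := S.lt_card_of_directed hLD (hk.trans S.len.isLt) hpos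
  let U : Segment Q := ⟨S.start, ⟨L, hLn⟩⟩
  have hUidx : ∀ m, U.idx m = S.idx m := fun m => rfl
  have hU : U.Outstretched := by
    refine outstretched_of_directed hε hLD fun _ => ⟨(h.1.2 (by omega)).1, ?_⟩
    change ¬ Q.EdgeVertical (S.idx (L - 1))
    rcases le_total (d + S'.len.val) S.len.val with h1 | h1
    · rw [hL, max_eq_left h1]
      exact (h.1.2 (by omega)).2
    · rw [hL, max_eq_right h1]
      have h2 := (h'.1.2 (by omega)).2
      rw [hidx] at h2
      have h3 : S'.len.val - 1 + d = d + S'.len.val - 1 := by omega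
      rwa [h3] at h2
  have hSU : S = U := by
    by_contra hne
    refine h.2 ⟨U, hU, ?_, ?_, hne⟩
    · rintro _ ⟨m, hm, rfl⟩
      exact ⟨m, hm.trans (le_max_left _ _), rfl⟩
    · rintro _ ⟨m, hm, rfl⟩
      exact ⟨m, hm.trans_le (le_max_left _ _), rfl⟩
  have hSU' : S' = U := by
    by_contra hne
    refine h'.2 ⟨U, hU, ?_, ?_, hne⟩
    · rintro _ ⟨m, hm, rfl⟩
      refine ⟨m + d, ?_, hidx m⟩
      change m + d ≤ L
      omega
    · rintro _ ⟨m, hm, rfl⟩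
      refine ⟨m + d, ?_, hidx m⟩
      change m + d < L
      omega
  rw [hSU, hSU']

/-- A non-vertical edge belongs to at most one maximal outstretched segment. -/
theorem MaxOutstretched.eq_of_mem {S S' : Segment Q} (h : S.MaxOutstretched)
    (h' : S'.MaxOutstretched) {e : Fin Q.n} (he : e ∈ S.edgeIdx) (he' : e ∈ S'.edgeIdx)
    (hv : ¬ Q.EdgeVertical e) : S = S' := by
  obtain ⟨k, hk, rfl⟩ := he
  obtain ⟨k', hk', hkk⟩ := he'
  rcases le_total k' k with hle | hle
  · exact h.eq_of_mem_of_le h' hk hk' hle hkk hv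
  · exact (h'.eq_of_mem_of_le h hk' hk hle hkk.symm (hkk ▸ hv)).symm

theorem mem_vertexIdx_of_mem_edgeIdx {S : Segment Q} {e : Fin Q.n} (he : e ∈ S.edgeIdx) :
    e ∈ S.vertexIdx ∧ finRotate Q.n e ∈ S.vertexIdx := by
  obtain ⟨k, hk, rfl⟩ := he
  exact ⟨⟨k, hk.le, rfl⟩, k + 1, hk, (S.idx_succ k).symm⟩

theorem mem_xIco_of_edge {S : Segment Q} {e : Fin Q.n} (he : e ∈ S.edgeIdx) {ξ : ℝ}
    (hξ : ξ ∈ Q.edgeIco e) : ξ ∈ S.xIco := by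
  have hsub : Q.edgeEnds e ⊆ S.corners := by
    have := mem_vertexIdx_of_mem_edgeIdx he
    rintro v (rfl | rfl)
    · exact ⟨e, this.1, rfl⟩
    · exact ⟨_, this.2, rfl⟩
  obtain ⟨⟨v, hv, h1⟩, w, hw, h2⟩ := hξ
  exact ⟨⟨v, hsub hv, h1⟩, w, hsub hw, h2⟩

theorem exists_edge_of_mem_xIco {S : Segment Q} {ξ : ℝ} (hξ : ξ ∈ S.xIco) :
    ∃ e ∈ S.edgeIdx, ξ ∈ Q.edgeIco e := by
  obtain ⟨⟨_, ⟨_, ⟨k, hk, rfl⟩, rfl⟩, h1⟩, _, ⟨_, ⟨l, hl, rfl⟩, rfl⟩, h2⟩ := hξ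
  have h1' : S.xSeq k ≤ ξ := h1
  have h2' : ¬ S.xSeq l ≤ ξ := not_le.2 h2
  rcases le_total k l with hkl | hkl
  · obtain ⟨i, h3, h4, h5⟩ := exists_step_of_not_iff (p := fun m => S.xSeq m ≤ ξ) hkl
      (fun h => h2' (h.1 h1'))
    exact ⟨_, ⟨i, by omega, rfl⟩, (S.mem_edgeIco_idx i ξ).2 h5⟩
  · obtain ⟨i, h3, h4, h5⟩ := exists_step_of_not_iff (p := fun m => S.xSeq m ≤ ξ) hkl
      (fun h => h2' (h.2 h1'))
    exact ⟨_, ⟨i, by omega, rfl⟩, (S.mem_edgeIco_idx i ξ).2 h5⟩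

theorem activeEdge_spec {S : Segment Q} {ξ : ℝ} (hξ : ξ ∈ S.xIco) :
    S.activeEdge ξ ∈ S.edgeIdx ∧ ξ ∈ Q.edgeIco (S.activeEdge ξ) := by
  have h := exists_edge_of_mem_xIco hξ
  rw [activeEdge, dif_pos h]
  exact h.choose_spec

theorem activeEdge_eq {S : Segment Q} (hS : S.Outstretched) {ξ : ℝ} {e : Fin Q.n}
    (he : e ∈ S.edgeIdx) (hξ : ξ ∈ Q.edgeIco e) : S.activeEdge ξ = e := by
  have h := activeEdge_spec (mem_xIco_of_edge he hξ)
  by_contra hne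
  have := hS.1 _ h.1 _ he hne
  exact eq_empty_iff_forall_notMem.1 this ξ ⟨h.2, hξ⟩

end Segment

/-! ### Active edges: segments met by a vertical line correspond to edges met by it. -/

theorem not_vertical_of_mem {Q : SimplePolygon} {e : Fin Q.n} {ξ : ℝ} (h : ξ ∈ Q.edgeIco e) :
    ¬ Q.EdgeVertical e := by
  rw [edgeVertical_iff]
  exact fun h' => absurd h (h' ▸ notMem_empty ξ)

/-- The maximal outstretched segment through a non-vertical edge. -/
noncomputable def segOf (Q : SimplePolygon) (e : Fin Q.n) (he : ¬ Q.EdgeVertical e) : Segment Q :=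
  (Segment.exists_maxOutstretched_containing e he).choose

theorem segOf_spec (Q : SimplePolygon) (e : Fin Q.n) (he : ¬ Q.EdgeVertical e) :
    (Q.segOf e he).MaxOutstretched ∧ e ∈ (Q.segOf e he).edgeIdx :=
  (Segment.exists_maxOutstretched_containing e he).choose_spec

/-- At a fixed abscissa, mapping a maximal outstretched segment to its active edge is injective. -/
theorem Segment.activeEdge_injOn {Q : SimplePolygon} (ξ : ℝ) :
    InjOn (fun S : Segment Q => S.activeEdge ξ) {S | S.MaxOutstretched ∧ ξ ∈ S.xIco} := by
  rintro S ⟨hS, h1⟩ S' ⟨hS', h2⟩ h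
  have a := activeEdge_spec h1
  have b := activeEdge_spec h2
  simp only at h
  rw [← h] at b
  exact hS.eq_of_mem hS' a.1 b.1 (not_vertical_of_mem a.2)

theorem mem_xIco_iff {Q : SimplePolygon} {ξ : ℝ} :
    ξ ∈ Q.xIco ↔ ∃ e, ξ ∈ Q.edgeIco e := by
  constructor
  · rintro ⟨⟨_, ⟨i, rfl⟩, h1⟩, _, ⟨j, rfl⟩, h2⟩
    obtain ⟨k, hk, rfl⟩ := exists_finRotate_iterate_eq i j
    obtain ⟨m, -, -, h3⟩ := exists_step_of_not_iff
      (p := fun m => (Q.poly ((⇑(finRotate Q.n))^[m] i)).1 ≤ ξ) (Nat.zero_le k)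
      (fun h => absurd (h.1 h1) (not_le.2 h2))
    exact ⟨_, mem_edgeIco.2 (by rwa [Function.iterate_succ_apply'] at h3)⟩
  · rintro ⟨e, ⟨v, hv, h1⟩, w, hw, h2⟩
    have hsub : Q.edgeEnds e ⊆ Q.corners := by
      rintro v (rfl | rfl)
      · exact ⟨e, rfl⟩
      · exact ⟨_, rfl⟩
    exact ⟨⟨v, hsub hv, h1⟩, w, hsub hw, h2⟩

/-- Counting maximal outstretched segments on a vertical line amounts to counting edges. -/
theorem Segment.ncard_maxOutstretched {Q : SimplePolygon} (ξ : ℝ) (p : ℝ → Prop) :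
    {S : Segment Q | S.MaxOutstretched ∧ ξ ∈ S.xIco ∧ p (S.yVal ξ)}.ncard =
      {e | ξ ∈ Q.edgeIco e ∧ p (Q.edgeY e ξ)}.ncard := by
  have hsub : {S : Segment Q | S.MaxOutstretched ∧ ξ ∈ S.xIco ∧ p (S.yVal ξ)} ⊆
      {S | S.MaxOutstretched ∧ ξ ∈ S.xIco} := fun T hT => ⟨hT.1, hT.2.1⟩
  rw [← ((activeEdge_injOn ξ).mono hsub).ncard_image]
  congr 1
  ext e
  constructor
  · rintro ⟨T, ⟨-, h2, h3⟩, rfl⟩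
    exact ⟨(activeEdge_spec h2).2, h3⟩
  · rintro ⟨h1, h2⟩
    have h := Q.segOf_spec e (not_vertical_of_mem h1)
    have ha := activeEdge_eq h.1.1 h.2 h1
    refine ⟨Q.segOf e (not_vertical_of_mem h1), ⟨h.1, mem_xIco_of_edge h.2 h1, ?_⟩, ha⟩
    change p (Q.edgeY ((Q.segOf e _).activeEdge ξ) ξ)
    rw [ha]
    exact h2

/-- The number of maximal outstretched segments at or above `S` is a number of edges. -/
theorem Segment.ncard_above {Q : SimplePolygon} (S : Segment Q) (ξ : ℝ) :
    (S.above ξ).ncard = {e | ξ ∈ Q.edgeIco e ∧ S.yVal ξ ≤ Q.edgeY e ξ}.ncard :=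
  ncard_maxOutstretched ξ fun y => S.yVal ξ ≤ y

/-! ### Points on edges -/

theorem edgeSet_eq_segment (i : Fin Q.n) :
    Q.poly.edgeSet ℝ i = segment ℝ (Q.poly i) (Q.poly (finRotate Q.n i)) :=
  affineSegment_eq_segment ..

theorem poly_injective : Function.Injective fun i => Q.poly i := Q.injective

theorem poly_ne_poly_finRotate (i : Fin Q.n) : Q.poly i ≠ Q.poly (finRotate Q.n i) := fun h =>
  finRotate_ne_self (by have := Q.three_le; omega) i (poly_injective h).symm

theorem edgeY_left (i : Fin Q.n) : Q.edgeY i (Q.poly i).1 = (Q.poly i).2 := by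
  simp [edgeY]

theorem edgeY_right {i : Fin Q.n} (h : ¬ Q.EdgeVertical i) :
    Q.edgeY i (Q.poly (finRotate Q.n i)).1 = (Q.poly (finRotate Q.n i)).2 := by
  have h' : (Q.poly (finRotate Q.n i)).1 - (Q.poly i).1 ≠ 0 := sub_ne_zero.2 fun h' => h h'.symm
  rw [edgeY, edgeSlope]
  field_simp
  ring

theorem edgeY_lineMap {i : Fin Q.n} (h : ¬ Q.EdgeVertical i) (t : ℝ) :
    Q.edgeY i (AffineMap.lineMap (Q.poly i) (Q.poly (finRotate Q.n i)) t).1 =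
      (AffineMap.lineMap (Q.poly i) (Q.poly (finRotate Q.n i)) t).2 := by
  have h' : (Q.poly (finRotate Q.n i)).1 - (Q.poly i).1 ≠ 0 := sub_ne_zero.2 fun h' => h h'.symm
  simp only [AffineMap.lineMap_apply, vsub_eq_sub, vadd_eq_add, Prod.fst_add, Prod.snd_add,
    Prod.smul_fst, Prod.smul_snd, Prod.fst_sub, Prod.snd_sub, smul_eq_mul, edgeY, edgeSlope]
  field_simp
  ring

theorem snd_eq_edgeY {i : Fin Q.n} (h : ¬ Q.EdgeVertical i) {p : ℝ × ℝ}
    (hp : p ∈ Q.poly.edgeSet ℝ i) : p.2 = Q.edgeY i p.1 := by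
  obtain ⟨t, -, rfl⟩ := hp
  exact (edgeY_lineMap h t).symm

theorem lineMap_eq_of_not_vertical {i : Fin Q.n} (h : ¬ Q.EdgeVertical i) (ξ : ℝ) :
    AffineMap.lineMap (Q.poly i) (Q.poly (finRotate Q.n i))
      ((ξ - (Q.poly i).1) / ((Q.poly (finRotate Q.n i)).1 - (Q.poly i).1)) =
        (ξ, Q.edgeY i ξ) := by
  have h' : (Q.poly (finRotate Q.n i)).1 - (Q.poly i).1 ≠ 0 := sub_ne_zero.2 fun h' => h h'.symm
  have h1 : (AffineMap.lineMap (Q.poly i) (Q.poly (finRotate Q.n i))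
      ((ξ - (Q.poly i).1) / ((Q.poly (finRotate Q.n i)).1 - (Q.poly i).1))).1 = ξ := by
    simp only [AffineMap.lineMap_apply, vsub_eq_sub, vadd_eq_add, Prod.fst_add,
      Prod.smul_fst, Prod.fst_sub, smul_eq_mul]
    field_simp
    ring
  refine Prod.ext h1 ?_
  rw [← edgeY_lineMap h, h1]

theorem mk_edgeY_mem_edgeSet {i : Fin Q.n} (h : ¬ Q.EdgeVertical i) {ξ : ℝ}
    (hξ : ξ ∈ uIcc (Q.poly i).1 (Q.poly (finRotate Q.n i)).1) :
    (ξ, Q.edgeY i ξ) ∈ Q.poly.edgeSet ℝ i := by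
  refine ⟨_, ?_, lineMap_eq_of_not_vertical h ξ⟩
  have h0 : (Q.poly i).1 ≠ (Q.poly (finRotate Q.n i)).1 := h
  rcases mem_uIcc.1 hξ with ⟨h1, h2⟩ | ⟨h1, h2⟩
  · have h3 : 0 < (Q.poly (finRotate Q.n i)).1 - (Q.poly i).1 :=
      sub_pos.2 (lt_of_le_of_ne (h1.trans h2) h0)
    exact ⟨div_nonneg (by linarith) h3.le, (div_le_one h3).2 (by linarith)⟩
  · have h3 : (Q.poly (finRotate Q.n i)).1 - (Q.poly i).1 < 0 :=
      sub_neg.2 (lt_of_le_of_ne (h1.trans h2) h0.symm)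
    exact ⟨div_nonneg_of_nonpos (by linarith) h3.le, (div_le_one_of_neg h3).2 (by linarith)⟩

theorem mk_edgeY_mem_openSegment {i : Fin Q.n} {ξ : ℝ} (hξ : ξ ∈ Q.edgeIco i)
    (h1 : (Q.poly i).1 ≠ ξ) (h2 : (Q.poly (finRotate Q.n i)).1 ≠ ξ) :
    (ξ, Q.edgeY i ξ) ∈ openSegment ℝ (Q.poly i) (Q.poly (finRotate Q.n i)) := by
  have hv := not_vertical_of_mem hξ
  rw [mem_edgeIco] at hξ
  have hm : (ξ, Q.edgeY i ξ) ∈ segment ℝ (Q.poly i) (Q.poly (finRotate Q.n i)) := by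
    rw [← edgeSet_eq_segment]
    apply mk_edgeY_mem_edgeSet hv
    rw [mem_uIcc]
    rcases le_total (Q.poly i).1 ξ with h3 | h3 <;>
      rcases le_total (Q.poly (finRotate Q.n i)).1 ξ with h4 | h4
    · exact absurd ⟨fun _ => h4, fun _ => h3⟩ hξ
    · exact Or.inl ⟨h3, h4⟩
    · exact Or.inr ⟨h4, h3⟩
    · exact absurd ⟨fun h => absurd (le_antisymm h h3) h1,
        fun h => absurd (le_antisymm h h4) h2⟩ hξ
  refine mem_openSegment_of_ne_left_right (fun h => h1 ?_) (fun h => h2 ?_) hm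
  · rw [h]
  · rw [h]

theorem mem_edgeSet_of_vertical {i : Fin Q.n} (h : Q.EdgeVertical i) {p : ℝ × ℝ}
    (h1 : p.1 = (Q.poly i).1) (h2 : p.2 ∈ uIcc (Q.poly i).2 (Q.poly (finRotate Q.n i)).2) :
    p ∈ Q.poly.edgeSet ℝ i := by
  rw [← segment_eq_uIcc, segment_eq_image_lineMap] at h2
  obtain ⟨t, ht, hp⟩ := h2
  refine ⟨t, ht, Prod.ext ?_ ?_⟩
  · have h0 : (Q.poly i).1 = (Q.poly (finRotate Q.n i)).1 := h
    simp [-finRotate_apply, AffineMap.lineMap_apply, ← h0, h1]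
  · rw [← hp]
    simp [AffineMap.lineMap_apply]

theorem poly_mem_edgeSet (i : Fin Q.n) : Q.poly i ∈ Q.poly.edgeSet ℝ i := by
  rw [edgeSet_eq_segment]; exact left_mem_segment ..

theorem poly_finRotate_mem_edgeSet (i : Fin Q.n) :
    Q.poly (finRotate Q.n i) ∈ Q.poly.edgeSet ℝ i := by
  rw [edgeSet_eq_segment]; exact right_mem_segment ..

theorem eq_end_of_mem_of_mem {i j : Fin Q.n} (hij : i ≠ j) {p : ℝ × ℝ}
    (hi : p ∈ Q.poly.edgeSet ℝ i) (hj : p ∈ Q.poly.edgeSet ℝ j) :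
    p = Q.poly i ∨ p = Q.poly (finRotate Q.n i) := by
  by_contra! hc
  refine disjoint_left.1 (Q.planar i j hij)
    (mem_openSegment_of_ne_left_right hc.1.symm hc.2.symm ?_) hj
  rwa [← edgeSet_eq_segment]

/-- A corner lies on no edges except the two that end there. -/
theorem eq_or_eq_of_poly_mem {k j : Fin Q.n} (h : Q.poly k ∈ Q.poly.edgeSet ℝ j) :
    j = k ∨ finRotate Q.n j = k := by
  by_cases hjk : j = k
  · exact Or.inl hjk
  rcases eq_end_of_mem_of_mem hjk h (poly_mem_edgeSet k) with h' | h'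
  · exact Or.inl (poly_injective h'.symm)
  · exact Or.inr (poly_injective h'.symm)

theorem edgeSet_subset_curve (i : Fin Q.n) : Q.poly.edgeSet ℝ i ⊆ Q.curve :=
  subset_iUnion (fun i => Q.poly.edgeSet ℝ i) i

theorem mem_curve {p : ℝ × ℝ} : p ∈ Q.curve ↔ ∃ i, p ∈ Q.poly.edgeSet ℝ i := mem_iUnion

theorem continuous_edgeY (i : Fin Q.n) : Continuous (Q.edgeY i) := by
  unfold edgeY; fun_prop

/-! ### Parity of the number of edges above a point -/

/-- Indicator of the abscissas at or to the right of corner `i`. -/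
noncomputable def ind (Q : SimplePolygon) (i : Fin Q.n) (ξ : ℝ) : ZMod 2 :=
  if (Q.poly i).1 ≤ ξ then 1 else 0

open Classical in
/-- The number modulo two of the edges in `T` that pass above the point `p`. -/
noncomputable def crossSum (Q : SimplePolygon) (T : Set (Fin Q.n)) (p : ℝ × ℝ) : ZMod 2 :=
  ∑ i, if i ∈ T ∧ p.1 ∈ Q.edgeIco i ∧ p.2 < Q.edgeY i p.1 then 1 else 0

theorem crossSum_eq_ncard (T : Set (Fin Q.n)) (p : ℝ × ℝ) :
    Q.crossSum T p = ({i | i ∈ T ∧ p.1 ∈ Q.edgeIco i ∧ p.2 < Q.edgeY i p.1}.ncard : ZMod 2) := by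
  classical
  rw [crossSum, Finset.sum_boole, ncard_eq_toFinset_card', toFinset_ofPred]

theorem eventually_ind_eq {i : Fin Q.n} {ξ₀ : ℝ} (h : (Q.poly i).1 ≠ ξ₀) :
    ∀ᶠ ξ in 𝓝 ξ₀, Q.ind i ξ = Q.ind i ξ₀ := by
  rcases lt_or_gt_of_ne h with h | h
  · filter_upwards [eventually_gt_nhds h] with ξ hξ
    rw [ind, ind, if_pos h.le, if_pos hξ.le]
  · filter_upwards [eventually_lt_nhds h] with ξ hξ
    rw [ind, ind, if_neg (not_le.2 h), if_neg (not_le.2 hξ)]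

theorem ind_add_ind (i : Fin Q.n) (ξ : ℝ) [Decidable (ξ ∈ Q.edgeIco i)] :
    Q.ind i ξ + Q.ind (finRotate Q.n i) ξ = if ξ ∈ Q.edgeIco i then 1 else 0 := by
  by_cases h1 : (Q.poly i).1 ≤ ξ <;> by_cases h2 : (Q.poly (finRotate Q.n i)).1 ≤ ξ <;>
    simp [-finRotate_apply, ind, mem_edgeIco, h1, h2, CharTwo.add_self_eq_zero]

/-- Summation by parts around the cycle: grouped by corners, each indicator is multiplied by the sum
of `σ` over the two edges at the corner. Where an indicator jumps at `ξ₀`, the two values agree and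
cancel modulo 2. -/
theorem eventually_sum_ind_eq {ξ₀ : ℝ} (σ : Fin Q.n → ZMod 2)
    (h : ∀ i, (Q.poly (finRotate Q.n i)).1 = ξ₀ → σ (finRotate Q.n i) = σ i) :
    ∀ᶠ ξ in 𝓝 ξ₀, ∑ i, (Q.ind i ξ + Q.ind (finRotate Q.n i) ξ) * σ i =
      ∑ i, (Q.ind i ξ₀ + Q.ind (finRotate Q.n i) ξ₀) * σ i := by
  have key : ∀ ξ, ∑ i, (Q.ind i ξ + Q.ind (finRotate Q.n i) ξ) * σ i =
      ∑ i, Q.ind (finRotate Q.n i) ξ * (σ (finRotate Q.n i) + σ i) := by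
    intro ξ
    simp only [add_mul, mul_add, Finset.sum_add_distrib]
    rw [Equiv.sum_comp (finRotate Q.n) fun i => Q.ind i ξ * σ i]
  simp only [key]
  have : ∀ i, ∀ᶠ ξ in 𝓝 ξ₀, Q.ind (finRotate Q.n i) ξ * (σ (finRotate Q.n i) + σ i) =
      Q.ind (finRotate Q.n i) ξ₀ * (σ (finRotate Q.n i) + σ i) := by
    intro i
    by_cases hi : (Q.poly (finRotate Q.n i)).1 = ξ₀
    · simp [-finRotate_apply, h i hi, CharTwo.add_self_eq_zero]
    · filter_upwards [eventually_ind_eq hi] with ξ hξ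
      rw [hξ]
  filter_upwards [eventually_all.2 this] with ξ hξ
  exact Finset.sum_congr rfl fun i _ => hξ i

/-- Away from the edges in `T`, the parity of the number of edges in `T` above a point is locally
constant, at abscissas where `T` contains both or neither of the edges at any corner. -/
theorem eventually_crossSum_eq (T : Set (Fin Q.n)) (p : ℝ × ℝ)
    (h1 : ∀ i ∈ T, p ∉ Q.poly.edgeSet ℝ i)
    (h2 : ∀ i, (Q.poly (finRotate Q.n i)).1 = p.1 → (finRotate Q.n i ∈ T ↔ i ∈ T)) :
    ∀ᶠ q in 𝓝 p, Q.crossSum T q = Q.crossSum T p := by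
  classical
  -- A vertical edge is never counted; its height is chosen only so that `σ` can be compared across
  -- consecutive edges.
  let lev : Fin Q.n → ℝ := fun i => if Q.EdgeVertical i then (Q.poly i).2 else Q.edgeY i p.1
  let σ : Fin Q.n → ZMod 2 := fun i => if i ∈ T ∧ p.2 < lev i then 1 else 0
  -- At a corner on the vertical line through `p`, a non-vertical edge has the height of the corner,
  -- and a vertical edge in `T` has both ends on the same side of `p` since it misses `p`.
  have hσ : ∀ i, (Q.poly (finRotate Q.n i)).1 = p.1 → σ (finRotate Q.n i) = σ i := by
    intro i hi
    by_cases hT : i ∈ T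
    swap
    · have hT' : finRotate Q.n i ∉ T := fun h => hT ((h2 i hi).1 h)
      simp [-finRotate_apply, σ, hT, hT']
    have hT' := (h2 i hi).2 hT
    have l1 : lev (finRotate Q.n i) = (Q.poly (finRotate Q.n i)).2 := by
      by_cases hv : Q.EdgeVertical (finRotate Q.n i)
      · simp [-finRotate_apply, lev, hv]
      · simp only [lev, hv, if_false]
        rw [← hi, edgeY_left]
    by_cases hv : Q.EdgeVertical i
    · have l2 : lev i = (Q.poly i).2 := by simp [-finRotate_apply, lev, hv]
      have hiff : p.2 < (Q.poly (finRotate Q.n i)).2 ↔ p.2 < (Q.poly i).2 := by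
        have hv' : (Q.poly i).1 = (Q.poly (finRotate Q.n i)).1 := hv
        have hn := h1 i hT
        by_contra hc
        refine hn (mem_edgeSet_of_vertical hv (hi.symm.trans hv'.symm) ?_)
        rw [mem_uIcc]
        by_cases a : p.2 < (Q.poly i).2
        · exact Or.inr ⟨by by_contra! b; exact hc ⟨fun _ => a, fun _ => b⟩, a.le⟩
        · exact Or.inl ⟨not_lt.1 a, by
            by_contra! b; exact hc ⟨fun c => absurd c (not_lt.2 b.le), fun c => absurd c a⟩⟩
      simp [-finRotate_apply, σ, hT, hT', l1, l2, hiff]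
    · have l2 : lev i = (Q.poly (finRotate Q.n i)).2 := by
        simp only [lev, hv, if_false]
        rw [← hi, edgeY_right hv]
      simp [-finRotate_apply, σ, hT, hT', l1, l2]
  have hterm : ∀ i, ∀ᶠ q : ℝ × ℝ in 𝓝 p,
      (if i ∈ T ∧ q.1 ∈ Q.edgeIco i ∧ q.2 < Q.edgeY i q.1 then (1 : ZMod 2) else 0) =
        (Q.ind i q.1 + Q.ind (finRotate Q.n i) q.1) * σ i := by
    intro i
    by_cases hv : Q.EdgeVertical i
    · refine Eventually.of_forall fun q => ?_
      rw [ind_add_ind]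
      simp [edgeVertical_iff.1 hv]
    by_cases hT : i ∈ T
    swap
    · simp [σ, hT]
    have l : lev i = Q.edgeY i p.1 := by simp [-finRotate_apply, lev, hv]
    by_cases hm : p.1 ∈ uIcc (Q.poly i).1 (Q.poly (finRotate Q.n i)).1
    · have hne : p.2 ≠ Q.edgeY i p.1 := by
        intro h
        refine h1 i hT ?_
        have := mk_edgeY_mem_edgeSet hv hm
        rwa [← h] at this
      have hc : ContinuousAt (fun q : ℝ × ℝ => Q.edgeY i q.1) p :=
        ((continuous_edgeY i).comp continuous_fst).continuousAt
      have hev : ∀ᶠ q : ℝ × ℝ in 𝓝 p, (q.2 < Q.edgeY i q.1 ↔ p.2 < Q.edgeY i p.1) := by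
        rcases lt_or_gt_of_ne hne with h | h
        · filter_upwards [continuousAt_snd.eventually_lt hc h] with q hq
          exact ⟨fun _ => h, fun _ => hq⟩
        · filter_upwards [hc.eventually_lt continuousAt_snd h] with q hq
          exact ⟨fun h' => absurd h' (not_lt.2 hq.le), fun h' => absurd h' (not_lt.2 h.le)⟩
      filter_upwards [hev] with q hq
      rw [ind_add_ind]
      by_cases a : q.1 ∈ Q.edgeIco i <;> by_cases b : p.2 < Q.edgeY i p.1 <;>
        simp [σ, hT, l, hq, a, b]
    · have hc : IsOpen {q : ℝ × ℝ | q.1 ∉ uIcc (Q.poly i).1 (Q.poly (finRotate Q.n i)).1} :=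
        (isClosed_Icc.preimage continuous_fst).isOpen_compl
      filter_upwards [hc.mem_nhds hm] with q hq
      have hq' : q.1 ∉ Q.edgeIco i := by
        rw [mem_edgeIco, not_not]
        have hq'' : ¬ q.1 ∈ uIcc (Q.poly i).1 (Q.poly (finRotate Q.n i)).1 := hq
        rw [mem_uIcc] at hq''
        push Not at hq''
        constructor
        · intro h; exact (hq''.1 h).le
        · intro h; exact (hq''.2 h).le
      rw [ind_add_ind]
      simp [hq']
  have hall := eventually_all.2 hterm
  have hsum : ∀ᶠ q : ℝ × ℝ in 𝓝 p, Q.crossSum T q =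
      ∑ i, (Q.ind i q.1 + Q.ind (finRotate Q.n i) q.1) * σ i := by
    filter_upwards [hall] with q hq
    exact Finset.sum_congr rfl fun i _ => hq i
  have hp := hsum.self_of_nhds
  filter_upwards [hsum, continuousAt_fst.eventually (eventually_sum_ind_eq σ hσ)] with q a b
  rw [a, b, hp]

theorem _root_.IsPreconnected.eq_of_eventually_eq {X α : Type*} [TopologicalSpace X] {W : Set X}
    (hW : IsPreconnected W) {F : X → α} (hF : ∀ p ∈ W, ∀ᶠ q in 𝓝[W] p, F q = F p)
    {p q : X}
    (hp : p ∈ W) (hq : q ∈ W) : F p = F q := by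
  let _ : TopologicalSpace α := ⊥
  have : DiscreteTopology α := ⟨rfl⟩
  have hc : ContinuousOn F W := fun x hx =>
    tendsto_nhds_of_eventually_eq (hF x hx)
  exact hW.constant hc hp hq

/-! ### Constancy of the parity along a maximal outstretched segment -/

namespace Segment

variable {S : Segment Q}

theorem between_ends_of_directed {ε : ℝ} (hε : ε = 1 ∨ ε = -1) (h : StepsDirected ε S.xSeq S.len.val)
    {ξ : ℝ} (hξ : ξ ∈ S.xIoo) :
    0 < ε * (ξ - S.xSeq 0) ∧ 0 < ε * (S.xSeq S.len.val - ξ) := by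
  obtain ⟨⟨_, ⟨_, ⟨k, hk, rfl⟩, rfl⟩, h1⟩, _, ⟨_, ⟨l, hl, rfl⟩, rfl⟩, h2⟩ := hξ
  have h1' : S.xSeq k < ξ := h1
  have h2' : ξ < S.xSeq l := h2
  have a1 := h.mono (Nat.zero_le k) hk
  have a2 := h.mono (Nat.zero_le l) hl
  have b1 := h.mono hk le_rfl
  have b2 := h.mono hl le_rfl
  rcases hε with rfl | rfl <;> constructor <;> linarith

theorem mem_xIoo_of_directed {ε : ℝ} (hε : ε = 1 ∨ ε = -1)
    {ξ : ℝ} (h1 : 0 < ε * (ξ - S.xSeq 0)) (h2 : 0 < ε * (S.xSeq S.len.val - ξ)) :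
    ξ ∈ S.xIoo := by
  have m0 : Q.poly (S.idx 0) ∈ S.corners := ⟨_, ⟨0, Nat.zero_le _, rfl⟩, rfl⟩
  have m1 : Q.poly (S.idx S.len.val) ∈ S.corners := ⟨_, ⟨_, le_rfl, rfl⟩, rfl⟩
  unfold xSeq at h1 h2
  rcases hε with rfl | rfl
  · exact ⟨⟨_, m0, by linarith⟩, _, m1, by linarith⟩
  · exact ⟨⟨_, m1, by linarith⟩, _, m0, by linarith⟩

/-- Terminal edges are not vertical, so the first and last steps are strict; this puts all inner
corners strictly between the ends. -/
theorem exists_directed_of_mem_xIoo (hS : S.Outstretched) {ξ : ℝ} (hξ : ξ ∈ S.xIoo) :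
    0 < S.len.val ∧ ∃ ε : ℝ, (ε = 1 ∨ ε = -1) ∧ StepsDirected ε S.xSeq S.len.val ∧
      0 < ε * (S.xSeq 1 - S.xSeq 0) ∧
      0 < ε * (S.xSeq S.len.val - S.xSeq (S.len.val - 1)) := by
  have h0 : 0 < S.len.val := by
    obtain ⟨⟨_, ⟨_, ⟨k, hk, rfl⟩, rfl⟩, h1⟩, _, ⟨_, ⟨l, hl, rfl⟩, rfl⟩, h2⟩ := hξ
    by_contra! hc
    have hk0 : k = 0 := by omega
    have hl0 : l = 0 := by omega
    subst hk0 hl0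
    linarith
  obtain ⟨hv1, hv2⟩ := hS.2 h0
  obtain ⟨ε, hε, hpos⟩ := S.exists_sign_of_not_vertical hv1
  have hD := hS.directed h0 hε hpos
  refine ⟨h0, ε, hε, hD, hpos, ?_⟩
  have h1 := hD (S.len.val - 1) (by omega)
  have h2 : S.len.val - 1 + 1 = S.len.val := by omega
  rw [edgeVertical_idx] at hv2
  rw [h2] at h1 hv2
  refine lt_of_le_of_ne h1 fun h => ?_
  rcases mul_eq_zero.1 h.symm with h | h
  · rcases hε with rfl | rfl <;> norm_num at h
  · exact hv2 (by linarith)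

/-- The part of the segment strictly between its ends. -/
def interiorPart (S : Segment Q) : Set (ℝ × ℝ) :=
  {p | p.1 ∈ S.xIoo ∧ ∃ e ∈ S.edgeIdx, p ∈ Q.poly.edgeSet ℝ e}

theorem convex_xIoo (S : Segment Q) : Convex ℝ S.xIoo := by
  have : OrdConnected S.xIoo := by
    refine ⟨?_⟩
    rintro a ⟨⟨v, hv, h1⟩, -⟩ b ⟨-, w, hw, h2⟩ c ⟨hac, hcb⟩
    exact ⟨⟨v, hv, h1.trans_le hac⟩, w, hw, hcb.trans_lt h2⟩
  exact this.convex

/-- A chain of convex pieces, one per edge; consecutive pieces share an inner corner. -/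
theorem isPreconnected_interiorPart (hS : S.Outstretched) : IsPreconnected S.interiorPart := by
  rcases S.xIoo.eq_empty_or_nonempty with he | ⟨ξ, hξ⟩
  · have : S.interiorPart = ∅ := by
      rw [eq_empty_iff_forall_notMem]
      rintro p ⟨hp, -⟩
      exact absurd hp (he ▸ notMem_empty _)
    rw [this]
    exact isPreconnected_empty
  obtain ⟨h0, ε, hε, hD, hf, hl⟩ := exists_directed_of_mem_xIoo hS hξ
  have heq : S.interiorPart =
      ⋃ k ∈ Iio S.len.val, (Prod.fst ⁻¹' S.xIoo ∩ Q.poly.edgeSet ℝ (S.idx k)) := by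
    ext p
    simp only [interiorPart, mem_ofPred_eq, mem_iUnion, exists_prop, mem_inter_iff, mem_preimage,
      mem_Iio]
    constructor
    · rintro ⟨h1, _, ⟨k, hk, rfl⟩, h2⟩
      exact ⟨k, hk, h1, h2⟩
    · rintro ⟨k, hk, h1, h2⟩
      exact ⟨h1, _, ⟨k, hk, rfl⟩, h2⟩
  rw [heq]
  refine IsPreconnected.biUnion_of_chain ordConnected_Iio (fun k _ => ?_) (fun k _ hk => ?_)
  · refine Convex.isPreconnected (Convex.inter ?_ ?_)
    · exact (convex_xIoo S).linear_preimage (LinearMap.fst ℝ ℝ ℝ)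
    · rw [edgeSet_eq_segment]
      exact convex_segment _ _
  · have hk' : k + 1 < S.len.val := hk
    refine ⟨Q.poly (S.idx (k + 1)), ⟨?_, ?_⟩, ?_, ?_⟩
    · have a := hD.mono (i := 1) (j := k + 1) (by omega) (by omega)
      have b := hD.mono (i := k + 1) (j := S.len.val - 1) (by omega) (by omega)
      apply mem_xIoo_of_directed hε
      · change 0 < ε * (S.xSeq (k + 1) - S.xSeq 0)
        nlinarith
      · change 0 < ε * (S.xSeq S.len.val - S.xSeq (k + 1))
        nlinarith
    · rw [idx_succ]
      exact poly_finRotate_mem_edgeSet _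
    · change S.xSeq (k + 1) ∈ S.xIoo
      have a := hD.mono (i := 1) (j := k + 1) (by omega) (by omega)
      have b := hD.mono (i := k + 1) (j := S.len.val - 1) (by omega) (by omega)
      apply mem_xIoo_of_directed hε
      · nlinarith
      · nlinarith
    · exact poly_mem_edgeSet _

theorem pos_lt_of_xSeq_mem (hS : S.Outstretched) {k : ℕ}
    (h : S.xSeq k ∈ S.xIoo) (hk : k ≤ S.len.val) : 0 < k ∧ k < S.len.val := by
  obtain ⟨h0, ε, hε, hD, -, -⟩ := exists_directed_of_mem_xIoo hS h
  have := between_ends_of_directed hε hD h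
  constructor
  · refine Nat.pos_of_ne_zero fun hk0 => ?_
    subst hk0
    simp at this
  · refine lt_of_le_of_ne hk fun hk0 => ?_
    rw [hk0] at this
    simp at this

/-- A corner over the open interval of `S` is not an end of `S`, so its two edges both belong to `S`
or both do not. This is the corner condition of `eventually_crossSum_eq` for the complement of `S`.
-/
theorem mem_edgeIdx_finRotate_iff (hS : S.Outstretched) {i : Fin Q.n}
    (h : (Q.poly (finRotate Q.n i)).1 ∈ S.xIoo) :
    finRotate Q.n i ∈ S.edgeIdx ↔ i ∈ S.edgeIdx := by
  constructor
  · rintro ⟨k, hk, hki⟩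
    have hx : S.xSeq k ∈ S.xIoo := by rw [xSeq, ← hki]; exact h
    obtain ⟨k1, k2⟩ := pos_lt_of_xSeq_mem hS hx hk.le
    obtain ⟨m, rfl⟩ := Nat.exists_eq_succ_of_ne_zero k1.ne'
    refine ⟨m, by omega, (finRotate Q.n).injective ?_⟩
    rw [hki, Nat.succ_eq_add_one, idx_succ]
  · rintro ⟨k, hk, rfl⟩
    rw [← idx_succ] at h ⊢
    exact ⟨k + 1, (pos_lt_of_xSeq_mem hS h hk).2, rfl⟩

theorem notMem_edgeSet_of_mem_interiorPart (hS : S.Outstretched) {p : ℝ × ℝ}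
    (hp : p ∈ S.interiorPart) {j : Fin Q.n} (hj : j ∉ S.edgeIdx) : p ∉ Q.poly.edgeSet ℝ j := by
  intro hpj
  obtain ⟨h1, e, he, hpe⟩ := hp
  have hne : j ≠ e := fun h => hj (h ▸ he)
  rcases eq_end_of_mem_of_mem hne hpj hpe with rfl | rfl
  · rcases eq_or_eq_of_poly_mem hpe with h | h
    · exact hne h.symm
    · subst h
      exact hj ((mem_edgeIdx_finRotate_iff hS h1).2 he)
  · rcases eq_or_eq_of_poly_mem hpe with h | h
    · subst h
      exact hj ((mem_edgeIdx_finRotate_iff hS h1).1 he)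
    · exact hne ((finRotate Q.n).injective h).symm

theorem mem_uIcc_of_mem_edgeIco {e : Fin Q.n} {ξ : ℝ} (h : ξ ∈ Q.edgeIco e) :
    ξ ∈ uIcc (Q.poly e).1 (Q.poly (finRotate Q.n e)).1 := by
  rw [mem_edgeIco] at h
  rw [mem_uIcc]
  rcases le_total (Q.poly e).1 ξ with a | a <;>
    rcases le_total (Q.poly (finRotate Q.n e)).1 ξ with b | b
  · exact absurd ⟨fun _ => b, fun _ => a⟩ h
  · exact Or.inl ⟨a, b⟩
  · exact Or.inr ⟨b, a⟩
  · by_cases c : (Q.poly e).1 ≤ ξ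
    · exact Or.inl ⟨c, b⟩
    · by_cases d : (Q.poly (finRotate Q.n e)).1 ≤ ξ
      · exact Or.inr ⟨d, a⟩
      · exact absurd ⟨fun x => absurd x c, fun x => absurd x d⟩ h

theorem xIoo_subset_xIco (S : Segment Q) : S.xIoo ⊆ S.xIco := by
  rintro ξ ⟨⟨v, hv, h1⟩, h2⟩
  exact ⟨⟨v, hv, h1.le⟩, h2⟩

theorem mk_yVal_mem_edgeSet {ξ : ℝ} (hξ : ξ ∈ S.xIco) :
    (ξ, S.yVal ξ) ∈ Q.poly.edgeSet ℝ (S.activeEdge ξ) := by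
  have h := activeEdge_spec hξ
  exact mk_edgeY_mem_edgeSet (not_vertical_of_mem h.2) (mem_uIcc_of_mem_edgeIco h.2)

/-- The edges at or above `S` are the active edge and the edges outside `S` above `S`. -/
theorem ncard_above_eq (hS : S.Outstretched) {ξ : ℝ} (hξ : ξ ∈ S.xIoo) :
    ((S.above ξ).ncard : ZMod 2) = Q.crossSum S.edgeIdxᶜ (ξ, S.yVal ξ) + 1 := by
  have hspec := activeEdge_spec (xIoo_subset_xIco S hξ)
  have hmem : (ξ, S.yVal ξ) ∈ S.interiorPart :=
    ⟨hξ, _, hspec.1, mk_yVal_mem_edgeSet (xIoo_subset_xIco S hξ)⟩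
  rw [crossSum_eq_ncard, ncard_above]
  have : {e | ξ ∈ Q.edgeIco e ∧ S.yVal ξ ≤ Q.edgeY e ξ} = insert (S.activeEdge ξ)
      {i | i ∈ S.edgeIdxᶜ ∧ (ξ, S.yVal ξ).1 ∈ Q.edgeIco i ∧
        (ξ, S.yVal ξ).2 < Q.edgeY i (ξ, S.yVal ξ).1} := by
    ext e
    simp only [mem_ofPred_eq, mem_insert_iff, mem_compl_iff]
    constructor
    · rintro ⟨h1, h2⟩
      by_cases he : e ∈ S.edgeIdx
      · exact Or.inl (activeEdge_eq hS he h1).symm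
      · refine Or.inr ⟨he, h1, lt_of_le_of_ne h2 fun h => ?_⟩
        refine notMem_edgeSet_of_mem_interiorPart hS hmem he ?_
        rw [h]
        exact mk_edgeY_mem_edgeSet (not_vertical_of_mem h1) (mem_uIcc_of_mem_edgeIco h1)
    · rintro (rfl | ⟨-, h1, h2⟩)
      · exact ⟨hspec.2, le_rfl⟩
      · exact ⟨h1, h2.le⟩
  rw [this, ncard_insert_of_notMem (fun h => h.1 hspec.1)]
  push_cast
  rfl

/-- The parity of an outstretched segment can be read off at any abscissa strictly between its
ends. -/
theorem parity_eq_zero_iff (hS : S.Outstretched) {ξ : ℝ} (hξ : ξ ∈ S.xIoo) :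
    S.parity = 0 ↔ Even (S.above ξ).ncard := by
  have key : ∀ ξ', ξ' ∈ S.xIoo → (Even (S.above ξ').ncard ↔ Even (S.above ξ).ncard) := by
    intro ξ' hξ'
    rw [← ZMod.natCast_eq_zero_iff_even, ← ZMod.natCast_eq_zero_iff_even, ncard_above_eq hS hξ,
      ncard_above_eq hS hξ']
    have hm : ∀ {ζ}, ζ ∈ S.xIoo → (ζ, S.yVal ζ) ∈ S.interiorPart := fun h =>
      ⟨h, _, (activeEdge_spec (xIoo_subset_xIco S h)).1,
        mk_yVal_mem_edgeSet (xIoo_subset_xIco S h)⟩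
    -- The point travels along `S` itself; no edge outside `S` meets its interior part, so the count
    -- of those edges above keeps its parity.
    rw [(isPreconnected_interiorPart hS).eq_of_eventually_eq (F := Q.crossSum S.edgeIdxᶜ) ?_
      (hm hξ') (hm hξ)]
    intro p hp
    refine (eventually_crossSum_eq _ p
      (fun i hi => notMem_edgeSet_of_mem_interiorPart hS hp hi) ?_).filter_mono nhdsWithin_le_nhds
    intro i hi
    exact not_congr (mem_edgeIdx_finRotate_iff hS (hi ▸ hp.1))
  rw [parity]
  constructor
  · intro h
    by_contra hc
    rw [if_neg fun h' => hc (h' ξ hξ)] at h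
    exact one_ne_zero h
  · intro h
    rw [if_pos fun ξ' hξ' => (key ξ' hξ').2 h]

end Segment
end SimplePolygon

/-! ### Two rays cut a disc into two connected pieces -/

/-- The determinant of the vectors `u` and `x`, as a linear function of `x`. -/
def detL (u : ℝ × ℝ) : ℝ × ℝ →ₗ[ℝ] ℝ :=
  u.1 • LinearMap.snd ℝ ℝ ℝ - u.2 • LinearMap.fst ℝ ℝ ℝ

theorem detL_apply (u x : ℝ × ℝ) : detL u x = u.1 * x.2 - u.2 * x.1 := by
  simp [detL]

/-- The ray from `q` in direction `u`. -/
def ray (q u : ℝ × ℝ) : Set (ℝ × ℝ) := {p | ∃ t : ℝ, 0 ≤ t ∧ p = q + t • u}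

theorem eventually_add_smul_mem {U : Set (ℝ × ℝ)} (hU : IsOpen U) {p : ℝ × ℝ} (hp : p ∈ U)
    (z : ℝ × ℝ) : ∀ᶠ ε : ℝ in 𝓝[>] 0, p + ε • z ∈ U := by
  have hc : Continuous fun ε : ℝ => p + ε • z := by fun_prop
  have : ∀ᶠ ε : ℝ in 𝓝 0, p + ε • z ∈ U :=
    hc.continuousAt.eventually_mem (by simpa using hU.mem_nhds hp)
  exact this.filter_mono nhdsWithin_le_nhds

theorem mem_closure_of_eventually_add_smul {S : Set (ℝ × ℝ)} {p z : ℝ × ℝ}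
    (h : ∀ᶠ ε : ℝ in 𝓝[>] 0, p + ε • z ∈ S) : p ∈ closure S := by
  have hc : Continuous fun ε : ℝ => p + ε • z := by fun_prop
  have ht : Tendsto (fun ε : ℝ => p + ε • z) (𝓝[>] 0) (𝓝 p) := by
    have := hc.tendsto 0
    simp only [zero_smul, add_zero] at this
    exact this.mono_left nhdsWithin_le_nhds
  exact mem_closure_of_tendsto ht h

/-- The set `R` cuts the open set `U` into two connected pieces, both of which accumulate at each
point of `R` in `U`. -/
def SplitsInTwo (U R : Set (ℝ × ℝ)) : Prop :=
  ∃ A B : Set (ℝ × ℝ), IsPreconnected A ∧ IsPreconnected B ∧ U \ R = A ∪ B ∧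
    U ∩ R ⊆ closure A ∩ closure B

theorem convex_detL_lt (u : ℝ × ℝ) (c : ℝ) : Convex ℝ {p | detL u p < c} :=
  convex_halfSpace_lt (detL u).isLinear c

theorem convex_lt_detL (u : ℝ × ℝ) (c : ℝ) : Convex ℝ {p | c < detL u p} :=
  convex_halfSpace_gt (detL u).isLinear c

/-- Write `p = q + a • u + b • w`. One piece is the convex sector `a, b > 0`; the other is the union
of the half-planes `a < 0` and `b < 0`. What is left over is the two rays. -/
theorem splitsInTwo_of_det_pos {U : Set (ℝ × ℝ)} (hU : IsOpen U) (hUc : Convex ℝ U)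
    {q : ℝ × ℝ} (hq : q ∈ U) {u w : ℝ × ℝ} (hD : 0 < detL u w) :
    SplitsInTwo U (ray q u ∪ ray q w) := by
  set D := detL u w with hDdef
  have huu : detL u u = 0 := by rw [detL_apply]; ring
  have hww : detL w w = 0 := by rw [detL_apply]; ring
  have hwu : detL w u = -D := by rw [hDdef, detL_apply, detL_apply]; ring
  refine ⟨U ∩ ({p | detL u q < detL u p} ∩ {p | detL w p < detL w q}),
    (U ∩ {p | detL u p < detL u q}) ∪ (U ∩ {p | detL w q < detL w p}), ?_, ?_, ?_, ?_⟩
  · exact (hUc.inter ((convex_lt_detL _ _).inter (convex_detL_lt _ _))).isPreconnected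
  -- A point slightly behind `q` lies in both half-planes and joins them.
  · obtain ⟨ε, h1, h2⟩ := ((eventually_add_smul_mem hU hq (-(u + w))).and
      self_mem_nhdsWithin).exists
    have h2' : 0 < ε := h2
    refine IsPreconnected.union (q + ε • -(u + w)) ⟨h1, ?_⟩ ⟨h1, ?_⟩
      (hUc.inter (convex_detL_lt _ _)).isPreconnected
      (hUc.inter (convex_lt_detL _ _)).isPreconnected
    · simp only [mem_ofPred_eq, map_add, map_smul, map_neg, smul_eq_mul, huu, ← hDdef]
      nlinarith
    · simp only [mem_ofPred_eq, map_add, map_smul, map_neg, smul_eq_mul, hww, hwu]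
      nlinarith
  · ext p
    constructor
    · rintro ⟨hp, hR⟩
      by_contra hc
      simp only [mem_union, mem_inter_iff, mem_ofPred_eq, hp, true_and, not_or, not_lt,
        not_and] at hc
      obtain ⟨h1, h2, h3⟩ := hc
      -- Coordinates of `p - q` in the basis `u`, `w`, by Cramer's rule.
      set a := (detL w q - detL w p) / D with ha
      set b := (detL u p - detL u q) / D with hb
      have ha0 : 0 ≤ a := div_nonneg (by linarith) hD.le
      have hb0 : 0 ≤ b := div_nonneg (by linarith) hD.le
      have hdec : p = q + a • u + b • w := by
        have ea : a * D = detL w q - detL w p := div_mul_cancel₀ _ hD.ne'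
        have eb : b * D = detL u p - detL u q := div_mul_cancel₀ _ hD.ne'
        have eD : D = u.1 * w.2 - u.2 * w.1 := detL_apply u w
        simp only [detL_apply] at ea eb
        refine Prod.ext (mul_left_cancel₀ hD.ne' ?_) (mul_left_cancel₀ hD.ne' ?_)
        · simp only [Prod.fst_add, Prod.smul_fst, smul_eq_mul]
          linear_combination (p.1 - q.1) * eD - u.1 * ea - w.1 * eb
        · simp only [Prod.snd_add, Prod.smul_snd, smul_eq_mul]
          linear_combination (p.2 - q.2) * eD - u.2 * ea - w.2 * eb
      apply hR
      rcases ha0.eq_or_lt with h | h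
      · exact Or.inr ⟨b, hb0, by rw [hdec, ← h]; simp⟩
      rcases hb0.eq_or_lt with h' | h'
      · exact Or.inl ⟨a, ha0, by rw [hdec, ← h']; simp⟩
      exfalso
      have e1 : detL u p - detL u q = b * D := by rw [hb]; field_simp
      have e2 : detL w q - detL w p = a * D := by rw [ha]; field_simp
      have := h1 (by nlinarith)
      nlinarith
    · rintro (⟨hp, h1, h2⟩ | ⟨hp, h1⟩ | ⟨hp, h1⟩) <;> refine ⟨hp, ?_⟩ <;>
        rintro (⟨t, ht, rfl⟩ | ⟨t, ht, rfl⟩) <;>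
        simp only [mem_ofPred_eq, map_add, map_smul, smul_eq_mul, huu, hww, hwu, ← hDdef] at * <;>
        nlinarith
  · rintro p ⟨hp, hR⟩
    have hev := fun z => (eventually_add_smul_mem hU hp z).and
      (self_mem_nhdsWithin : Ioi (0 : ℝ) ∈ 𝓝[>] 0)
    rcases hR with ⟨t, ht, rfl⟩ | ⟨t, ht, rfl⟩
    · constructor
      · refine mem_closure_of_eventually_add_smul (z := u + w) ?_
        filter_upwards [hev (u + w)] with ε ⟨h1, h2⟩
        have h2' : 0 < ε := h2
        refine ⟨h1, ?_, ?_⟩ <;>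
          simp only [mem_ofPred_eq, map_add, map_smul, smul_eq_mul, huu, hww, hwu, ← hDdef] <;>
          nlinarith
      · refine mem_closure_of_eventually_add_smul (z := -w) ?_
        filter_upwards [hev (-w)] with ε ⟨h1, h2⟩
        have h2' : 0 < ε := h2
        refine Or.inl ⟨h1, ?_⟩
        simp only [mem_ofPred_eq, map_add, map_smul, map_neg, smul_eq_mul, huu, ← hDdef]
        nlinarith
    · constructor
      · refine mem_closure_of_eventually_add_smul (z := u + w) ?_
        filter_upwards [hev (u + w)] with ε ⟨h1, h2⟩
        have h2' : 0 < ε := h2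
        refine ⟨h1, ?_, ?_⟩ <;>
          simp only [mem_ofPred_eq, map_add, map_smul, smul_eq_mul, huu, hww, hwu, ← hDdef] <;>
          nlinarith
      · refine mem_closure_of_eventually_add_smul (z := -u) ?_
        filter_upwards [hev (-u)] with ε ⟨h1, h2⟩
        have h2' : 0 < ε := h2
        refine Or.inr ⟨h1, ?_⟩
        simp only [mem_ofPred_eq, map_add, map_smul, map_neg, smul_eq_mul, hww, hwu]
        nlinarith

/-- Opposite rays form a line, a level set of `detL u`; the pieces are its two sides, reached along
the normal `(-u.2, u.1)`. -/
theorem splitsInTwo_of_opposite {U : Set (ℝ × ℝ)} (hU : IsOpen U) (hUc : Convex ℝ U)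
    {q : ℝ × ℝ} {u : ℝ × ℝ} (hu : u ≠ 0) {l : ℝ} (hl : 0 < l) :
    SplitsInTwo U (ray q u ∪ ray q (-l • u)) := by
  have huu : detL u u = 0 := by rw [detL_apply]; ring
  have hN : 0 < u.1 * u.1 + u.2 * u.2 := by
    by_contra! hc
    refine hu (Prod.ext ?_ ?_) <;> simp only [Prod.fst_zero, Prod.snd_zero] <;>
      nlinarith [mul_self_nonneg u.1, mul_self_nonneg u.2]
  have hn : detL u (-u.2, u.1) = u.1 * u.1 + u.2 * u.2 := by rw [detL_apply]; simp
  have hline : ∀ p, p ∈ ray q u ∪ ray q (-l • u) ↔ detL u p = detL u q := by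
    intro p
    constructor
    · rintro (⟨t, ht, rfl⟩ | ⟨t, ht, rfl⟩) <;> simp [huu]
    · intro h
      set t := ((p.1 - q.1) * u.1 + (p.2 - q.2) * u.2) / (u.1 * u.1 + u.2 * u.2) with ht
      rw [detL_apply, detL_apply] at h
      have hp : p = q + t • u := by
        have et : t * (u.1 * u.1 + u.2 * u.2) = _ := div_mul_cancel₀ _ hN.ne'
        refine Prod.ext (mul_left_cancel₀ hN.ne' ?_) (mul_left_cancel₀ hN.ne' ?_)
        · simp only [Prod.fst_add, Prod.smul_fst, smul_eq_mul]
          linear_combination -u.2 * h - u.1 * et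
        · simp only [Prod.snd_add, Prod.smul_snd, smul_eq_mul]
          linear_combination u.1 * h - u.2 * et
      rcases le_total 0 t with h0 | h0
      · exact Or.inl ⟨t, h0, hp⟩
      · refine Or.inr ⟨-t / l, div_nonneg (by linarith) hl.le, ?_⟩
        rw [smul_smul]
        have : -t / l * -l = t := by field_simp
        rw [this, hp]
  refine ⟨U ∩ {p | detL u q < detL u p}, U ∩ {p | detL u p < detL u q},
    (hUc.inter (convex_lt_detL _ _)).isPreconnected,
    (hUc.inter (convex_detL_lt _ _)).isPreconnected, ?_, ?_⟩
  · ext p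
    rw [Set.mem_sdiff, hline]
    simp only [mem_union, mem_inter_iff, mem_ofPred_eq]
    constructor
    · rintro ⟨h1, h2⟩
      rcases lt_or_gt_of_ne h2 with h | h
      · exact Or.inr ⟨h1, h⟩
      · exact Or.inl ⟨h1, h⟩
    · rintro (⟨h1, h2⟩ | ⟨h1, h2⟩)
      · exact ⟨h1, h2.ne'⟩
      · exact ⟨h1, h2.ne⟩
  · rintro p ⟨hp, hR⟩
    rw [hline] at hR
    have hev := fun z => (eventually_add_smul_mem hU hp z).and
      (self_mem_nhdsWithin : Ioi (0 : ℝ) ∈ 𝓝[>] 0)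
    constructor
    · refine mem_closure_of_eventually_add_smul (z := (-u.2, u.1)) ?_
      filter_upwards [hev (-u.2, u.1)] with ε ⟨h1, h2⟩
      have h2' : 0 < ε := h2
      refine ⟨h1, ?_⟩
      simp only [mem_ofPred_eq, map_add, map_smul, smul_eq_mul, hn, hR]
      nlinarith
    · refine mem_closure_of_eventually_add_smul (z := -(-u.2, u.1)) ?_
      filter_upwards [hev (-(-u.2, u.1))] with ε ⟨h1, h2⟩
      have h2' : 0 < ε := h2
      refine ⟨h1, ?_⟩
      simp only [mem_ofPred_eq, map_add, map_smul, map_neg, smul_eq_mul, hn, hR]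
      nlinarith

theorem splitsInTwo_rays {U : Set (ℝ × ℝ)} (hU : IsOpen U) (hUc : Convex ℝ U)
    {q : ℝ × ℝ} (hq : q ∈ U) {u w : ℝ × ℝ} (hu : u ≠ 0) (hw : w ≠ 0)
    (huw : ¬ ∃ t : ℝ, 0 < t ∧ w = t • u) : SplitsInTwo U (ray q u ∪ ray q w) := by
  rcases lt_trichotomy 0 (detL u w) with h | h | h
  · exact splitsInTwo_of_det_pos hU hUc hq h
  · have hN : 0 < u.1 * u.1 + u.2 * u.2 := by
      by_contra! hc
      refine hu (Prod.ext ?_ ?_) <;> simp only [Prod.fst_zero, Prod.snd_zero] <;>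
        nlinarith [mul_self_nonneg u.1, mul_self_nonneg u.2]
    set t := (w.1 * u.1 + w.2 * u.2) / (u.1 * u.1 + u.2 * u.2) with ht
    rw [detL_apply] at h
    have hwt : w = t • u := by
      have et : t * (u.1 * u.1 + u.2 * u.2) = _ := div_mul_cancel₀ _ hN.ne'
      refine Prod.ext (mul_left_cancel₀ hN.ne' ?_) (mul_left_cancel₀ hN.ne' ?_)
      · simp only [Prod.smul_fst, smul_eq_mul]
        linear_combination u.2 * h - u.1 * et
      · simp only [Prod.smul_snd, smul_eq_mul]
        linear_combination -u.1 * h - u.2 * et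
    have ht0 : t < 0 := by
      rcases lt_trichotomy t 0 with h0 | h0 | h0
      · exact h0
      · exact absurd (by rw [hwt, h0, zero_smul]) hw
      · exact absurd ⟨t, h0, hwt⟩ huw
    have := splitsInTwo_of_opposite hU hUc (q := q) hu (l := -t) (by linarith)
    rwa [neg_neg, ← hwt] at this
  · have h' : 0 < detL w u := by
      rw [detL_apply] at h ⊢
      linarith
    rw [union_comm]
    exact splitsInTwo_of_det_pos hU hUc hq h'

theorem segment_eq_union_of_mem {a b q : ℝ × ℝ} (h : q ∈ segment ℝ a b) :
    segment ℝ a b = segment ℝ a q ∪ segment ℝ q b := by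
  rw [segment_eq_image_lineMap] at h
  obtain ⟨s, hs, rfl⟩ := h
  have e : ∀ x y : ℝ, AffineMap.lineMap a b '' uIcc x y =
      segment ℝ (AffineMap.lineMap a b x : ℝ × ℝ) (AffineMap.lineMap a b y) := fun x y => by
    rw [← segment_eq_uIcc, image_segment]
  have e0 := e 0 s
  have e1 := e s 1
  have e2 := e 0 1
  rw [AffineMap.lineMap_apply_zero] at e0 e2
  rw [AffineMap.lineMap_apply_one] at e1 e2
  rw [← e0, ← e1, ← e2, ← image_union, uIcc_of_le hs.1, uIcc_of_le hs.2, uIcc_of_le zero_le_one,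
    Icc_union_Icc_eq_Icc hs.1 hs.2]

theorem segment_inter_ball {q b : ℝ × ℝ} {ρ : ℝ} (hρ : ρ ≤ dist b q) :
    segment ℝ q b ∩ Metric.ball q ρ = ray q (b - q) ∩ Metric.ball q ρ := by
  ext p
  constructor
  · rintro ⟨h1, h2⟩
    rw [segment_eq_image'] at h1
    obtain ⟨t, ht, rfl⟩ := h1
    exact ⟨⟨t, ht.1, rfl⟩, h2⟩
  · rintro ⟨⟨t, ht, rfl⟩, h2⟩
    refine ⟨?_, h2⟩
    rw [segment_eq_image']
    refine ⟨t, ⟨ht, ?_⟩, rfl⟩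
    rw [Metric.mem_ball, dist_eq_norm, add_sub_cancel_left, norm_smul, Real.norm_of_nonneg ht]
      at h2
    rw [dist_eq_norm] at hρ
    by_contra! hc
    nlinarith [norm_nonneg (b - q)]

/-- Near a point where exactly two segments start, in different directions, the curve cuts the
plane into two connected pieces. -/
theorem exists_ball_splitsInTwo {K Z : Set (ℝ × ℝ)} {q a b : ℝ × ℝ}
    (hK : K = segment ℝ q a ∪ segment ℝ q b ∪ Z) (hZ : IsClosed Z) (hqZ : q ∉ Z) (ha : a ≠ q)
    (hb : b ≠ q) (hab : ¬ ∃ t : ℝ, 0 < t ∧ b - q = t • (a - q)) :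
    ∃ ρ > 0, SplitsInTwo (Metric.ball q ρ) K := by
  obtain ⟨ρ₀, hρ₀, hball⟩ := Metric.isOpen_iff.1 hZ.isOpen_compl q hqZ
  set ρ := min ρ₀ (min (dist a q) (dist b q)) with hρ
  have hpos : 0 < ρ := lt_min hρ₀ (lt_min (dist_pos.2 ha) (dist_pos.2 hb))
  refine ⟨ρ, hpos, ?_⟩
  have h := splitsInTwo_rays (Metric.isOpen_ball (x := q) (ε := ρ)) (convex_ball q ρ)
    (Metric.mem_ball_self hpos) (sub_ne_zero.2 ha) (sub_ne_zero.2 hb) hab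
  have hKR : Metric.ball q ρ ∩ K = Metric.ball q ρ ∩ (ray q (a - q) ∪ ray q (b - q)) := by
    have h1 := segment_inter_ball (q := q) (b := a) (ρ := ρ)
      ((min_le_right _ _).trans (min_le_left _ _))
    have h2 := segment_inter_ball (q := q) (b := b) (ρ := ρ)
      ((min_le_right _ _).trans (min_le_right _ _))
    have h3 : Metric.ball q ρ ∩ Z = ∅ := by
      rw [← disjoint_iff_inter_eq_empty, disjoint_left]
      exact fun x hx => hball (Metric.ball_subset_ball (min_le_left _ _) hx)
    rw [hK, inter_union_distrib_left, inter_union_distrib_left, h3, union_empty, inter_comm, h1,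
      inter_comm _ (segment ℝ q b), h2, inter_union_distrib_left, inter_comm,
      inter_comm (ray q (b - q))]
  obtain ⟨A, B, hA, hB, h1, h2⟩ := h
  refine ⟨A, B, hA, hB, ?_, ?_⟩
  · rw [← h1, ← sdiff_self_inter, hKR, sdiff_self_inter]
  · rw [hKR]
    exact h2

namespace SimplePolygon

variable {Q : SimplePolygon}

/-! ### The curve and the components of its complement -/

theorem isCompact_edgeSet (i : Fin Q.n) : IsCompact (Q.poly.edgeSet ℝ i) := by
  rw [Polygon.edgeSet_eq_image_edgePath]
  exact isCompact_Icc.image (AffineMap.lineMap_continuous (R := ℝ))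

theorem isCompact_curve (Q : SimplePolygon) : IsCompact Q.curve :=
  isCompact_iUnion fun i => isCompact_edgeSet i

theorem isClosed_curve (Q : SimplePolygon) : IsClosed Q.curve := Q.isCompact_curve.isClosed

theorem isPreconnected_curve (Q : SimplePolygon) : IsPreconnected Q.curve := by
  have hn := Q.three_le
  let i₀ : Fin Q.n := ⟨0, by omega⟩
  have : Q.curve = ⋃ k : ℕ, Q.poly.edgeSet ℝ ((⇑(finRotate Q.n))^[k] i₀) := by
    ext p
    rw [mem_curve, mem_iUnion]
    constructor
    · rintro ⟨i, hi⟩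
      obtain ⟨k, -, rfl⟩ := exists_finRotate_iterate_eq i₀ i
      exact ⟨k, hi⟩
    · rintro ⟨k, hk⟩
      exact ⟨_, hk⟩
  rw [this]
  refine IsPreconnected.iUnion_of_chain (fun k => ?_) fun k => ?_
  · rw [edgeSet_eq_segment]
    exact (convex_segment _ _).isPreconnected
  · refine ⟨Q.poly ((⇑(finRotate Q.n))^[k + 1] i₀), ?_, poly_mem_edgeSet _⟩
    rw [Function.iterate_succ_apply']
    exact poly_finRotate_mem_edgeSet _

/-- The two edges at a corner leave it in different directions. -/
theorem corner_directions (j : Fin Q.n) :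
    ¬ ∃ t : ℝ, 0 < t ∧ Q.poly (finRotate Q.n (finRotate Q.n j)) - Q.poly (finRotate Q.n j) =
      t • (Q.poly j - Q.poly (finRotate Q.n j)) := by
  rintro ⟨t, ht, h⟩
  have hne : j ≠ finRotate Q.n j := (finRotate_ne_self (by have := Q.three_le; omega) j).symm
  set q := Q.poly (finRotate Q.n j)
  set a := Q.poly j
  -- Small enough that the same point has parameter `s < 1` on one edge and `s / t ≤ 1` on the
  -- other, against planarity.
  set s := min 1 t / 2 with hs
  have hs0 : 0 < s := by positivity
  have hs1 : s < 1 := by have := min_le_left 1 t; linarith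
  have hst : s / t ≤ 1 := by
    rw [div_le_one ht]
    have := min_le_right 1 t
    linarith
  have m1 : q + s • (a - q) ∈ openSegment ℝ a q := by
    rw [openSegment_symm, openSegment_eq_image']
    exact ⟨s, ⟨hs0, hs1⟩, rfl⟩
  refine disjoint_left.1 (Q.planar j (finRotate Q.n j) hne) m1 ?_
  rw [edgeSet_eq_segment, segment_eq_image']
  refine ⟨s / t, ⟨by positivity, hst⟩, ?_⟩
  change q + (s / t) • (_ - q) = _
  rw [h, smul_smul]
  congr 2
  field_simp

theorem curve_eq_union (T : Set (Fin Q.n)) :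
    Q.curve = (⋃ i ∈ T, Q.poly.edgeSet ℝ i) ∪ ⋃ i ∈ Tᶜ, Q.poly.edgeSet ℝ i := by
  ext p
  simp only [mem_curve, mem_union, mem_iUnion, exists_prop, mem_compl_iff]
  constructor
  · rintro ⟨i, hi⟩
    by_cases h : i ∈ T
    · exact Or.inl ⟨i, h, hi⟩
    · exact Or.inr ⟨i, h, hi⟩
  · rintro (⟨i, -, hi⟩ | ⟨i, -, hi⟩) <;> exact ⟨i, hi⟩

theorem isClosed_biUnion_edgeSet (T : Set (Fin Q.n)) :
    IsClosed (⋃ i ∈ T, Q.poly.edgeSet ℝ i) :=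
  (toFinite T).isClosed_biUnion fun i _ => (isCompact_edgeSet i).isClosed

/-- At a corner the two segments are its edges; elsewhere the edge through `q` is cut at `q` into
two opposite ones. The remaining edges form a closed set missing `q`. -/
theorem curve_locally_splits {q : ℝ × ℝ} (hq : q ∈ Q.curve) :
    ∃ ρ > 0, SplitsInTwo (Metric.ball q ρ) Q.curve := by
  obtain ⟨i, hi⟩ := mem_curve.1 hq
  by_cases hcor : ∃ k, q = Q.poly k
  · obtain ⟨k, rfl⟩ := hcor
    obtain ⟨j, rfl⟩ := (finRotate Q.n).surjective k
    refine exists_ball_splitsInTwo (a := Q.poly j)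
      (b := Q.poly (finRotate Q.n (finRotate Q.n j)))
      (Z := ⋃ i ∈ ({j, finRotate Q.n j} : Set (Fin Q.n))ᶜ, Q.poly.edgeSet ℝ i) ?_
      (isClosed_biUnion_edgeSet _) ?_ (poly_ne_poly_finRotate j)
      (poly_ne_poly_finRotate (finRotate Q.n j)).symm (corner_directions j)
    · rw [curve_eq_union {j, finRotate Q.n j}, biUnion_insert, biUnion_singleton,
        edgeSet_eq_segment, edgeSet_eq_segment, segment_symm ℝ (Q.poly j)]
    · simp only [mem_iUnion, not_exists]
      intro i hi hm
      apply hi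
      rcases eq_or_eq_of_poly_mem hm with h | h
      · exact Or.inr h
      · exact Or.inl ((finRotate Q.n).injective h)
  · push Not at hcor
    have ha := (hcor i).symm
    have hb := (hcor (finRotate Q.n i)).symm
    have hab := poly_ne_poly_finRotate i
    set a := Q.poly i with hadef
    set b := Q.poly (finRotate Q.n i) with hbdef
    have hmem : q ∈ segment ℝ a b := by rw [hadef, hbdef, ← edgeSet_eq_segment]; exact hi
    refine exists_ball_splitsInTwo (a := a) (b := b)
      (Z := ⋃ j ∈ ({i} : Set (Fin Q.n))ᶜ, Q.poly.edgeSet ℝ j) ?_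
      (isClosed_biUnion_edgeSet _) ?_ ha hb ?_
    · rw [curve_eq_union {i}, biUnion_singleton, edgeSet_eq_segment, ← hadef, ← hbdef,
        segment_symm ℝ q a]
      congr 1
      exact segment_eq_union_of_mem hmem
    · simp only [mem_iUnion, not_exists]
      intro j hj hm
      rcases eq_end_of_mem_of_mem (fun h => hj h.symm) hi hm with h | h
      · exact ha h.symm
      · exact hb h.symm
    · rintro ⟨t, ht, h⟩
      rw [segment_eq_image'] at hmem
      obtain ⟨s, ⟨hs0, hs1⟩, rfl⟩ := hmem
      have hs0' : s ≠ 0 := by rintro rfl; simp at ha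
      have e : b - (a + s • (b - a)) = (1 - s) • (b - a) := by module
      have e' : t • (a - (a + s • (b - a))) = (-(t * s)) • (b - a) := by module
      rw [e, e'] at h
      have h' := smul_left_injective ℝ (sub_ne_zero.2 hab.symm) h
      have : 0 < s := lt_of_le_of_ne hs0 hs0'.symm
      nlinarith [mul_pos ht this]

/-- The curve is connected, so it suffices that the curve points in the closure of the component
form a nonempty set, open and closed in the curve. -/
theorem subset_closure_component {p : ℝ × ℝ} (hp : p ∉ Q.curve) :
    Q.curve ⊆ closure (connectedComponentIn Q.curveᶜ p) := by
  set C := connectedComponentIn Q.curveᶜ p with hC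
  have hpC : p ∈ C := mem_connectedComponentIn hp
  have hCK : C ⊆ Q.curveᶜ := connectedComponentIn_subset _ _
  have hCo : IsOpen C := (Q.isClosed_curve.isOpen_compl).connectedComponentIn
  -- Otherwise `C` would be open and closed in the plane, hence everything.
  have hmeet : ∃ q ∈ Q.curve, q ∈ closure C := by
    by_contra! hc
    have h1 : closure C ⊆ Q.curveᶜ := fun x hx hxK => hc x hxK hx
    have h2 : closure C ⊆ C :=
      (isPreconnected_connectedComponentIn.closure).subset_connectedComponentIn
        (subset_closure hpC) h1
    have h3 : IsClosed C := isClosed_of_closure_subset h2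
    have h4 : C = univ := IsClopen.eq_univ ⟨h3, hCo⟩ ⟨p, hpC⟩
    let i₀ : Fin Q.n := ⟨0, by have := Q.three_le; omega⟩
    exact hCK (h4 ▸ mem_univ (Q.poly i₀)) (edgeSet_subset_curve i₀ (poly_mem_edgeSet i₀))
  obtain ⟨q₀, hq₀, hq₀C⟩ := hmeet
  intro q hq
  have := Q.isPreconnected_curve.eq_of_eventually_eq (F := fun q => q ∈ closure C) ?_ hq₀ hq
  · exact this ▸ hq₀C
  intro x hx
  by_cases hxC : x ∈ closure C
  -- `C` meets a local piece, so it contains that piece, which accumulates at every curve point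
  -- nearby.
  · obtain ⟨ρ, hρ, A, B, hA, hB, h1, h2⟩ := curve_locally_splits hx
    obtain ⟨z, hz1, hz2⟩ := mem_closure_iff.1 hxC _ Metric.isOpen_ball (Metric.mem_ball_self hρ)
    have hz : z ∈ A ∪ B := h1 ▸ ⟨hz1, hCK hz2⟩
    have hsub : ∀ D : Set (ℝ × ℝ), D ⊆ A ∪ B → IsPreconnected D → z ∈ D → D ⊆ C := by
      intro D hD hDc hzD
      rw [hC, connectedComponentIn_eq hz2]
      exact hDc.subset_connectedComponentIn hzD fun y hy => (h1 ▸ hD hy : y ∈ _ \ Q.curve).2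
    filter_upwards [self_mem_nhdsWithin,
      mem_nhdsWithin_of_mem_nhds (Metric.ball_mem_nhds x hρ)] with y hy1 hy2
    have hy := h2 ⟨hy2, hy1⟩
    refine propext ⟨fun _ => hxC, fun _ => ?_⟩
    rcases hz with hz | hz
    · exact closure_mono (hsub A subset_union_left hA hz) hy.1
    · exact closure_mono (hsub B subset_union_right hB hz) hy.2
  · filter_upwards [mem_nhdsWithin_of_mem_nhds (isClosed_closure.isOpen_compl.mem_nhds hxC)]
      with y hy
    exact propext ⟨fun h => absurd h hy, fun h => absurd h hxC⟩

/-! ### Vertical lines through no corner -/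

/-- The vertical line at `ξ` contains no corner. -/
def IsGeneric (Q : SimplePolygon) (ξ : ℝ) : Prop := ∀ i, (Q.poly i).1 ≠ ξ

theorem fst_mem_uIcc_of_mem_edgeSet {i : Fin Q.n} {p : ℝ × ℝ} (hp : p ∈ Q.poly.edgeSet ℝ i) :
    p.1 ∈ uIcc (Q.poly i).1 (Q.poly (finRotate Q.n i)).1 := by
  rw [edgeSet_eq_segment] at hp
  rw [← segment_eq_uIcc]
  exact (Prod.segment_subset _ _ hp).1

theorem IsGeneric.mem_edgeIco {ξ : ℝ} (h : Q.IsGeneric ξ) {i : Fin Q.n}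
    (hξ : ξ ∈ uIcc (Q.poly i).1 (Q.poly (finRotate Q.n i)).1) : ξ ∈ Q.edgeIco i := by
  rw [SimplePolygon.mem_edgeIco]
  rcases mem_uIcc.1 hξ with ⟨h1, h2⟩ | ⟨h1, h2⟩
  · exact fun h' => h (finRotate Q.n i) (le_antisymm (h'.1 h1) h2)
  · exact fun h' => h i (le_antisymm (h'.2 h1) h2)

theorem IsGeneric.mem_curve_iff {ξ : ℝ} (h : Q.IsGeneric ξ) {y : ℝ} :
    (ξ, y) ∈ Q.curve ↔ ∃ e, ξ ∈ Q.edgeIco e ∧ y = Q.edgeY e ξ := by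
  rw [mem_curve]
  constructor
  · rintro ⟨i, hi⟩
    have := h.mem_edgeIco (fst_mem_uIcc_of_mem_edgeSet hi)
    exact ⟨i, this, snd_eq_edgeY (not_vertical_of_mem this) hi⟩
  · rintro ⟨e, he, rfl⟩
    exact ⟨e, mk_edgeY_mem_edgeSet (not_vertical_of_mem he)
      (Segment.mem_uIcc_of_mem_edgeIco he)⟩

theorem IsGeneric.edgeY_injOn {ξ : ℝ} (h : Q.IsGeneric ξ) {e f : Fin Q.n}
    (he : ξ ∈ Q.edgeIco e) (hf : ξ ∈ Q.edgeIco f) (hef : Q.edgeY e ξ = Q.edgeY f ξ) : e = f := by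
  by_contra hne
  refine disjoint_left.1 (Q.planar e f hne) (mk_edgeY_mem_openSegment he (h _) (h _)) ?_
  rw [hef]
  exact mk_edgeY_mem_edgeSet (not_vertical_of_mem hf) (Segment.mem_uIcc_of_mem_edgeIco hf)

/-- If all edges were vertical, both edges at a highest corner would go straight down, contradicting
`corner_directions`. -/
theorem exists_not_vertical (Q : SimplePolygon) : ∃ e, ¬ Q.EdgeVertical e := by
  by_contra! hc
  have hn := Q.three_le
  have : Nonempty (Fin Q.n) := ⟨⟨0, by omega⟩⟩
  obtain ⟨k, hk⟩ := Finite.exists_max fun i => (Q.poly i).2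
  obtain ⟨j, rfl⟩ := (finRotate Q.n).surjective k
  set q := Q.poly (finRotate Q.n j)
  set a := Q.poly j
  set b := Q.poly (finRotate Q.n (finRotate Q.n j))
  have ha1 : a.1 = q.1 := hc j
  have hb1 : q.1 = b.1 := hc (finRotate Q.n j)
  have ha2 : a.2 < q.2 := lt_of_le_of_ne (hk j) fun h => poly_ne_poly_finRotate j (Prod.ext ha1 h)
  have hb2 : b.2 < q.2 := lt_of_le_of_ne (hk _) fun h =>
    poly_ne_poly_finRotate (finRotate Q.n j) (Prod.ext hb1 h.symm)
  refine corner_directions j ⟨(b.2 - q.2) / (a.2 - q.2),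
    div_pos_of_neg_of_neg (by linarith) (by linarith), Prod.ext ?_ ?_⟩
  · change b.1 - q.1 = _ * (a.1 - q.1)
    rw [ha1, hb1]; simp
  · change b.2 - q.2 = _ * (a.2 - q.2)
    have : a.2 - q.2 ≠ 0 := by linarith
    field_simp

theorem finite_corner_abscissas (Q : SimplePolygon) : (range fun i => (Q.poly i).1).Finite :=
  finite_range _

theorem exists_generic (e : Fin Q.n) (he : ¬ Q.EdgeVertical e) :
    ∃ ξ ∈ Q.edgeIco e, Q.IsGeneric ξ := by
  have hinf : (Q.edgeIco e).Infinite := by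
    rcases lt_or_gt_of_ne he with h | h
    · refine (Ioo_infinite h).mono fun ξ hξ => SimplePolygon.mem_edgeIco.2 fun h' => ?_
      exact absurd (h'.1 hξ.1.le) (not_le.2 hξ.2)
    · refine (Ioo_infinite h).mono fun ξ hξ => SimplePolygon.mem_edgeIco.2 fun h' => ?_
      exact absurd (h'.2 hξ.1.le) (not_le.2 hξ.2)
  obtain ⟨ξ, h1, h2⟩ := hinf.exists_notMem_finite Q.finite_corner_abscissas
  exact ⟨ξ, h1, fun i hi => h2 ⟨i, hi⟩⟩

/-- Across an edge the parity of the number of edges above changes. -/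
theorem IsGeneric.eventually_crossSum {ξ : ℝ} (h : Q.IsGeneric ξ) {e : Fin Q.n}
    (he : ξ ∈ Q.edgeIco e) :
    ∀ᶠ η : ℝ in 𝓝[>] 0, (ξ, Q.edgeY e ξ - η) ∉ Q.curve ∧ (ξ, Q.edgeY e ξ + η) ∉ Q.curve ∧
      Q.crossSum univ (ξ, Q.edgeY e ξ - η) = Q.crossSum univ (ξ, Q.edgeY e ξ + η) + 1 := by
  -- At a generic abscissa the other edges have other heights; a smaller shift `η` passes `e` alone.
  have hev : ∀ᶠ η : ℝ in 𝓝[>] 0, ∀ i, ξ ∈ Q.edgeIco i → i ≠ e →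
      η < |Q.edgeY i ξ - Q.edgeY e ξ| := by
    rw [eventually_all]
    intro i
    by_cases hi : ξ ∈ Q.edgeIco i ∧ i ≠ e
    · have hpos : 0 < |Q.edgeY i ξ - Q.edgeY e ξ| :=
        abs_pos.2 (sub_ne_zero.2 fun h' => hi.2 (h.edgeY_injOn hi.1 he h'))
      filter_upwards [mem_nhdsWithin_of_mem_nhds (eventually_lt_nhds hpos)] with η hη _ _
      exact hη
    · exact Eventually.of_forall fun η h1 h2 => absurd ⟨h1, h2⟩ hi
  filter_upwards [hev, self_mem_nhdsWithin] with η hη (hη0 : 0 < η)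
  refine ⟨?_, ?_, ?_⟩
  · rw [h.mem_curve_iff]
    rintro ⟨i, hi, hy⟩
    by_cases hie : i = e
    · subst hie; linarith
    · have := hη i hi hie
      rw [← hy, sub_sub_cancel_left, abs_neg, abs_of_pos hη0] at this
      exact lt_irrefl _ this
  · rw [h.mem_curve_iff]
    rintro ⟨i, hi, hy⟩
    by_cases hie : i = e
    · subst hie; linarith
    · have := hη i hi hie
      rw [← hy, add_sub_cancel_left, abs_of_pos hη0] at this
      exact lt_irrefl _ this
  · rw [crossSum_eq_ncard, crossSum_eq_ncard]
    have : {i | i ∈ univ ∧ ξ ∈ Q.edgeIco i ∧ Q.edgeY e ξ - η < Q.edgeY i ξ} =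
        insert e {i | i ∈ univ ∧ ξ ∈ Q.edgeIco i ∧ Q.edgeY e ξ + η < Q.edgeY i ξ} := by
      ext i
      simp only [mem_ofPred_eq, mem_insert_iff, mem_univ, true_and]
      constructor
      · rintro ⟨h1, h2⟩
        by_cases hie : i = e
        · exact Or.inl hie
        · refine Or.inr ⟨h1, ?_⟩
          rcases lt_abs.1 (hη i h1 hie) with h3 | h3 <;> linarith
      · rintro (rfl | ⟨h1, h2⟩)
        · exact ⟨he, by linarith⟩
        · exact ⟨h1, by linarith⟩
    rw [this, ncard_insert_of_notMem (fun h => by have := h.2.2; linarith)]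
    push_cast
    rfl

/-! ### Inside and outside -/

theorem eventually_crossSum_univ {p : ℝ × ℝ} (hp : p ∉ Q.curve) :
    ∀ᶠ q in 𝓝 p, Q.crossSum univ q = Q.crossSum univ p :=
  eventually_crossSum_eq univ p (fun i _ hi => hp (edgeSet_subset_curve i hi))
    fun i _ => by simp only [mem_univ]

theorem crossSum_eq_of_mem_component {p q : ℝ × ℝ}
    (hq : q ∈ connectedComponentIn Q.curveᶜ p) : Q.crossSum univ q = Q.crossSum univ p := by
  have hp : p ∈ Q.curveᶜ := by
    by_contra hc
    rw [connectedComponentIn_eq_empty hc] at hq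
    exact hq
  exact isPreconnected_connectedComponentIn.eq_of_eventually_eq
    (fun x hx => (eventually_crossSum_univ (connectedComponentIn_subset _ _ hx)).filter_mono
      nhdsWithin_le_nhds) hq (mem_connectedComponentIn hp)

/-- Points off the curve with the same parity lie in the same component. -/
theorem component_eq_of_crossSum_eq {p p' : ℝ × ℝ} (hp : p ∉ Q.curve) (hp' : p' ∉ Q.curve)
    (h : Q.crossSum univ p = Q.crossSum univ p') :
    connectedComponentIn Q.curveᶜ p = connectedComponentIn Q.curveᶜ p' := by
  obtain ⟨e, he⟩ := Q.exists_not_vertical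
  obtain ⟨ξ, hξe, hξ⟩ := exists_generic e he
  set q : ℝ × ℝ := (ξ, Q.edgeY e ξ) with hqdef
  have hq : q ∈ Q.curve := hξ.mem_curve_iff.2 ⟨e, hξe, rfl⟩
  obtain ⟨ρ, hρ, A, B, hA, hB, h1, h2⟩ := curve_locally_splits hq
  have hqU : q ∈ Metric.ball q ρ := Metric.mem_ball_self hρ
  -- Every component has `q` in its closure, so it contains one of the two pieces at `q`.
  have key : ∀ {r : ℝ × ℝ}, r ∉ Q.curve → A ⊆ connectedComponentIn Q.curveᶜ r ∨
      B ⊆ connectedComponentIn Q.curveᶜ r := by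
    intro r hr
    obtain ⟨z, hz1, hz2⟩ := mem_closure_iff.1 (subset_closure_component hr hq) _
      Metric.isOpen_ball hqU
    have hz : z ∈ A ∪ B := h1 ▸ ⟨hz1, connectedComponentIn_subset _ _ hz2⟩
    have hsub : ∀ D : Set (ℝ × ℝ), D ⊆ A ∪ B → IsPreconnected D → z ∈ D →
        D ⊆ connectedComponentIn Q.curveᶜ r := by
      intro D hD hDc hzD
      rw [connectedComponentIn_eq hz2]
      exact hDc.subset_connectedComponentIn hzD fun y hy => (h1 ▸ hD hy : y ∈ _ \ Q.curve).2
    rcases hz with hz | hz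
    · exact Or.inl (hsub A subset_union_left hA hz)
    · exact Or.inr (hsub B subset_union_right hB hz)
  have hcl := h2 ⟨hqU, hq⟩
  have hAne : A.Nonempty := closure_nonempty_iff.1 ⟨q, hcl.1⟩
  have hBne : B.Nonempty := closure_nonempty_iff.1 ⟨q, hcl.2⟩
  have hsame : ∀ D : Set (ℝ × ℝ), D.Nonempty → D ⊆ connectedComponentIn Q.curveᶜ p →
      D ⊆ connectedComponentIn Q.curveᶜ p' →
      connectedComponentIn Q.curveᶜ p = connectedComponentIn Q.curveᶜ p' := by
    rintro D ⟨z, hz⟩ hD hD'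
    rw [connectedComponentIn_eq (hD hz), connectedComponentIn_eq (hD' hz)]
  have hflip : ¬ ∀ z ∈ A ∪ B, Q.crossSum univ z = Q.crossSum univ p := by
    intro hall
    have e1 := eventually_add_smul_mem Metric.isOpen_ball hqU (0, 1)
    have e2 := eventually_add_smul_mem Metric.isOpen_ball hqU (0, -1)
    obtain ⟨η, ⟨m1, m2, m3⟩, m4, m5⟩ := ((hξ.eventually_crossSum hξe).and (e1.and e2)).exists
    have z1 : q + η • (0, 1) = (ξ, Q.edgeY e ξ + η) := by ext <;> simp [hqdef]
    have z2 : q + η • (0, -1) = (ξ, Q.edgeY e ξ - η) := by ext <;> simp [hqdef]; ring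
    rw [z1] at m4
    rw [z2] at m5
    have h5 : (ξ, Q.edgeY e ξ - η) ∈ Metric.ball q ρ \ Q.curve := ⟨m5, m1⟩
    have h4 : (ξ, Q.edgeY e ξ + η) ∈ Metric.ball q ρ \ Q.curve := ⟨m4, m2⟩
    rw [h1] at h4 h5
    rw [hall _ h5, hall _ h4] at m3
    exact one_ne_zero (left_eq_add.1 m3)
  -- Sharing a piece makes the components equal. If they held different pieces, equal parities would
  -- make the parity constant on `A ∪ B`, contradicting `hflip`.
  rcases key hp with a | a <;> rcases key hp' with b | b
  · exact hsame A hAne a b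
  · refine absurd (fun z hz => ?_) hflip
    rcases hz with hz | hz
    · exact crossSum_eq_of_mem_component (a hz)
    · rw [crossSum_eq_of_mem_component (b hz), h]
  · refine absurd (fun z hz => ?_) hflip
    rcases hz with hz | hz
    · rw [crossSum_eq_of_mem_component (b hz), h]
    · exact crossSum_eq_of_mem_component (a hz)
  · exact hsame B hBne a b

theorem zmod_two_eq_one_iff {a : ZMod 2} : a = 1 ↔ a ≠ 0 := by
  revert a; decide

/-- With half-open intervals a closed curve meets every vertical line in an even number of edges,
even at corners. -/
theorem sum_ind_eq_zero (Q : SimplePolygon) (ξ : ℝ) :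
    ∑ i, (Q.ind i ξ + Q.ind (finRotate Q.n i) ξ) = 0 := by
  rw [Finset.sum_add_distrib, Equiv.sum_comp (finRotate Q.n) fun i => Q.ind i ξ,
    CharTwo.add_self_eq_zero]

/-- A point with an odd number of edges above it has an edge above and an edge below. -/
theorem exists_edges_of_crossSum_ne_zero {p : ℝ × ℝ} (h : Q.crossSum univ p ≠ 0) :
    (∃ e, p.1 ∈ Q.edgeIco e ∧ p.2 < Q.edgeY e p.1) ∧
      ∃ e, p.1 ∈ Q.edgeIco e ∧ Q.edgeY e p.1 ≤ p.2 := by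
  classical
  constructor
  · by_contra! hc
    refine h (Finset.sum_eq_zero fun i _ => if_neg ?_)
    rintro ⟨-, h1, h2⟩
    exact absurd h2 (not_lt.2 (hc i h1))
  · by_contra! hc
    apply h
    rw [← Q.sum_ind_eq_zero p.1]
    refine Finset.sum_congr rfl fun i _ => ?_
    rw [ind_add_ind]
    by_cases hi : p.1 ∈ Q.edgeIco i
    · simp [hi, hc i hi]
    · simp [hi]

/-- A point of odd parity lies vertically between two points of the curve, so it obeys the same
bound in the sup norm. -/
theorem exists_bound (Q : SimplePolygon) : ∃ r, Q.curve ⊆ Metric.closedBall 0 r ∧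
    {p | Q.crossSum univ p ≠ 0} ⊆ Metric.closedBall 0 r := by
  obtain ⟨r, hr⟩ := Q.isCompact_curve.isBounded.subset_closedBall 0
  refine ⟨r, hr, fun p hp => ?_⟩
  obtain ⟨⟨e, he, h1⟩, f, hf, h2⟩ := exists_edges_of_crossSum_ne_zero hp
  have key : ∀ e, p.1 ∈ Q.edgeIco e → |p.1| ≤ r ∧ |Q.edgeY e p.1| ≤ r := by
    intro e he
    have := hr (edgeSet_subset_curve e (mk_edgeY_mem_edgeSet (not_vertical_of_mem he)
      (Segment.mem_uIcc_of_mem_edgeIco he)))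
    rw [mem_closedBall_zero_iff, Prod.norm_def] at this
    exact ⟨(le_max_left _ _).trans this, (le_max_right _ _).trans this⟩
  have a := key e he
  have b := key f hf
  rw [mem_closedBall_zero_iff, Prod.norm_def]
  refine max_le a.1 ?_
  have a2 := abs_le.1 a.2
  have b2 := abs_le.1 b.2
  rw [Real.norm_eq_abs, abs_le]
  exact ⟨by linarith [b2.1], by linarith [a2.2]⟩

/-- Jordan curve theorem for polygons: the enclosed points are those off the curve with an odd
number of edges above. -/
theorem mem_inside_iff {p : ℝ × ℝ} :
    p ∈ Q.inside ↔ p ∉ Q.curve ∧ Q.crossSum univ p = 1 := by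
  rw [inside, mem_ofPred_eq, and_congr_right_iff]
  intro hp
  obtain ⟨r, hr1, hr2⟩ := Q.exists_bound
  rw [zmod_two_eq_one_iff]
  constructor
  · intro hb hc
    obtain ⟨r', hr'⟩ := (hb.union Metric.isBounded_closedBall).subset_closedBall (0 : ℝ × ℝ)
      (s := _ ∪ Metric.closedBall 0 r)
    -- A far away point is even, so it shares the component of the even point `p`, which is then
    -- unbounded.
    set z : ℝ × ℝ := (|r'| + 1, 0) with hz
    have hzn : z ∉ Metric.closedBall (0 : ℝ × ℝ) r' := by
      rw [mem_closedBall_zero_iff, Prod.norm_def, not_le]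
      refine lt_max_of_lt_left ?_
      rw [Real.norm_eq_abs, abs_of_pos (by positivity)]
      linarith [le_abs_self r']
    have hz1 : z ∉ Q.curve := fun h => hzn (hr' (Or.inr (hr1 h)))
    have hz2 : Q.crossSum univ z = 0 := by
      by_contra h
      exact hzn (hr' (Or.inr (hr2 h)))
    refine hzn (hr' (Or.inl ?_))
    rw [component_eq_of_crossSum_eq hp hz1 (hc.trans hz2.symm)]
    exact mem_connectedComponentIn hz1
  · intro h
    refine (Metric.isBounded_closedBall (x := (0 : ℝ × ℝ)) (r := r)).subset fun q hq => hr2 ?_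
    change Q.crossSum univ q ≠ 0
    rwa [crossSum_eq_of_mem_component hq]

theorem isOpen_setOf_crossSum (c : ZMod 2) : IsOpen {p | p ∉ Q.curve ∧ Q.crossSum univ p = c} := by
  rw [isOpen_iff_mem_nhds]
  rintro p ⟨h1, h2⟩
  filter_upwards [Q.isClosed_curve.isOpen_compl.mem_nhds h1, eventually_crossSum_univ h1]
    with q h3 h4
  exact ⟨h3, h4.trans h2⟩

theorem inside_eq (Q : SimplePolygon) :
    Q.inside = {p | p ∉ Q.curve ∧ Q.crossSum univ p = 1} :=
  Set.ext fun _ => mem_inside_iff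

theorem isOpen_inside (Q : SimplePolygon) : IsOpen Q.inside := by
  rw [inside_eq]
  exact isOpen_setOf_crossSum 1

theorem isBounded_inside (Q : SimplePolygon) : Bornology.IsBounded Q.inside := by
  obtain ⟨r, -, hr⟩ := Q.exists_bound
  refine Metric.isBounded_closedBall.subset fun p hp => hr ?_
  exact zmod_two_eq_one_iff.1 (mem_inside_iff.1 hp).2

theorem exists_point_with_crossSum (Q : SimplePolygon) (c : ZMod 2) :
    ∃ p, p ∉ Q.curve ∧ Q.crossSum univ p = c := by
  obtain ⟨e, he⟩ := Q.exists_not_vertical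
  obtain ⟨ξ, hξe, hξ⟩ := exists_generic e he
  obtain ⟨η, h1, h2, h3⟩ := (hξ.eventually_crossSum hξe).exists
  by_cases h : Q.crossSum univ (ξ, Q.edgeY e ξ - η) = c
  · exact ⟨_, h1, h⟩
  · refine ⟨_, h2, ?_⟩
    rw [h3] at h
    generalize Q.crossSum univ (ξ, Q.edgeY e ξ + η) = x at h
    revert x c
    decide

/-- Points of either parity accumulate at every point of the curve. -/
theorem curve_subset_closure (Q : SimplePolygon) (c : ZMod 2) :
    Q.curve ⊆ closure {p | p ∉ Q.curve ∧ Q.crossSum univ p = c} := by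
  obtain ⟨p, h1, h2⟩ := Q.exists_point_with_crossSum c
  refine (subset_closure_component h1).trans (closure_mono fun q hq => ?_)
  exact ⟨connectedComponentIn_subset _ _ hq, (crossSum_eq_of_mem_component hq).trans h2⟩

theorem inside_nonempty (Q : SimplePolygon) : Q.inside.Nonempty := by
  obtain ⟨p, hp⟩ := Q.exists_point_with_crossSum 1
  exact ⟨p, mem_inside_iff.2 hp⟩

theorem closure_inside_subset (Q : SimplePolygon) : closure Q.inside ⊆ Q.inside ∪ Q.curve := by
  intro p hp
  by_contra hc
  rw [mem_union, not_or] at hc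
  have h0 : Q.crossSum univ p = 0 := by
    by_contra h
    exact hc.1 (mem_inside_iff.2 ⟨hc.2, zmod_two_eq_one_iff.2 h⟩)
  obtain ⟨q, hq1, hq2⟩ := mem_closure_iff.1 hp _ (isOpen_setOf_crossSum 0) ⟨hc.2, h0⟩
  have := (mem_inside_iff.1 hq2).2
  rw [hq1.2] at this
  exact zero_ne_one this

/-- The region determines its curve, so polygons distinct as curves have distinct interiors and
inclusions between them are strict. -/
theorem curve_eq_closure_sdiff (Q : SimplePolygon) : Q.curve = closure Q.inside \ Q.inside := by
  apply Subset.antisymm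
  · intro p hp
    refine ⟨?_, fun h => (mem_inside_iff.1 h).1 hp⟩
    rw [inside_eq]
    exact Q.curve_subset_closure 1 hp
  · rintro p ⟨h1, h2⟩
    exact (Q.closure_inside_subset h1).resolve_left h2

theorem curve_eq_of_inside_eq {Q' : SimplePolygon} (h : Q.inside = Q'.inside) :
    Q.curve = Q'.curve := by
  rw [curve_eq_closure_sdiff, curve_eq_closure_sdiff, h]

/-- The difference could be null a priori; it is not, because it contains the nonempty open set
`Q'.inside \ closure Q.inside`. -/
theorem area_lt_of_inside_ssubset {Q' : SimplePolygon} (h : Q.inside ⊂ Q'.inside) :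
    Q.area < Q'.area := by
  have hne : (Q'.inside \ closure Q.inside).Nonempty := by
    obtain ⟨p, hp, hp'⟩ := exists_of_ssubset h
    by_cases hpc : p ∈ closure Q.inside
    · have hK : p ∈ Q.curve := (Q.closure_inside_subset hpc).resolve_left hp'
      -- If the extra point is on the curve of `Q`, points outside `Q` accumulate at it and some lie
      -- in the open set `Q'.inside`.
      obtain ⟨q, hq1, hq2⟩ := mem_closure_iff.1 (Q.curve_subset_closure 0 hK) _ Q'.isOpen_inside hp
      refine ⟨q, hq1, fun hqc => ?_⟩
      rcases Q.closure_inside_subset hqc with h3 | h3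
      · have := (mem_inside_iff.1 h3).2
        rw [hq2.2] at this
        exact zero_ne_one this
      · exact hq2.1 h3
    · exact ⟨p, hp, hpc⟩
  have hpos : 0 < volume (Q'.inside \ closure Q.inside) :=
    (Q'.isOpen_inside.sdiff isClosed_closure).measure_pos _ hne
  have hfin : volume Q.inside ≠ ⊤ := Q.isBounded_inside.measure_lt_top.ne
  have hle : volume Q.inside + volume (Q'.inside \ closure Q.inside) ≤ volume Q'.inside := by
    rw [← measure_union (disjoint_left.2 fun x hx hx' => hx'.2 (subset_closure hx))
      (Q'.isOpen_inside.sdiff isClosed_closure).measurableSet]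
    exact measure_mono (union_subset h.1 sdiff_subset)
  exact (ENNReal.lt_add_right hfin hpos.ne').trans_le hle

end SimplePolygon

/-! ### Crossings of a laminar family with a vertical line -/

/-- The crossings of a laminar family of regions with the vertical line at `x`: each crossing `s`
belongs to the region `pol s`, lies at height `y s`, and has parity one if the region is just below
and parity zero if it is just above. -/
structure LineCrossings (σ ι : Type*) where
  M : Set σ
  finite : M.Finite
  pol : σ → ι
  y : σ → ℝ
  par : σ → ℕ
  area : ι → ENNReal
  ins : ι → Set (ℝ × ℝ)
  x : ℝ
  inj : ∀ s ∈ M, ∀ t ∈ M, pol s = pol t → y s = y t → s = t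
  mem_ins_iff : ∀ i z, (∀ s ∈ M, pol s = i → y s ≠ z) →
    ((x, z) ∈ ins i ↔ Odd {s | s ∈ M ∧ pol s = i ∧ z < y s}.ncard)
  par_iff : ∀ s ∈ M, (par s = 1 ↔ Odd {t | t ∈ M ∧ pol t = pol s ∧ y s ≤ y t}.ncard)
  par_eq : ∀ s, par s = 0 ∨ par s = 1
  laminar : ∀ i j, i ≠ j → (ins i ∩ ins j).Nonempty → ins i ⊂ ins j ∨ ins j ⊂ ins i
  area_lt : ∀ i j, ins i ⊂ ins j → area i < area j

namespace LineCrossings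

variable {σ ι : Type*} (C : LineCrossings σ ι)

/-- The sweep order on crossings. -/
def Lt (s t : σ) : Prop :=
  C.y t < C.y s ∨ (C.y s = C.y t ∧
    ((C.par s = 0 ∧ C.par t = 1) ∨
      (C.par s = 1 ∧ C.par t = 1 ∧ C.area (C.pol t) < C.area (C.pol s)) ∨
      (C.par s = 0 ∧ C.par t = 0 ∧ C.area (C.pol s) < C.area (C.pol t))))

variable {C}

theorem lt_irrefl (s : σ) : ¬ C.Lt s s := by
  rintro (h | ⟨-, ⟨h1, h2⟩ | ⟨-, -, h⟩ | ⟨-, -, h⟩⟩)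
  · exact _root_.lt_irrefl _ h
  · omega
  · exact _root_.lt_irrefl _ h
  · exact _root_.lt_irrefl _ h

theorem Lt.trans {s t u : σ} (h1 : C.Lt s t) (h2 : C.Lt t u) : C.Lt s u := by
  rcases h1 with h1 | ⟨e1, h1⟩
  · rcases h2 with h2 | ⟨e2, -⟩
    · exact Or.inl (h2.trans h1)
    · exact Or.inl (e2 ▸ h1)
  · rcases h2 with h2 | ⟨e2, h2⟩
    · exact Or.inl (e1 ▸ h2)
    · refine Or.inr ⟨e1.trans e2, ?_⟩
      rcases h1 with ⟨a, b⟩ | ⟨a, b, c⟩ | ⟨a, b, c⟩ <;>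
        rcases h2 with ⟨a', b'⟩ | ⟨a', b', c'⟩ | ⟨a', b', c'⟩
      · omega
      · exact Or.inl ⟨a, b'⟩
      · omega
      · omega
      · exact Or.inr (Or.inl ⟨a, b', c'.trans c⟩)
      · omega
      · exact Or.inl ⟨a, b'⟩
      · omega
      · exact Or.inr (Or.inr ⟨a, b', c.trans c'⟩)

theorem Lt.y_le {s t : σ} (h : C.Lt s t) : C.y t ≤ C.y s := by
  rcases h with h | ⟨h, -⟩
  · exact h.le
  · exact h.ge

/-- A positive number smaller than all distances between crossings of different heights. -/
def IsGap (C : LineCrossings σ ι) (ε : ℝ) : Prop :=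
  0 < ε ∧ ∀ s ∈ C.M, ∀ t ∈ C.M, C.y s < C.y t → C.y s + ε < C.y t

theorem exists_isGap (C : LineCrossings σ ι) : ∃ ε, C.IsGap ε := by
  have h : ∀ᶠ ε : ℝ in 𝓝[>] 0, ∀ s ∈ C.M, ∀ t ∈ C.M, C.y s < C.y t → C.y s + ε < C.y t := by
    rw [eventually_all_finite C.finite]
    intro s _
    rw [eventually_all_finite C.finite]
    intro t _
    by_cases hst : C.y s < C.y t
    · filter_upwards [mem_nhdsWithin_of_mem_nhds (eventually_lt_nhds (sub_pos.2 hst))] with ε hε _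
      linarith
    · exact Eventually.of_forall fun ε h => absurd h hst
  obtain ⟨ε, h1, h2⟩ := (h.and self_mem_nhdsWithin).exists
  exact ⟨ε, h2, h1⟩

variable {ε : ℝ}

theorem IsGap.le_of_sub_lt (hε : C.IsGap ε) {s t : σ} (hs : s ∈ C.M) (ht : t ∈ C.M)
    (h : C.y s - ε < C.y t) : C.y s ≤ C.y t := by
  by_contra! hc
  linarith [hε.2 t ht s hs hc]

theorem IsGap.lt_add_iff (hε : C.IsGap ε) {s t : σ} (hs : s ∈ C.M) (ht : t ∈ C.M) :
    C.y s + ε < C.y t ↔ C.y s < C.y t :=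
  ⟨fun h => by linarith [hε.1], hε.2 s hs t ht⟩

theorem IsGap.ne_sub (hε : C.IsGap ε) {s t : σ} (hs : s ∈ C.M) (ht : t ∈ C.M) :
    C.y t ≠ C.y s - ε := by
  intro h
  have h1 : C.y t < C.y s := by linarith [hε.1]
  linarith [hε.2 t ht s hs h1]

theorem IsGap.ne_add (hε : C.IsGap ε) {s t : σ} (hs : s ∈ C.M) (ht : t ∈ C.M) :
    C.y t ≠ C.y s + ε := by
  intro h
  have h1 : C.y s < C.y t := by linarith [hε.1]
  linarith [hε.2 s hs t ht h1]

/-- Just below `s`, the crossings strictly above the point are those at or above `s`, which is the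
count defining the parity. -/
theorem IsGap.mem_below_iff (hε : C.IsGap ε) {s : σ} (hs : s ∈ C.M) :
    (C.x, C.y s - ε) ∈ C.ins (C.pol s) ↔ C.par s = 1 := by
  rw [C.mem_ins_iff _ _ fun t ht _ => hε.ne_sub hs ht, C.par_iff s hs]
  have : {t | t ∈ C.M ∧ C.pol t = C.pol s ∧ C.y s - ε < C.y t} =
      {t | t ∈ C.M ∧ C.pol t = C.pol s ∧ C.y s ≤ C.y t} := by
    ext t
    constructor
    · rintro ⟨h1, h2, h3⟩
      exact ⟨h1, h2, hε.le_of_sub_lt hs h1 h3⟩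
    · rintro ⟨h1, h2, h3⟩
      exact ⟨h1, h2, by linarith [hε.1]⟩
  rw [this]

theorem ncard_le_eq {s : σ} (hs : s ∈ C.M) :
    {t | t ∈ C.M ∧ C.pol t = C.pol s ∧ C.y s ≤ C.y t}.ncard =
      {t | t ∈ C.M ∧ C.pol t = C.pol s ∧ C.y s < C.y t}.ncard + 1 := by
  rw [← ncard_insert_of_notMem (a := s) (fun h => _root_.lt_irrefl _ h.2.2)
    (C.finite.subset fun t ht => ht.1)]
  congr 1
  ext t
  constructor
  · rintro ⟨h1, h2, h3⟩
    rcases h3.eq_or_lt with h | h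
    · exact Or.inl (C.inj t h1 s hs h2 h.symm)
    · exact Or.inr ⟨h1, h2, h⟩
  · rintro (rfl | ⟨h1, h2, h3⟩)
    · exact ⟨hs, rfl, le_rfl⟩
    · exact ⟨h1, h2, h3.le⟩

theorem par_eq_zero_iff {s : σ} (hs : s ∈ C.M) :
    C.par s = 0 ↔ Odd {t | t ∈ C.M ∧ C.pol t = C.pol s ∧ C.y s < C.y t}.ncard := by
  have h := C.par_iff s hs
  rw [ncard_le_eq hs, Nat.odd_add_one] at h
  rcases C.par_eq s with h' | h'
  · simp only [h', zero_ne_one, false_iff, not_not] at h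
    exact iff_of_true h' h
  · simp only [h', true_iff] at h
    exact iff_of_false (by omega) h

theorem IsGap.mem_above_iff (hε : C.IsGap ε) {s : σ} (hs : s ∈ C.M) :
    (C.x, C.y s + ε) ∈ C.ins (C.pol s) ↔ C.par s = 0 := by
  rw [C.mem_ins_iff _ _ fun t ht _ => hε.ne_add hs ht, par_eq_zero_iff hs]
  have : {t | t ∈ C.M ∧ C.pol t = C.pol s ∧ C.y s + ε < C.y t} =
      {t | t ∈ C.M ∧ C.pol t = C.pol s ∧ C.y s < C.y t} := by
    ext t
    exact and_congr_right fun ht => and_congr_right fun _ => hε.lt_add_iff hs ht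
  rw [this]

/-- Above a point of a region there is a lowest crossing, and it has parity one. -/
theorem exists_above {i : ι} {z : ℝ} (hz : ∀ s ∈ C.M, C.y s ≠ z) (h : (C.x, z) ∈ C.ins i) :
    ∃ u ∈ C.M, C.pol u = i ∧ z < C.y u ∧ C.par u = 1 ∧
      (∀ t ∈ C.M, C.pol t = i → z < C.y t → C.y u ≤ C.y t) ∧
      ∀ w, (∀ s ∈ C.M, C.y s ≠ w) → z ≤ w → w < C.y u → (C.x, w) ∈ C.ins i := by
  rw [C.mem_ins_iff i z fun s hs _ => hz s hs] at h
  have hfin : {s | s ∈ C.M ∧ C.pol s = i ∧ z < C.y s}.Finite := C.finite.subset fun t ht => ht.1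
  obtain ⟨u, ⟨h1, rfl, h3⟩, hmin⟩ := hfin.exists_minimalFor C.y _
    (nonempty_of_ncard_ne_zero h.pos.ne')
  have hmin' : ∀ t ∈ C.M, C.pol t = C.pol u → z < C.y t → C.y u ≤ C.y t := by
    intro t ht htu hzt
    rcases le_total (C.y u) (C.y t) with h' | h'
    · exact h'
    · exact hmin ⟨ht, htu, hzt⟩ h'
  refine ⟨u, h1, rfl, h3, ?_, hmin', ?_⟩
  · rw [C.par_iff u h1]
    convert h using 3
    ext t
    exact and_congr_right fun ht => and_congr_right fun htu =>
      ⟨fun h' => h3.trans_le h', fun h' => hmin' t ht htu h'⟩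
  · intro w hw hzw hwu
    rw [C.mem_ins_iff _ w fun s hs _ => hw s hs]
    convert h using 3
    ext t
    exact and_congr_right fun ht => and_congr_right fun htu =>
      ⟨fun h' => hzw.trans_lt h', fun h' => hwu.trans_le (hmin' t ht htu h')⟩

/-- Between a point of a region and a lower point outside there is a crossing of parity zero. -/
theorem exists_between {i : ι} {z w : ℝ} (hz : ∀ s ∈ C.M, C.y s ≠ z) (hw : ∀ s ∈ C.M, C.y s ≠ w)
    (hzw : z ≤ w) (h1 : (C.x, w) ∈ C.ins i) (h2 : (C.x, z) ∉ C.ins i) :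
    ∃ v ∈ C.M, C.pol v = i ∧ z < C.y v ∧ C.y v < w ∧ C.par v = 0 := by
  rw [C.mem_ins_iff i z fun s hs _ => hz s hs] at h2
  rw [C.mem_ins_iff i w fun s hs _ => hw s hs] at h1
  have hfin : {s | s ∈ C.M ∧ C.pol s = i ∧ z < C.y s ∧ C.y s < w}.Finite :=
    C.finite.subset fun t ht => ht.1
  have hne : {s | s ∈ C.M ∧ C.pol s = i ∧ z < C.y s ∧ C.y s < w}.Nonempty := by
    by_contra hc
    apply h2
    convert h1 using 3
    ext t
    refine and_congr_right fun ht => and_congr_right fun htu => ⟨fun h' => ?_, hzw.trans_lt⟩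
    refine lt_of_le_of_ne ?_ (hw t ht).symm
    by_contra! hc'
    exact hc ⟨t, ht, htu, h', hc'⟩
  -- For the highest crossing `v` below `w`, the crossings above `v` are those above `w`, an odd
  -- number.
  obtain ⟨v, ⟨a1, rfl, a3, a4⟩, hmax⟩ := hfin.exists_maximalFor C.y _ hne
  refine ⟨v, a1, rfl, a3, a4, ?_⟩
  rw [par_eq_zero_iff a1]
  convert h1 using 3
  ext t
  refine and_congr_right fun ht => and_congr_right fun htu => ⟨fun h' => ?_, a4.trans⟩
  refine lt_of_le_of_ne ?_ (hw t ht).symm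
  by_contra! hc'
  exact absurd (hmax ⟨ht, htu, a3.trans h', hc'⟩ h'.le) (not_le.2 h')

/-- Crossings at the same height belong to different regions. If their parities agree, both regions
contain the point just below, or just above; laminarity nests them and the areas differ. -/
theorem lt_trichotomous {s t : σ} (hs : s ∈ C.M) (ht : t ∈ C.M) (hst : s ≠ t) :
    C.Lt s t ∨ C.Lt t s := by
  obtain ⟨ε, hε⟩ := C.exists_isGap
  rcases lt_trichotomy (C.y s) (C.y t) with h | h | h
  · exact Or.inr (Or.inl h)
  swap
  · exact Or.inl (Or.inl h)
  have hpol : C.pol s ≠ C.pol t := fun h' => hst (C.inj s hs t ht h' h)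
  rcases C.par_eq s with ps | ps <;> rcases C.par_eq t with pt | pt
  · have a := (hε.mem_above_iff hs).2 ps
    have b := (hε.mem_above_iff ht).2 pt
    rw [← h] at b
    rcases C.laminar _ _ hpol ⟨_, a, b⟩ with h' | h'
    · exact Or.inl (Or.inr ⟨h, Or.inr (Or.inr ⟨ps, pt, C.area_lt _ _ h'⟩)⟩)
    · exact Or.inr (Or.inr ⟨h.symm, Or.inr (Or.inr ⟨pt, ps, C.area_lt _ _ h'⟩)⟩)
  · exact Or.inl (Or.inr ⟨h, Or.inl ⟨ps, pt⟩⟩)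
  · exact Or.inr (Or.inr ⟨h.symm, Or.inl ⟨pt, ps⟩⟩)
  · have a := (hε.mem_below_iff hs).2 ps
    have b := (hε.mem_below_iff ht).2 pt
    rw [← h] at b
    rcases C.laminar _ _ hpol ⟨_, a, b⟩ with h' | h'
    · exact Or.inr (Or.inr ⟨h.symm, Or.inr (Or.inl ⟨pt, ps, C.area_lt _ _ h'⟩)⟩)
    · exact Or.inl (Or.inr ⟨h, Or.inr (Or.inl ⟨ps, pt, C.area_lt _ _ h'⟩)⟩)

/-- `s` is the first crossing of its region. -/
def FirstOfPol (C : LineCrossings σ ι) (s : σ) : Prop :=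
  s ∈ C.M ∧ ∀ t ∈ C.M, C.pol t = C.pol s → t ≠ s → C.Lt s t

theorem FirstOfPol.y_le {s : σ} (h : C.FirstOfPol s) {t : σ} (ht : t ∈ C.M)
    (hts : C.pol t = C.pol s) : C.y t ≤ C.y s := by
  by_cases h' : t = s
  · rw [h']
  · exact (h.2 t ht hts h').y_le

theorem FirstOfPol.par_eq_one {s : σ} (h : C.FirstOfPol s) : C.par s = 1 := by
  rw [C.par_iff s h.1]
  have : {t | t ∈ C.M ∧ C.pol t = C.pol s ∧ C.y s ≤ C.y t} = {s} := by
    ext t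
    constructor
    · rintro ⟨h1, h2, h3⟩
      exact C.inj t h1 s h.1 h2 (le_antisymm (h.y_le h1 h2) h3)
    · rintro rfl
      exact ⟨h.1, rfl, le_rfl⟩
  rw [this, ncard_singleton]
  exact odd_one

/-- `t` immediately precedes `s`. -/
def Pred (C : LineCrossings σ ι) (t s : σ) : Prop :=
  t ∈ C.M ∧ C.Lt t s ∧ ¬ ∃ u ∈ C.M, C.Lt t u ∧ C.Lt u s

/-- A region that properly contains the region of its first crossing `s` has an earlier crossing of
parity one, and the line stays in the larger region down to `s`. -/
theorem exists_lt_of_ssubset (hε : C.IsGap ε) {s : σ} (hs : C.FirstOfPol s) {R : ι}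
    (hR : C.ins (C.pol s) ⊂ C.ins R) :
    ∃ u ∈ C.M, C.pol u = R ∧ C.Lt u s ∧ C.par u = 1 ∧ C.y s ≤ C.y u ∧
      (∀ t ∈ C.M, C.pol t = R → C.y s - ε < C.y t → C.y u ≤ C.y t) ∧
      ∀ w, (∀ s ∈ C.M, C.y s ≠ w) → C.y s - ε ≤ w → w < C.y u → (C.x, w) ∈ C.ins R := by
  have hz := hR.1 ((hε.mem_below_iff hs.1).2 hs.par_eq_one)
  obtain ⟨u, h1, h2, h3, h4, h5, h6⟩ := exists_above (fun t ht => hε.ne_sub hs.1 ht) hz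
  have h7 := hε.le_of_sub_lt hs.1 h1 h3
  refine ⟨u, h1, h2, ?_, h4, h7, h5, h6⟩
  rcases h7.eq_or_lt with h | h
  · refine Or.inr ⟨h.symm, Or.inr (Or.inl ⟨h4, hs.par_eq_one, ?_⟩)⟩
    rw [h2]
    exact C.area_lt _ _ hR
  · exact Or.inl h

theorem FirstOfPol.not_ssubset_of_first {s : σ} (hs : C.FirstOfPol s)
    (hfirst : ∀ t ∈ C.M, t ≠ s → C.Lt s t) (R : ι) : ¬ C.ins (C.pol s) ⊂ C.ins R := by
  intro hR
  obtain ⟨ε, hε⟩ := C.exists_isGap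
  obtain ⟨u, h1, -, h2, -⟩ := exists_lt_of_ssubset hε hs hR
  by_cases hus : u = s
  · exact lt_irrefl _ (hus ▸ h2)
  · exact lt_irrefl _ ((hfirst u h1 hus).trans h2)

theorem FirstOfPol.pol_ne_of_lt {s t : σ} (hs : C.FirstOfPol s) (ht : t ∈ C.M) (h : C.Lt t s) :
    C.pol s ≠ C.pol t := by
  intro hp
  by_cases hts : t = s
  · exact lt_irrefl _ (hts ▸ h)
  · exact lt_irrefl _ ((hs.2 t ht hp.symm hts).trans h)

/-- The region of `t` reaches from just below `t` to just below `s`, since a lower boundary in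
between would be a crossing between `t` and `s` in the order. So the two regions are nested. -/
theorem FirstOfPol.parent_of_pred_par_one {s t : σ} (hs : C.FirstOfPol s) (ht : C.Pred t s)
    (hpar : C.par t = 1) :
    C.ins (C.pol s) ⊂ C.ins (C.pol t) ∧
      ¬ ∃ k, C.ins (C.pol s) ⊂ C.ins k ∧ C.ins k ⊂ C.ins (C.pol t) := by
  obtain ⟨ε, hε⟩ := C.exists_isGap
  obtain ⟨htM, hts, hno⟩ := ht
  have hpol := hs.pol_ne_of_lt htM hts
  have hyst := hts.y_le
  have hbt := (hε.mem_below_iff htM).2 hpar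
  have hbs := (hε.mem_below_iff hs.1).2 hs.par_eq_one
  have hz : (C.x, C.y s - ε) ∈ C.ins (C.pol t) := by
    by_contra hc
    obtain ⟨v, h1, h2, h3, h4, h5⟩ := exists_between (fun u hu => hε.ne_sub hs.1 hu)
      (fun u hu => hε.ne_sub htM hu) (by linarith) hbt hc
    have h6 := hε.le_of_sub_lt hs.1 h1 h3
    refine hno ⟨v, h1, Or.inl (by linarith [hε.1]), ?_⟩
    rcases h6.eq_or_lt with h | h
    · exact Or.inr ⟨h.symm, Or.inl ⟨h5, hs.par_eq_one⟩⟩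
    · exact Or.inl h
  refine ⟨?_, ?_⟩
  · rcases C.laminar _ _ hpol ⟨_, hbs, hz⟩ with h | h
    · exact h
    -- In the reverse nesting the region of `s` has a crossing at or above `t`; so `s` and `t` have
    -- equal height and the larger area puts `s` first.
    exfalso
    obtain ⟨u, h1, h2, h3, -⟩ := exists_above (fun u hu => hε.ne_sub htM hu) (h.1 hbt)
    have h4 := hε.le_of_sub_lt htM h1 h3
    have h5 := hs.y_le h1 h2
    have h6 : C.y s = C.y t := by linarith
    exact lt_irrefl s (Lt.trans (Or.inr ⟨h6, Or.inr (Or.inl ⟨hs.par_eq_one, hpar,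
      C.area_lt _ _ h⟩)⟩) hts)
  · rintro ⟨k, hk1, hk2⟩
    obtain ⟨u, h1, h2, h3, h4, h5, h6, h7⟩ := exists_lt_of_ssubset hε hs hk1
    refine hno ⟨u, h1, ?_, h3⟩
    -- A crossing `u` of an intermediate region above `t` would put the point just above `t` in the
    -- region of `t`, against parity 1; otherwise `u` separates `t` from `s`.
    rcases lt_trichotomy (C.y t) (C.y u) with h | h | h
    · exfalso
      have h8 := h7 (C.y t + ε) (fun r hr => hε.ne_add htM hr) (by linarith [hε.1])
        (hε.2 t htM u h1 h)
      have h9 := (hε.mem_above_iff htM).1 (hk2.1 h8)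
      omega
    · exact Or.inr ⟨h, Or.inr (Or.inl ⟨hpar, h4, h2 ▸ C.area_lt _ _ hk2⟩)⟩
    · exact Or.inl h

/-- The line enters no region and leaves none strictly between `t` and `s` in the order, so a region
`R` containing one of the two surrounds the other as well. -/
theorem FirstOfPol.ssubset_iff_of_pred_par_zero {s t : σ} (hs : C.FirstOfPol s) (ht : C.Pred t s)
    (hpar : C.par t = 0) (R : ι) :
    C.ins (C.pol s) ⊂ C.ins R ↔ C.ins (C.pol t) ⊂ C.ins R := by
  obtain ⟨ε, hε⟩ := C.exists_isGap
  obtain ⟨htM, hts, hno⟩ := ht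
  have hyst := hts.y_le
  have hat := (hε.mem_above_iff htM).2 hpar
  have hbs := (hε.mem_below_iff hs.1).2 hs.par_eq_one
  have hpos := hε.1
  constructor
  · intro hR
    obtain ⟨u, h1, h2, h3, h4, h5, h6, h7⟩ := exists_lt_of_ssubset hε hs hR
    have htu : C.y t < C.y u := by
      by_contra! hc
      refine hno ⟨u, h1, ?_, h3⟩
      rcases hc.eq_or_lt with h | h
      · exact Or.inr ⟨h.symm, Or.inl ⟨hpar, h4⟩⟩
      · exact Or.inl h
    have h8 := h7 (C.y t + ε) (fun r hr => hε.ne_add htM hr) (by linarith)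
      (hε.2 t htM u h1 htu)
    have hne : R ≠ C.pol t := by
      intro h
      linarith [h6 t htM h.symm (by linarith)]
    -- `R` also contains the point just below `t`, which the region of `t` does not; this excludes
    -- `R` being the smaller one.
    rcases C.laminar _ _ hne ⟨_, h8, hat⟩ with h | h
    · have h9 := h7 (C.y t - ε) (fun r hr => hε.ne_sub htM hr) (by linarith) (by linarith)
      have := (hε.mem_below_iff htM).1 (h.1 h9)
      omega
    · exact h
  · intro hR
    have hw := hR.1 hat
    have hz : (C.x, C.y s - ε) ∈ C.ins R := by
      by_contra hc
      obtain ⟨v, h1, h2, h3, h4, h5⟩ := exists_between (fun u hu => hε.ne_sub hs.1 hu)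
        (fun u hu => hε.ne_add htM hu) (by linarith) hw hc
      have h6 := hε.le_of_sub_lt hs.1 h1 h3
      have h7 : C.y v ≤ C.y t := by
        by_contra! h
        linarith [hε.2 t htM v h1 h]
      refine hno ⟨v, h1, ?_, ?_⟩
      · rcases h7.eq_or_lt with h | h
        · exact Or.inr ⟨h.symm, Or.inr (Or.inr ⟨hpar, h5, h2 ▸ C.area_lt _ _ hR⟩)⟩
        · exact Or.inl h
      · rcases h6.eq_or_lt with h | h
        · exact Or.inr ⟨h.symm, Or.inl ⟨h5, hs.par_eq_one⟩⟩
        · exact Or.inl h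
    -- This point of `R` is higher than every crossing of the region of `s`.
    have hnot : (C.x, C.y t + ε) ∉ C.ins (C.pol s) := by
      intro h
      obtain ⟨u, h1, h2, h3, -⟩ := exists_above (fun u hu => hε.ne_add htM hu) h
      linarith [hs.y_le h1 h2]
    have hne : C.pol s ≠ R := fun h => hnot (h ▸ hw)
    rcases C.laminar _ _ hne ⟨_, hbs, hz⟩ with h | h
    · exact h
    · exact absurd (h.1 hw) hnot

end LineCrossings

/-! ### The sweep line as a system of crossings -/

variable {ι : Type*}

/-- `ξ'` lies so closely to the right of `ξ` that no corner is passed and no two edges cross. -/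
def IsJustRight (P : ι → SimplePolygon) (ξ ξ' : ℝ) : Prop :=
  (∀ i k, ((P i).poly k).1 ≠ ξ' ∧ (((P i).poly k).1 ≤ ξ ↔ ((P i).poly k).1 ≤ ξ')) ∧
  ∀ i e j f, ((P i).edgeY e ξ < (P j).edgeY f ξ → (P i).edgeY e ξ' < (P j).edgeY f ξ') ∧
    ((P i).edgeY e ξ = (P j).edgeY f ξ → (P i).edgeSlope e < (P j).edgeSlope f →
      (P i).edgeY e ξ' < (P j).edgeY f ξ') ∧
    ((P i).edgeY e ξ = (P j).edgeY f ξ → (P i).edgeSlope e = (P j).edgeSlope f →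
      (P i).edgeY e ξ' = (P j).edgeY f ξ')

theorem SimplePolygon.edgeY_eq_add (Q : SimplePolygon) (e : Fin Q.n) (ξ ξ' : ℝ) :
    Q.edgeY e ξ' = Q.edgeY e ξ + Q.edgeSlope e * (ξ' - ξ) := by
  unfold edgeY
  ring

theorem exists_isJustRight [Finite ι] (P : ι → SimplePolygon) (ξ : ℝ) :
    ∃ ξ', IsJustRight P ξ ξ' := by
  have h1 : ∀ᶠ ξ' : ℝ in 𝓝[>] ξ,
      ∀ i k, ((P i).poly k).1 ≠ ξ' ∧ (((P i).poly k).1 ≤ ξ ↔ ((P i).poly k).1 ≤ ξ') := by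
    rw [eventually_all]
    intro i
    rw [eventually_all]
    intro k
    rcases le_or_gt ((P i).poly k).1 ξ with h | h
    · filter_upwards [self_mem_nhdsWithin] with ξ' (hξ' : ξ < ξ')
      exact ⟨(h.trans_lt hξ').ne, fun _ => h.trans hξ'.le, fun _ => h⟩
    · filter_upwards [mem_nhdsWithin_of_mem_nhds (eventually_lt_nhds h)] with ξ' hξ'
      exact ⟨hξ'.ne', fun h' => absurd h' (not_le.2 h), fun h' => absurd h' (not_le.2 hξ')⟩
  have h2 : ∀ᶠ ξ' : ℝ in 𝓝[>] ξ, ∀ i e j f, ((P i).edgeY e ξ < (P j).edgeY f ξ →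
      (P i).edgeY e ξ' < (P j).edgeY f ξ') := by
    rw [eventually_all]
    intro i
    rw [eventually_all]
    intro e
    rw [eventually_all]
    intro j
    rw [eventually_all]
    intro f
    by_cases h : (P i).edgeY e ξ < (P j).edgeY f ξ
    · filter_upwards [mem_nhdsWithin_of_mem_nhds
        ((SimplePolygon.continuous_edgeY e).continuousAt.eventually_lt
          (SimplePolygon.continuous_edgeY f).continuousAt h)] with ξ' h' _
      exact h'
    · exact Eventually.of_forall fun _ h' => absurd h' h
  obtain ⟨ξ', ⟨h3, h4⟩, h5⟩ := ((h1.and h2).and self_mem_nhdsWithin).exists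
  have h6 : 0 < ξ' - ξ := sub_pos.2 h5
  refine ⟨ξ', h3, fun i e j f => ⟨h4 i e j f, fun h7 h8 => ?_, fun h7 h8 => ?_⟩⟩
  · rw [(P i).edgeY_eq_add e ξ, (P j).edgeY_eq_add f ξ, h7]
    nlinarith
  · rw [(P i).edgeY_eq_add e ξ, (P j).edgeY_eq_add f ξ, h7, h8]

namespace SimplePolygon.Segment

theorem parity_eq_zero_or_one {Q : SimplePolygon} (S : Segment Q) :
    S.parity = 0 ∨ S.parity = 1 := by
  unfold parity
  split_ifs
  · exact Or.inl rfl
  · exact Or.inr rfl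

theorem mem_xIoo_of_generic {Q : SimplePolygon} {S : Segment Q} {ξ : ℝ} (h : Q.IsGeneric ξ)
    (hξ : ξ ∈ S.xIco) : ξ ∈ S.xIoo := by
  obtain ⟨⟨v, ⟨i, hi, rfl⟩, h1⟩, h2⟩ := hξ
  exact ⟨⟨_, ⟨i, hi, rfl⟩, lt_of_le_of_ne h1 (h i)⟩, h2⟩

end SimplePolygon.Segment

section

variable {P : ι → SimplePolygon} {ξ ξ' : ℝ}

theorem IsJustRight.isGeneric (h : IsJustRight P ξ ξ') (i : ι) : (P i).IsGeneric ξ' :=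
  fun k => (h.1 i k).1

theorem IsJustRight.mem_xIco_iff (h : IsJustRight P ξ ξ') {i : ι} (S : (P i).Segment) :
    ξ ∈ S.xIco ↔ ξ' ∈ S.xIco := by
  constructor
  · rintro ⟨⟨_, ⟨k, hk, rfl⟩, h1⟩, _, ⟨l, hl, rfl⟩, h2⟩
    exact ⟨⟨_, ⟨k, hk, rfl⟩, (h.1 i k).2.1 h1⟩, _, ⟨l, hl, rfl⟩,
      not_le.1 fun h' => absurd ((h.1 i l).2.2 h') (not_le.2 h2)⟩
  · rintro ⟨⟨_, ⟨k, hk, rfl⟩, h1⟩, _, ⟨l, hl, rfl⟩, h2⟩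
    exact ⟨⟨_, ⟨k, hk, rfl⟩, (h.1 i k).2.2 h1⟩, _, ⟨l, hl, rfl⟩,
      not_le.1 fun h' => absurd ((h.1 i l).2.1 h') (not_le.2 h2)⟩

/-- Intervals closed on the left and open on the right are insensitive to a small move to the right.
-/
theorem IsJustRight.sweepSet_eq (h : IsJustRight P ξ ξ') : sweepSet P ξ = sweepSet P ξ' := by
  ext s
  exact and_congr_right fun _ => h.mem_xIco_iff s.2

theorem IsJustRight.activeEdge_eq (h : IsJustRight P ξ ξ') {i : ι} {S : (P i).Segment}
    (hS : S.MaxOutstretched) (hξ : ξ ∈ S.xIco) : S.activeEdge ξ' = S.activeEdge ξ := by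
  have hs := SimplePolygon.Segment.activeEdge_spec hξ
  refine SimplePolygon.Segment.activeEdge_eq hS.1 hs.1 ?_
  rw [SimplePolygon.mem_edgeIco, ← (h.1 i _).2, ← (h.1 i _).2, ← SimplePolygon.mem_edgeIco]
  exact hs.2

/-- Slope breaks ties in height at `ξ` exactly as height does slightly further right; equal height
and slope means equal height there too. -/
theorem IsJustRight.sweepLT_iff (h : IsJustRight P ξ ξ') {s t : SegPair P}
    (hs : s ∈ sweepSet P ξ) (ht : t ∈ sweepSet P ξ) :
    SweepLT P ξ s t ↔ t.2.yVal ξ' < s.2.yVal ξ' ∨ (s.2.yVal ξ' = t.2.yVal ξ' ∧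
      ((s.2.parity = 0 ∧ t.2.parity = 1) ∨
       (s.2.parity = 1 ∧ t.2.parity = 1 ∧ (P t.1).area < (P s.1).area) ∨
       (s.2.parity = 0 ∧ t.2.parity = 0 ∧ (P s.1).area < (P t.1).area))) := by
  obtain ⟨a1, a2, a3⟩ := h.2 s.1 (s.2.activeEdge ξ) t.1 (t.2.activeEdge ξ)
  obtain ⟨b1, b2, -⟩ := h.2 t.1 (t.2.activeEdge ξ) s.1 (s.2.activeEdge ξ)
  have es : s.2.yVal ξ' = (P s.1).edgeY (s.2.activeEdge ξ) ξ' := by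
    rw [SimplePolygon.Segment.yVal, h.activeEdge_eq hs.1 hs.2]
  have et : t.2.yVal ξ' = (P t.1).edgeY (t.2.activeEdge ξ) ξ' := by
    rw [SimplePolygon.Segment.yVal, h.activeEdge_eq ht.1 ht.2]
  rw [es, et]
  unfold SweepLT SimplePolygon.Segment.yVal SimplePolygon.Segment.slope
  rcases lt_trichotomy ((P s.1).edgeY (s.2.activeEdge ξ) ξ) ((P t.1).edgeY (t.2.activeEdge ξ) ξ)
    with h1 | h1 | h1
  · have := a1 h1
    simp only [h1.not_gt, h1.ne, this.not_gt, this.ne, false_and, or_self]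
  · rcases lt_trichotomy ((P s.1).edgeSlope (s.2.activeEdge ξ))
      ((P t.1).edgeSlope (t.2.activeEdge ξ)) with h2 | h2 | h2
    · have := a2 h1 h2
      simp only [h1, h2.not_gt, h2.ne, this.not_gt, this.ne, false_and, or_self, and_false,
        _root_.lt_irrefl]
    · have := a3 h1 h2
      simp only [h1, h2, this, _root_.lt_irrefl, true_and, false_or]
    · have := b2 h1.symm h2
      simp only [h1, h2, this, true_or, and_self, or_true]
  · have := b1 h1
    simp only [h1, this, true_or]

theorem ncard_sweepSet (P : ι → SimplePolygon) (ξ : ℝ) (i : ι) (p : ℝ → Prop) :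
    {s | s ∈ sweepSet P ξ ∧ s.1 = i ∧ p (s.2.yVal ξ)}.ncard =
      {e | ξ ∈ (P i).edgeIco e ∧ p ((P i).edgeY e ξ)}.ncard := by
  rw [← SimplePolygon.Segment.ncard_maxOutstretched, ← ncard_image_of_injective _
    (sigma_mk_injective : Function.Injective (Sigma.mk i : _ → SegPair P))]
  congr 1
  ext ⟨j, S⟩
  constructor
  · rintro ⟨⟨h1, h2⟩, rfl, h3⟩
    exact ⟨S, ⟨h1, h2, h3⟩, rfl⟩
  · rintro ⟨T, ⟨h1, h2, h3⟩, h⟩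
    obtain ⟨rfl, h⟩ := Sigma.mk.inj h
    obtain rfl := eq_of_heq h
    exact ⟨⟨h1, h2⟩, rfl, h3⟩

theorem mem_xIco_iff_exists_mem_sweepSet (i : ι) :
    ξ ∈ (P i).xIco ↔ ∃ s ∈ sweepSet P ξ, s.1 = i := by
  rw [SimplePolygon.mem_xIco_iff]
  constructor
  · rintro ⟨e, he⟩
    have h := (P i).segOf_spec e (SimplePolygon.not_vertical_of_mem he)
    exact ⟨⟨i, _⟩, ⟨h.1, SimplePolygon.Segment.mem_xIco_of_edge h.2 he⟩, rfl⟩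
  · rintro ⟨s, hs, rfl⟩
    exact ⟨_, (SimplePolygon.Segment.activeEdge_spec hs.2).2⟩

theorem inside_injective (hdist : Function.Injective fun i => (P i).curve) :
    Function.Injective fun i => (P i).inside :=
  fun _ _ h => hdist (SimplePolygon.curve_eq_of_inside_eq h)

theorem ssubset_or_ssubset (hdist : Function.Injective fun i => (P i).curve)
    (hov : OverlapFree (range fun i => (P i).inside)) {i j : ι} (hij : i ≠ j)
    (h : ((P i).inside ∩ (P j).inside).Nonempty) :
    (P i).inside ⊂ (P j).inside ∨ (P j).inside ⊂ (P i).inside := by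
  have hne : (P i).inside ≠ (P j).inside := fun h => hij (inside_injective hdist h)
  have := hov _ ⟨i, rfl⟩ _ ⟨j, rfl⟩
  unfold Overlap at this
  by_cases h1 : (P i).inside ∩ (P j).inside = (P i).inside
  · exact Or.inl ((inter_eq_left.1 h1).ssubset_of_ne hne)
  · by_cases h2 : (P i).inside ∩ (P j).inside = (P j).inside
    · exact Or.inr ((inter_eq_right.1 h2).ssubset_of_ne hne.symm)
    · exact absurd ⟨h1, h2, h.ne_empty⟩ this

instance (Q : SimplePolygon) : Finite Q.Segment :=
  Finite.of_injective (fun S => (S.start, S.len)) fun S T h => by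
    cases S; cases T
    simpa using h

/-- The crossings of the polygons with a vertical line through no corner. -/
noncomputable def sweepCrossings [Finite ι] (hdist : Function.Injective fun i => (P i).curve)
    (hov : OverlapFree (range fun i => (P i).inside)) (hξ : ∀ i, (P i).IsGeneric ξ) :
    LineCrossings (SegPair P) ι where
  M := sweepSet P ξ
  finite := toFinite _
  pol s := s.1
  y s := s.2.yVal ξ
  par s := s.2.parity
  area i := (P i).area
  ins i := (P i).inside
  x := ξ
  inj := by
    rintro ⟨i, S⟩ ⟨hS, hS'⟩ ⟨j, T⟩ ⟨hT, hT'⟩ hij hy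
    obtain rfl : i = j := hij
    have := (hξ i).edgeY_injOn (SimplePolygon.Segment.activeEdge_spec hS').2
      (SimplePolygon.Segment.activeEdge_spec hT').2 hy
    exact congrArg (Sigma.mk i) (SimplePolygon.Segment.activeEdge_injOn ξ ⟨hS, hS'⟩ ⟨hT, hT'⟩ this)
  mem_ins_iff := by
    intro i z hz
    have hz' : (ξ, z) ∉ (P i).curve := by
      rw [(hξ i).mem_curve_iff]
      rintro ⟨e, he, rfl⟩
      have h := (P i).segOf_spec e (SimplePolygon.not_vertical_of_mem he)
      refine hz ⟨i, _⟩ ⟨h.1, SimplePolygon.Segment.mem_xIco_of_edge h.2 he⟩ rfl ?_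
      change (P i).edgeY (((P i).segOf e
        (SimplePolygon.not_vertical_of_mem he)).activeEdge ξ) ξ = (P i).edgeY e ξ
      rw [SimplePolygon.Segment.activeEdge_eq h.1.1 h.2 he]
    rw [ncard_sweepSet P ξ i fun y => z < y, SimplePolygon.mem_inside_iff, and_iff_right hz',
      SimplePolygon.crossSum_eq_ncard, ZMod.natCast_eq_one_iff_odd]
    simp only [mem_univ, true_and]
  -- A generic abscissa in the half-open interval of a segment is in the open one, where the parity
  -- can be read off.
  par_iff := by
    rintro s ⟨h1, h2⟩
    rw [ncard_sweepSet P ξ s.1 fun y => s.2.yVal ξ ≤ y, ← SimplePolygon.Segment.ncard_above,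
      ← Nat.not_even_iff_odd, ← SimplePolygon.Segment.parity_eq_zero_iff h1.1
        (SimplePolygon.Segment.mem_xIoo_of_generic (hξ _) h2)]
    have := s.2.parity_eq_zero_or_one
    omega
  par_eq s := s.2.parity_eq_zero_or_one
  laminar _ _ hij h := ssubset_or_ssubset hdist hov hij h
  area_lt _ _ h := SimplePolygon.area_lt_of_inside_ssubset h

end

/-! ### The nesting forest -/

section

variable {P : ι → SimplePolygon}

theorem isParent_iff {i j : ι} : IsParent P j i ↔ (P i).inside ⊂ (P j).inside ∧
    ¬ ∃ k, (P i).inside ⊂ (P k).inside ∧ (P k).inside ⊂ (P j).inside := by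
  constructor
  · rintro ⟨h | h, h'⟩
    · exact h
    · exact absurd (h.1.trans h') (ssubset_irrefl _)
  · intro h
    exact ⟨Or.inl h, h.1⟩

/-- A minimal strict superset is unique: two of them share the points of the region of `i`, so they
are comparable. -/
theorem exists_isParentFunction [Finite ι] (hdist : Function.Injective fun i => (P i).curve)
    (hov : OverlapFree (range fun i => (P i).inside)) : ∃ par, IsParentFunction P par := by
  have h : ∀ i, ∃ o : Option ι, (o = none ↔ IsRoot P i) ∧ ∀ j, o = some j ↔ IsParent P j i := by
    intro i
    by_cases hr : IsRoot P i
    · refine ⟨none, iff_of_true rfl hr, fun j => iff_of_false (by simp) fun hj => ?_⟩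
      exact hr ⟨j, hj.2⟩
    have hne : {j | (P i).inside ⊂ (P j).inside}.Nonempty := not_not.1 hr
    obtain ⟨j, hj, hmin⟩ := (toFinite _).exists_minimalFor (fun j => (P j).inside) _ hne
    refine ⟨some j, iff_of_false (by simp) hr, fun k => ?_⟩
    have hjp : IsParent P j i := isParent_iff.2 ⟨hj, fun ⟨k, h1, h2⟩ => h2.2 (hmin h1 h2.1)⟩
    rw [Option.some_inj]
    refine ⟨fun h => h ▸ hjp, fun hk => ?_⟩
    by_contra hjk
    obtain ⟨p, hp⟩ := (P i).inside_nonempty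
    rw [isParent_iff] at hk hjp
    rcases ssubset_or_ssubset hdist hov hjk ⟨p, hjp.1.1 hp, hk.1.1 hp⟩ with h | h
    · exact hk.2 ⟨j, hjp.1, h⟩
    · exact hjp.2 ⟨k, hk.1, h⟩
  choose par hpar using h
  exact ⟨par, hpar⟩

/-- The parent depends only on the strict supersets; this justifies copying a parent in case (c). -/
theorem IsParentFunction.eq_of_ssubset_iff {par : ι → Option ι} (h : IsParentFunction P par)
    {i j : ι} (hij : ∀ k, (P i).inside ⊂ (P k).inside ↔ (P j).inside ⊂ (P k).inside) :
    par i = par j := by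
  ext k
  rw [(h i).2 k, (h j).2 k, isParent_iff, isParent_iff]
  simp only [hij]

/-! ### The run of the procedure -/

theorem exists_list_of_isStrictTotalOrder {α : Type*} {M : Set α} (hM : M.Finite)
    {r : α → α → Prop} (h : IsStrictTotalOrder M fun a b => r a b) :
    ∃ L : List α, L.Nodup ∧ (∀ a, a ∈ L ↔ a ∈ M) ∧ L.Pairwise r := by
  classical
  have := hM.fintype
  let _ : LinearOrder M := linearOrderOfSTO fun a b : M => r a b
  refine ⟨((Finset.univ : Finset M).sort).map Subtype.val, ?_, ?_, ?_⟩
  · exact (Finset.sort_nodup _ _).map Subtype.val_injective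
  · simp
  · rw [List.pairwise_map]
    exact (Finset.sortedLT_sort _).pairwise

/-- What the procedure needs to know about the order and the parent function. -/
structure SweepCorrect (P : ι → SimplePolygon) (ξ : ℝ) (par : ι → Option ι) : Prop where
  irrefl : ∀ s ∈ sweepSet P ξ, ¬ SweepLT P ξ s s
  trans : ∀ s ∈ sweepSet P ξ, ∀ t ∈ sweepSet P ξ, ∀ u ∈ sweepSet P ξ,
    SweepLT P ξ s t → SweepLT P ξ t u → SweepLT P ξ s u
  trichotomous : ∀ s ∈ sweepSet P ξ, ∀ t ∈ sweepSet P ξ, s ≠ t →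
    SweepLT P ξ s t ∨ SweepLT P ξ t s
  first : ∀ s, IsFirstOfPolygon P ξ s → IsFirst P ξ s → par s.1 = none
  pred_one : ∀ s t, IsFirstOfPolygon P ξ s → IsPred P ξ t s → t.2.parity = 1 → par s.1 = some t.1
  pred_zero : ∀ s t, IsFirstOfPolygon P ξ s → IsPred P ξ t s → t.2.parity ≠ 1 →
    par s.1 = par t.1

theorem sweepCorrect [Finite ι] (hdist : Function.Injective fun i => (P i).curve)
    (hov : OverlapFree (range fun i => (P i).inside)) {par : ι → Option ι}
    (hpar : IsParentFunction P par) (ξ : ℝ) : SweepCorrect P ξ par := by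
  obtain ⟨ξ', hξ'⟩ := exists_isJustRight P ξ
  let C := sweepCrossings hdist hov hξ'.isGeneric
  have hM : C.M = sweepSet P ξ := hξ'.sweepSet_eq.symm
  have hlt : ∀ {s t}, s ∈ sweepSet P ξ → t ∈ sweepSet P ξ → (SweepLT P ξ s t ↔ C.Lt s t) :=
    fun hs ht => hξ'.sweepLT_iff hs ht
  have hfirst : ∀ {s}, IsFirstOfPolygon P ξ s → C.FirstOfPol s := by
    intro s hs
    refine ⟨hM ▸ hs.1, fun t ht hts hne => ?_⟩
    rw [hM] at ht
    exact (hlt hs.1 ht).1 (hs.2 t ht hts hne)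
  have hpred : ∀ {s t}, s ∈ sweepSet P ξ → IsPred P ξ t s → C.Pred t s := by
    rintro s t hs ⟨h1, h2, h3⟩
    refine ⟨hM ▸ h1, (hlt h1 hs).1 h2, ?_⟩
    rintro ⟨u, hu, h4, h5⟩
    rw [hM] at hu
    exact h3 ⟨u, hu, (hlt h1 hu).2 h4, (hlt hu hs).2 h5⟩
  refine ⟨?_, ?_, ?_, ?_, ?_, ?_⟩
  · intro s hs
    rw [hlt hs hs]
    exact LineCrossings.lt_irrefl s
  · intro s hs t ht u hu
    rw [hlt hs ht, hlt ht hu, hlt hs hu]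
    exact LineCrossings.Lt.trans
  · intro s hs t ht hst
    rw [hlt hs ht, hlt ht hs]
    exact LineCrossings.lt_trichotomous (hM ▸ hs) (hM ▸ ht) hst
  · intro s hs hs'
    rw [(hpar s.1).1]
    rintro ⟨R, hR⟩
    refine (hfirst hs).not_ssubset_of_first (fun t ht hne => ?_) R hR
    rw [hM] at ht
    exact (hlt hs.1 ht).1 (hs'.2 t ht hne)
  · intro s t hs ht h1
    rw [(hpar s.1).2, isParent_iff]
    exact (hfirst hs).parent_of_pred_par_one (hpred hs.1 ht) h1
  · intro s t hs ht h1
    have h0 : t.2.parity = 0 := t.2.parity_eq_zero_or_one.resolve_right h1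
    exact hpar.eq_of_ssubset_iff fun k =>
      (hfirst hs).ssubset_iff_of_pred_par_zero (hpred hs.1 ht) h0 k

variable {ξ : ℝ} {par : ι → Option ι}

theorem SweepCorrect.isStrictTotalOrder (h : SweepCorrect P ξ par) :
    IsStrictTotalOrder (sweepSet P ξ) fun s t => SweepLT P ξ s t where
  irrefl s := h.irrefl s s.2
  trans s t u := h.trans s s.2 t t.2 u u.2
  trichotomous s t h1 h2 := by
    by_contra hne
    rcases h.trichotomous s s.2 t t.2 (fun h' => hne (Subtype.ext h')) with h' | h'
    · exact h1 h'
    · exact h2 h'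

/-- Among the elements before `s`, one with the most elements before it is the predecessor. -/
theorem SweepCorrect.exists_pred (h : SweepCorrect P ξ par) (hfin : (sweepSet P ξ).Finite)
    {s : SegPair P} (hs : s ∈ sweepSet P ξ) (hs' : ¬ IsFirst P ξ s) : ∃ t, IsPred P ξ t s := by
  have hne : {u | u ∈ sweepSet P ξ ∧ SweepLT P ξ u s}.Nonempty := by
    by_contra hc
    refine hs' ⟨hs, fun t ht hts => (h.trichotomous s hs t ht hts.symm).resolve_right fun h' => ?_⟩
    exact hc ⟨t, ht, h'⟩
  obtain ⟨t, ⟨h1, h2⟩, hmax⟩ := (hfin.subset fun u hu => hu.1).exists_maximalFor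
    (fun u => {v | v ∈ sweepSet P ξ ∧ SweepLT P ξ v u}.ncard) _ hne
  refine ⟨t, h1, h2, ?_⟩
  rintro ⟨u, hu, h3, h4⟩
  have hlt : {v | v ∈ sweepSet P ξ ∧ SweepLT P ξ v t}.ncard <
      {v | v ∈ sweepSet P ξ ∧ SweepLT P ξ v u}.ncard := by
    refine ncard_lt_ncard ⟨fun v hv => ⟨hv.1, h.trans v hv.1 t h1 u hu hv.2 h3⟩, fun hsub => ?_⟩
      (hfin.subset fun u hu => hu.1)
    exact h.irrefl t h1 (hsub ⟨h1, h3⟩).2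
  exact absurd (hmax ⟨hu, h4⟩ hlt.le) (not_le.2 hlt)

open Classical in
/-- After part of the list has been processed, exactly the polygons met so far have been assigned
their parents. -/
theorem SweepCorrect.foldl_eq (h : SweepCorrect P ξ par) (hfin : (sweepSet P ξ).Finite)
    {L : List (SegPair P)} (hL : IsSweepList P ξ L) (L₁ : List (SegPair P)) (hpre : L₁ <+: L)
    (i : ι) : L₁.foldl (sweepStep P ξ) (fun _ => none) i =
      if ∃ s ∈ L₁, s.1 = i then some (par i) else none := by
  induction L₁ using List.reverseRecOn generalizing i with
  | nil => simp
  | append_singleton L₁ s ih =>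
    replace ih := ih ((List.prefix_append _ _).trans hpre)
    obtain ⟨L₂, rfl⟩ := hpre
    obtain ⟨hnd, hmem, hpw⟩ := hL
    rw [List.append_assoc, List.singleton_append] at hpw hnd hmem
    have hsM : s ∈ sweepSet P ξ := (hmem s).1 (by simp)
    have hltL : ∀ {t}, t ∈ sweepSet P ξ → SweepLT P ξ t s → t ∈ L₁ := by
      intro t ht hts
      have ht' := (hmem t).2 ht
      rw [List.mem_append, List.mem_cons] at ht'
      rcases ht' with h1 | rfl | h1
      · exact h1
      · exact absurd hts (h.irrefl _ hsM)
      · rw [List.pairwise_append] at hpw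
        have h2 := (List.pairwise_cons.1 hpw.2.1).1 t h1
        exact absurd (h.trans _ hsM _ ht _ hsM h2 hts) (h.irrefl _ hsM)
    rw [List.foldl_append, List.foldl_cons, List.foldl_nil]
    -- Every step amounts to writing the true parent: when `s` is not the first of its polygon, an
    -- earlier segment has already written it and the update changes nothing.
    have hstep : sweepStep P ξ (L₁.foldl (sweepStep P ξ) fun _ => none) s =
        Function.update (L₁.foldl (sweepStep P ξ) fun _ => none) s.1 (some (par s.1)) := by
      by_cases hf : IsFirstOfPolygon P ξ s
      · rw [sweepStep, if_pos hf]
        by_cases hf' : IsFirst P ξ s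
        · rw [if_pos hf', h.first s hf hf']
        · have hex := h.exists_pred hfin hsM hf'
          rw [if_neg hf', dif_pos hex]
          have hp := hex.choose_spec
          split_ifs with h1
          · rw [h.pred_one s _ hf hp h1]
          -- The predecessor was processed earlier, so the copied state is already the parent of its
          -- polygon.
          · rw [ih, if_pos ⟨_, hltL hp.1 hp.2.1, rfl⟩, h.pred_zero s _ hf hp h1]
      · rw [sweepStep, if_neg hf]
        have hex : ∃ t ∈ L₁, t.1 = s.1 := by
          by_contra! hc
          refine hf ⟨hsM, fun t ht hts hne => ?_⟩
          exact (h.trichotomous s hsM t ht hne.symm).resolve_right fun h' =>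
            hc t (hltL ht h') hts
        rw [Function.update_eq_self_iff.2]
        rw [ih, if_pos hex]
    rw [hstep]
    by_cases hi : i = s.1
    · subst hi
      rw [Function.update_self, if_pos ⟨s, by simp, rfl⟩]
    · rw [Function.update_of_ne hi, ih]
      congr 1
      refine propext ⟨fun ⟨t, h1, h2⟩ => ⟨t, by simp [h1], h2⟩, fun ⟨t, h1, h2⟩ => ?_⟩
      rw [List.mem_append, List.mem_singleton] at h1
      rcases h1 with h1 | rfl
      · exact ⟨t, h1, h2⟩
      · exact absurd h2.symm hi

theorem SweepCorrect.exists_list (h : SweepCorrect P ξ par) (hfin : (sweepSet P ξ).Finite) :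
    ∃ L, IsSweepList P ξ L :=
  exists_list_of_isStrictTotalOrder hfin h.isStrictTotalOrder

theorem SweepCorrect.sweepAssigns_iff (h : SweepCorrect P ξ par) (hfin : (sweepSet P ξ).Finite)
    (i : ι) (r : Option ι) : SweepAssigns P ξ i r ↔ ξ ∈ (P i).xIco ∧ par i = r := by
  classical
  rw [mem_xIco_iff_exists_mem_sweepSet]
  have key : ∀ L, IsSweepList P ξ L →
      (runSweep P ξ L i = some r ↔ (∃ s ∈ sweepSet P ξ, s.1 = i) ∧ par i = r) := by
    intro L hL
    rw [runSweep, h.foldl_eq hfin hL L List.prefix_rfl i]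
    simp only [hL.2.1]
    split_ifs with h1
    · rw [Option.some_inj, and_iff_right h1]
    · exact iff_of_false (by simp) fun h' => h1 h'.1
  constructor
  · rintro ⟨L, hL, h1⟩
    exact (key L hL).1 h1
  · intro h1
    obtain ⟨L, hL⟩ := h.exists_list hfin
    exact ⟨L, hL, (key L hL).2 h1⟩

theorem sweepComputes [Finite ι] (hdist : Function.Injective fun i => (P i).curve)
    (hov : OverlapFree (range fun i => (P i).inside)) (hpar : IsParentFunction P par)
    {X : Set ℝ} (hX : MeetsAll P X) : SweepComputes P X par := by
  have hfin : ∀ ξ, (sweepSet P ξ).Finite := fun ξ => toFinite _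
  have h := sweepCorrect hdist hov hpar
  refine ⟨fun ξ _ => ⟨(h ξ).isStrictTotalOrder, (h ξ).exists_list (hfin ξ), fun i => ?_⟩,
    fun i r => ?_⟩
  · simp only [(h ξ).sweepAssigns_iff (hfin ξ)]
    exact ⟨fun ⟨_, h1, _⟩ => h1, fun h1 => ⟨_, h1, rfl⟩⟩
  · constructor
    · rintro ⟨ξ, -, h1⟩
      exact (((h ξ).sweepAssigns_iff (hfin ξ) i r).1 h1).2
    · intro h1
      obtain ⟨ξ, hξ, h2⟩ := hX i
      exact ⟨ξ, hξ, ((h ξ).sweepAssigns_iff (hfin ξ) i r).2 ⟨h2, h1⟩⟩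

/-- The half-open interval contains its minimum once it is nonempty, which a non-vertical edge
guarantees. -/
theorem SimplePolygon.minX_mem_xIco (Q : SimplePolygon) : Q.minX ∈ Q.xIco := by
  obtain ⟨e, he⟩ := Q.exists_not_vertical
  have hle : ∀ i, Q.minX ≤ (Q.poly i).1 := fun i => ciInf_le (finite_range _).bddBelow i
  have : Nonempty (Fin Q.n) := ⟨e⟩
  obtain ⟨i, hi⟩ := exists_eq_ciInf_of_finite (f := fun i : Fin Q.n => (Q.poly i).1)
  refine ⟨⟨Q.poly i, ⟨i, rfl⟩, hi.le⟩, ?_⟩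
  by_contra! hc
  have heq : ∀ k, (Q.poly k).1 = Q.minX := fun k => le_antisymm (hc _ ⟨k, rfl⟩) (hle k)
  exact he ((heq _).trans (heq _).symm)

end

end Nesting

open Nesting in
theorem mainTheorem5 {ι : Type*} [Finite ι] (P : ι → SimplePolygon)
    (hdist : Function.Injective fun i => (P i).curve)
    (hov : OverlapFree (Set.range fun i => (P i).inside)) :
    ∃ par : ι → Option ι, IsParentFunction P par ∧
      (∀ X : Set ℝ, X.Finite → MeetsAll P X → SweepComputes P X par) ∧
      MeetsAll P (Set.range fun i => (P i).minX) ∧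
      SweepComputes P (Set.range fun i => (P i).minX) par := by
  obtain ⟨par, hpar⟩ := exists_isParentFunction hdist hov
  have hmeet : MeetsAll P (Set.range fun i => (P i).minX) := fun i =>
    ⟨_, ⟨i, rfl⟩, (P i).minX_mem_xIco⟩
  exact ⟨par, hpar, fun X _ hX => sweepComputes hdist hov hpar hX, hmeet,
    sweepComputes hdist hov hpar hmeet⟩
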